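/- Let $N\ge 1$. All function spaces are over $\mathbb R^N$. We consider $$\partial_t\rho=\nabla\cdot\big(\rho\,(\nabla W*\rho)\big)+\Delta\rho,\qquad \rho(0,\cdot)=\rho_0, \tag{1}$$ where $W:\mathbb R^N\to\mathbb R$ is locally integrable with weak gradient $\nabla W$. Let $G(t,x)=(4\pi t)^{-N/2}e^{-|x|^2/(4t)}$, $e^{t\Delta}f=G(t,\cdot)*f$ and $\nabla e^{t\Delta}F=\sum_{i=1}^N\partial_{i}G(t,\cdot)*F_i$ for a vector field $F$. For $T\in(0,\infty]$ and $p\in[1,\infty]$, a mild solution of (1) on $[0,T)$ of class $p$ is a function $\rho\in C([0,T);L^1)$ with $\rho_t\in L^p$ for all $t\in[0,T)$ and $\sup_{0\le t\le t_1}\|\rho_t\|_p<\infty$ for every $t_1<T$, with value $\rho_0$ at time $0$, such that for every $t\in(0,T)$, almost everywhere in $x$, $$\rho_t=e^{t\Delta}\rho_0+\int_0^t\nabla e^{(t-s)\Delta}\big(\rho_s(\nabla W*\rho_s)\big)\,ds .$$ (This includes every mild solution in $C([0,T);L^1\cap L^p)$.) We write $\|f\|_{H^m}^2=\sum_{|\gamma|\le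 m}\|\partial^\gamma f\|_2^2$, and $\|\nabla W\|_q$ is the $L^q$ norm of the Euclidean length $|\nabla W|$. (i) Let $\rho_0\ge 0$ with $\rho_0\in L^1$. There is a constant $C\ge 0$, depending only on $\rho_0$ and $N$, such that the following holds. Let $p,q\in[1,\infty]$ with $\frac1p+\frac1q=1$, let $\rho_0\in L^p$, $\nabla W\in (L^q\cap L^\infty)^N$, $T\in(0,\infty]$, and let $\rho$ be a mild solution on $[0,T)$ of class $p$ with initial datum $\rho_0$. Then for all $t\in[0,T)$ $$\|\rho_t\|_1=\|\rho_0\|_1,\qquad \|\rho_t\|_p\le\|\rho_0\|_p\,\exp\!\big(C\,\|\nabla W\|_\infty\,\|\rho_0\|_1\,\sqrt t\,\big).$$ (ii) Let $m\ge 1$ be an integer and $\rho_0\in H^m\cap L^1\cap L^\infty$. There is a function $C_m(t)$, bounded on every bounded interval of times $t\ge 0$ and depending only on $m$, $N$, $\rho_0$, $\|\nabla W\|_1$ and $\|\nabla W\|_\infty$, such that for every $W$ with $\nabla W\in(L^1\cap L^\infty)^N$, every $p\in[1,\infty]$, every $T\in(0,\infty]$ and every mild solution $\rho$ on $[0,T)$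 of class $p$ with initial datum $\rho_0$ and $\rho\in C([0,T);H^m)$, one has for all $t\in[0,T)$ $$\|\rho_t\|_{H^m}\le C_m(t)\,\|\rho_0\|_{H^m}.$$ -/

import Mathlib

open MeasureTheory Filter Topology Set
open scoped ENNReal NNReal ContDiff

noncomputable section

/-- Euclidean space of dimension `N`. -/
abbrev Space (N : ℕ) : Type := EuclideanSpace ℝ (Fin N)

/-- The classical partial derivative in the `i`-th coordinate. -/
def partialDeriv {N : ℕ} (i : Fin N) (f : Space N → ℝ) : Space N → ℝ :=
  fun x => fderiv ℝ f x (EuclideanSpace.single i 1)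

/-- The classical derivative `∂₁^{γ₁} ∂₂^{γ₂} ⋯ ∂_N^{γ_N} f` for a multi-index `γ`. -/
def multiDeriv {N : ℕ} (γ : Fin N → ℕ) (f : Space N → ℝ) : Space N → ℝ :=
  (List.finRange N).foldr (fun i g => (partialDeriv i)^[γ i] g) f

/-- `g` is the generalized (weak) derivative `∂^γ f`, tested against smooth functions with
compact support. -/
def HasWeakDeriv {N : ℕ} (γ : Fin N → ℕ) (f g : Space N → ℝ) : Prop :=
  LocallyIntegrable f volume ∧ LocallyIntegrable g volume ∧
    ∀ φ : Space N → ℝ, ContDiff ℝ ∞ φ → HasCompactSupport φ →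
      ∫ x, f x * multiDeriv γ φ x = (-1 : ℝ) ^ (∑ i, γ i) * ∫ x, g x * φ x

/-- `V` is the weak gradient of `W`. -/
def HasWeakGradient {N : ℕ} (W : Space N → ℝ) (V : Space N → Space N) : Prop :=
  ∀ i : Fin N, HasWeakDeriv (Pi.single i 1) W (fun x => V x i)

/-- A chosen weak derivative `∂^γ f` (unique up to null sets), and `0` if there is none. -/
def weakDeriv {N : ℕ} (γ : Fin N → ℕ) (f : Space N → ℝ) : Space N → ℝ :=
  open Classical in if h : ∃ g, HasWeakDeriv γ f g then h.choose else 0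

/-- The multi-indices `γ` with `|γ| ≤ m`. -/
def multiIndices (N m : ℕ) : Finset (Fin N → ℕ) :=
  (Finset.range (m + 1)).biUnion (fun k => Finset.piAntidiag Finset.univ k)

/-- Membership in `H^m = W^{m,2}`: all weak derivatives up to order `m` exist and lie in `L²`. -/
def MemH {N : ℕ} (m : ℕ) (f : Space N → ℝ) : Prop :=
  ∀ γ ∈ multiIndices N m, ∃ g, HasWeakDeriv γ f g ∧ MemLp g 2 volume

/-- The norm `‖f‖_{H^m} = (∑_{|γ| ≤ m} ‖∂^γ f‖₂²)^{1/2}`, meaningful for `f` in `H^m`. -/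
def normH {N : ℕ} (m : ℕ) (f : Space N → ℝ) : ℝ :=
  Real.sqrt (∑ γ ∈ multiIndices N m, (eLpNorm (weakDeriv γ f) 2 volume).toReal ^ 2)

/-- The heat kernel `G(t,x) = (4πt)^{-N/2} exp(-|x|²/(4t))`. -/
def heatKernel {N : ℕ} (t : ℝ) (x : Space N) : ℝ :=
  1 / (4 * Real.pi * t) ^ ((N : ℝ) / 2) * Real.exp (-‖x‖ ^ 2 / (4 * t))

/-- The heat semigroup `e^{tΔ} f = G(t,·) * f`. -/
def heatSemigroup {N : ℕ} (t : ℝ) (f : Space N → ℝ) (x : Space N) : ℝ :=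
  ∫ y, heatKernel t (x - y) * f y

/-- `∇ e^{tΔ} F = ∑ᵢ ∂ᵢ G(t,·) * Fᵢ` for a vector field `F`. -/
def heatDivergence {N : ℕ} (t : ℝ) (F : Space N → Space N) (x : Space N) : ℝ :=
  ∫ y, inner ℝ (gradient (heatKernel t) (x - y)) (F y)

/-- The convolution `V * f` of a vector field with a function. -/
def convField {N : ℕ} (V : Space N → Space N) (f : Space N → ℝ) (x : Space N) : Space N :=
  ∫ y, f y • V (x - y)

/-- The time interval `[0, T)`, where `T = ∞` is allowed. -/
def timeInterval (T : EReal) : Set ℝ := {t | 0 ≤ t ∧ (t : EReal) < T}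

/-- `ρ` is a mild solution on `[0, T)` of `∂ₜρ = ∇ · (ρ (∇W * ρ)) + Δρ`, where `V = ∇W`, with
initial datum `ρ₀`, in the class `C([0,T); L¹) ∩ L^∞_loc([0,T); L^p)`. The class contains
`C([0,T); L¹ ∩ L^p)`; for `p = ∞` continuity at time `0` in `L^∞` is not required, since the heat
semigroup is not strongly continuous on `L^∞`. When `V` is bounded, the integrand in Duhamel's
formula is, for almost every `x`, integrable in `s` over `(0, t)`. -/
structure IsMildSolution {N : ℕ} (p : ℝ≥0∞) (V : Space N → Space N) (T : EReal)
    (ρ₀ : Space N → ℝ) (ρ : ℝ → Space N → ℝ) : Prop where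
  memLp_one : ∀ t ∈ timeInterval T, MemLp (ρ t) 1 volume
  continuous_one : ∀ t₀ ∈ timeInterval T,
    Tendsto (fun t => eLpNorm (ρ t - ρ t₀) 1 volume) (𝓝[timeInterval T] t₀) (𝓝 0)
  memLp : ∀ t ∈ timeInterval T, MemLp (ρ t) p volume
  locallyBounded : ∀ t₁ ∈ timeInterval T, ∃ R : ℝ≥0, ∀ t ∈ Icc 0 t₁, eLpNorm (ρ t) p volume ≤ R
  initial : ρ 0 =ᵐ[volume] ρ₀
  duhamel : ∀ t ∈ timeInterval T, 0 < t → ∀ᵐ x ∂volume,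
    ρ t x = heatSemigroup t ρ₀ x +
      ∫ s in (0 : ℝ)..t, heatDivergence (t - s) (fun y => ρ s y • convField V (ρ s) y) x

/-- `ρ ∈ C([0,T); H^m)`. -/
def ContinuousInH {N : ℕ} (m : ℕ) (T : EReal) (ρ : ℝ → Space N → ℝ) : Prop :=
  (∀ t ∈ timeInterval T, MemH m (ρ t)) ∧
    ∀ t₀ ∈ timeInterval T,
      Tendsto (fun t => normH m (ρ t - ρ t₀)) (𝓝[timeInterval T] t₀) (𝓝 0)

end

noncomputable section

/-! Freeze the drift: a mild solution solves the linear equation `∂ₜρ = ∇·(ρ b) + Δρ` with `b = ∇W *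
ρ`, and `|b| ≤ B = ‖∇W‖_∞ ‖ρ₀‖₁` as soon as the `L¹` norm is known not to grow. The linear equation
is studied through a splitting scheme: in a step of length `η` the mass at `y` is moved to `y - η
b(y)` and then diffused by the heat flow. A step keeps the integral and does not increase the `L¹`
norm, and the scheme converges to `ρ` in `L¹` (`IsDriftSolution.tendsto_eulerScheme`). So the
integral is conserved and the `L¹` norm does not grow; for a nonnegative datum the two together give
equality of the norms.

A Gronwall argument for the singular kernel `|∇G|` would put `B² t` into the exponent of the `L^p`
bound. To reach `B √t`, the scheme is tested against exponentials `e^{w·z}`: each step multiplies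
them by at most `e^{(|w|² + |w| B) η}`, whatever the direction of `w`. Hence an average of `ρ_t`
over a Gaussian of variance of order `τ` is at most the convolution of `|ρ₀|` with a multiple of
`e^{-β|z|}` (`IsDriftSolution.enorm_heatSemigroup_le`); for `β = t^{-1/2}` that kernel has mass of
order `(t/τ)^{N/2} e^{B √t}`. With `τ` of order `B^{-2}` the Duhamel term over the last `τ` units of
time can be absorbed, and what remains is a power of `B √t` times `e^{B √t}`
(`IsDriftSolution.eLpNorm_le_exp`).

The Sobolev bound goes by induction on the order `k` of the derivatives, order zero being the `L²`
case of the `L^p` bound. Derivatives of `∇W * ρ` fall on `ρ` and are bounded in the sup norm by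
`‖∇W‖₂ ‖∂^γ ρ‖₂`. In every term of the Leibniz rule for `ρ (∇W * ρ)` one of the two factors carries
fewer than `k` derivatives and is already controlled, so the inequality for order `k` is linear and
closes in a norm weighted exponentially in time (`IsDriftSolution.eLpNorm_weakDeriv_step`). All
derivatives are kept on test functions, where they commute with the translations out of which
convolutions are built. -/

variable {N : ℕ}

/-! ### The heat kernel -/

/-- The maximum `(4πt)^{-N/2}` of the heat kernel. -/
def heatPeak (N : ℕ) (t : ℝ) : ℝ := 1 / (4 * Real.pi * t) ^ ((N : ℝ) / 2)

lemma heatPeak_pos {t : ℝ} (ht : 0 < t) : 0 < heatPeak N t := by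
  have := Real.pi_pos
  unfold heatPeak
  positivity

lemma heatKernel_eq (t : ℝ) (x : Space N) :
    heatKernel t x = heatPeak N t * Real.exp (-(1 / (4 * t)) * ‖x‖ ^ 2) := by
  unfold heatKernel heatPeak
  congr 2
  ring

lemma heatKernel_pos {t : ℝ} (ht : 0 < t) (x : Space N) : 0 < heatKernel t x := by
  rw [heatKernel_eq]
  exact mul_pos (heatPeak_pos ht) (Real.exp_pos _)

lemma heatKernel_le {t : ℝ} (ht : 0 < t) (x : Space N) : heatKernel t x ≤ heatPeak N t := by
  rw [heatKernel_eq]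
  refine mul_le_of_le_one_right (heatPeak_pos ht).le (Real.exp_le_one_iff.2 ?_)
  have : 0 ≤ 1 / (4 * t) * ‖x‖ ^ 2 := by positivity
  linarith

lemma heatKernel_neg (t : ℝ) (x : Space N) : heatKernel t (-x) = heatKernel t x := by
  simp [heatKernel]

lemma continuous_heatKernel (t : ℝ) : Continuous (heatKernel (N := N) t) := by
  have : heatKernel (N := N) t =
      fun x => heatPeak N t * Real.exp (-(1 / (4 * t)) * ‖x‖ ^ 2) := by
    ext x; exact heatKernel_eq t x
  rw [this]
  fun_prop

lemma continuousAt_uncurry_heatKernel {t : ℝ} (ht : 0 < t) (x : Space N) :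
    ContinuousAt (fun p : ℝ × Space N => heatKernel p.1 p.2) (t, x) := by
  unfold heatKernel
  have hp : (4 * Real.pi * t) ≠ 0 := by have := Real.pi_pos; positivity
  refine ContinuousAt.mul ?_ ?_
  · refine ContinuousAt.div continuousAt_const ?_ ?_
    · exact ContinuousAt.rpow (by fun_prop) continuousAt_const (Or.inl hp)
    · have := Real.pi_pos
      have : 0 < (4 * Real.pi * t) ^ ((N : ℝ) / 2) := by positivity
      exact this.ne'
  · refine Real.continuous_exp.continuousAt.comp ?_
    exact ContinuousAt.div (by fun_prop) (by fun_prop) (by simpa using ht.ne')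

lemma integral_heatKernel {t : ℝ} (ht : 0 < t) : ∫ x : Space N, heatKernel t x = 1 := by
  simp_rw [heatKernel_eq]
  rw [integral_const_mul, GaussianFourier.integral_rexp_neg_mul_sq_norm (by positivity)]
  have hp : Real.pi / (1 / (4 * t)) = 4 * Real.pi * t := by field_simp
  have := Real.pi_pos
  rw [hp, heatPeak, finrank_euclideanSpace, Fintype.card_fin, one_div,
    inv_mul_cancel₀ (by positivity)]

lemma integrable_heatKernel {t : ℝ} (ht : 0 < t) :
    Integrable (heatKernel t : Space N → ℝ) :=
  integrable_of_integral_eq_one (integral_heatKernel ht)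

lemma enorm_heatKernel {t : ℝ} (ht : 0 < t) (x : Space N) :
    ‖heatKernel t x‖ₑ = ENNReal.ofReal (heatKernel t x) :=
  Real.enorm_of_nonneg (heatKernel_pos ht x).le

lemma lintegral_enorm_heatKernel {t : ℝ} (ht : 0 < t) :
    ∫⁻ x : Space N, ‖heatKernel t x‖ₑ = 1 := by
  simp_rw [enorm_heatKernel ht]
  rw [← ofReal_integral_eq_lintegral_ofReal (integrable_heatKernel ht)
    (ae_of_all _ fun x => (heatKernel_pos ht x).le), integral_heatKernel ht, ENNReal.ofReal_one]

/-- Completing the square in `z`. This one identity yields the semigroup law for `G` and, through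
its first moment, the one for `∇G`. -/
lemma heatKernel_mul_heatKernel {a b : ℝ} (ha : 0 < a) (hb : 0 < b) (x z : Space N) :
    heatKernel a (x - z) * heatKernel b z =
      heatKernel (a + b) x * heatKernel (a * b / (a + b)) (z - (b / (a + b)) • x) := by
  have hpi := Real.pi_pos
  have hpeak : heatPeak N a * heatPeak N b = heatPeak N (a + b) * heatPeak N (a * b / (a + b)) := by
    unfold heatPeak
    rw [one_div_mul_one_div, one_div_mul_one_div, ← Real.mul_rpow (by positivity) (by positivity),
      ← Real.mul_rpow (by positivity) (by positivity)]
    congr 2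
    field_simp
  simp_rw [heatKernel_eq]
  rw [mul_mul_mul_comm, mul_mul_mul_comm (heatPeak N (a + b)), hpeak, ← Real.exp_add,
    ← Real.exp_add]
  congr 2
  rw [norm_sub_sq_real, norm_sub_sq_real, norm_smul, inner_smul_right, real_inner_comm,
    Real.norm_of_nonneg (by positivity)]
  field_simp
  ring

lemma integral_heatKernel_mul_heatKernel {a b : ℝ} (ha : 0 < a) (hb : 0 < b) (x y : Space N) :
    ∫ z, heatKernel a (x - z) * heatKernel b (z - y) = heatKernel (a + b) (x - y) := by
  have h1 := integral_sub_right_eq_self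
    (fun z : Space N => heatKernel a ((x - y) - z) * heatKernel b z) y (μ := volume)
  simp only [sub_sub_sub_cancel_right] at h1
  rw [h1]
  simp_rw [heatKernel_mul_heatKernel ha hb]
  rw [integral_const_mul, integral_sub_right_eq_self (fun z => heatKernel (a * b / (a + b)) z),
    integral_heatKernel (by positivity), mul_one]

/-! ### Its gradient -/

lemma hasGradientAt_heatKernel {t : ℝ} (x : Space N) :
    HasGradientAt (heatKernel t) (-(heatKernel t x / (2 * t)) • x) x := by
  rw [hasGradientAt_iff_hasFDerivAt]
  have h0 : HasFDerivAt (fun y : Space N => ‖y‖ ^ 2) (2 • innerSL ℝ x) x :=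
    (hasStrictFDerivAt_norm_sq x).hasFDerivAt
  have h := (h0.const_mul (-(1 / (4 * t)))).exp.const_mul (heatPeak N t)
  have he : heatKernel (N := N) t =
      fun x => heatPeak N t * Real.exp (-(1 / (4 * t)) * ‖x‖ ^ 2) := by
    ext x; exact heatKernel_eq t x
  rw [he]
  refine h.congr_fderiv ?_
  ext v
  simp
  ring

lemma gradient_heatKernel (t : ℝ) (x : Space N) :
    gradient (heatKernel t) x = -(heatKernel t x / (2 * t)) • x :=
  (hasGradientAt_heatKernel x).gradient

lemma continuous_gradient_heatKernel (t : ℝ) :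
    Continuous (gradient (heatKernel (N := N) t)) := by
  have : gradient (heatKernel (N := N) t) = fun x => -(heatKernel t x / (2 * t)) • x := by
    ext1 x; exact gradient_heatKernel t x
  rw [this]
  have := continuous_heatKernel (N := N) t
  fun_prop

lemma continuousAt_uncurry_gradient_heatKernel {t : ℝ} (ht : 0 < t) (x : Space N) :
    ContinuousAt (fun p : ℝ × Space N => gradient (heatKernel p.1) p.2) (t, x) := by
  simp_rw [gradient_heatKernel]
  refine ContinuousAt.fun_smul (f := fun p : ℝ × Space N => -(heatKernel p.1 p.2 / (2 * p.1)))
    (ContinuousAt.neg ?_) continuousAt_snd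
  exact (continuousAt_uncurry_heatKernel ht x).div (by fun_prop) (by simpa using ht.ne')

lemma gradient_heatKernel_neg (t : ℝ) (x : Space N) :
    gradient (heatKernel t) (-x) = -gradient (heatKernel t) x := by
  simp [gradient_heatKernel, heatKernel_neg]

/-- The constant in the bound `‖∇G(t,·)‖₁ ≤ c t^{-1/2}`. -/
def gradConst (N : ℕ) : ℝ := √2 * 2 ^ ((N : ℝ) / 2)

lemma gradConst_pos : 0 < gradConst N := by unfold gradConst; positivity

/-- Half of the Gaussian exponent absorbs the factor `‖x‖`, by `s e^{-s²} ≤ 1`; the other half is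
the exponent of `heatKernel (2 * t)`. Norms of `∇G` thereby reduce to the total mass of a heat
kernel. -/
lemma norm_gradient_heatKernel_le {t : ℝ} (ht : 0 < t) (x : Space N) :
    ‖gradient (heatKernel t) x‖ ≤ gradConst N * t ^ (-(1 / 2) : ℝ) * heatKernel (2 * t) x := by
  have hpi := Real.pi_pos
  have hk := heatKernel_pos ht x
  rw [gradient_heatKernel, neg_smul, norm_neg, norm_smul, Real.norm_of_nonneg (by positivity)]
  have hpeak : heatPeak N t = 2 ^ ((N : ℝ) / 2) * heatPeak N (2 * t) := by
    unfold heatPeak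
    rw [show 4 * Real.pi * (2 * t) = 2 * (4 * Real.pi * t) by ring,
      Real.mul_rpow (by norm_num : (0 : ℝ) ≤ 2) (by positivity : 0 ≤ 4 * Real.pi * t)]
    have h1 : (4 * Real.pi * t) ^ ((N : ℝ) / 2) ≠ 0 := by positivity
    have h2 : (2 : ℝ) ^ ((N : ℝ) / 2) ≠ 0 := by positivity
    rw [one_div, one_div, mul_inv, mul_inv_cancel_left₀ h2]
  rw [heatKernel_eq, heatKernel_eq, hpeak, Real.rpow_neg ht.le, ← Real.sqrt_eq_rpow]
  have hs : √t * √t = t := Real.mul_self_sqrt ht.le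
  have hs0 : 0 < √t := Real.sqrt_pos.2 ht
  have h2 : √2 * √2 = 2 := Real.mul_self_sqrt (by norm_num)
  have h20 : 0 < √2 := by positivity
  set E := Real.exp (-(1 / (4 * (2 * t))) * ‖x‖ ^ 2) with hE
  have hEE : Real.exp (-(1 / (4 * t)) * ‖x‖ ^ 2) = E * E := by
    rw [hE, ← Real.exp_add]
    congr 1
    field_simp
    ring
  have hkey : ‖x‖ * E ≤ 2 * √2 * √t := by
    set s := ‖x‖ / (2 * √2 * √t) with hsdef
    have hx : ‖x‖ = s * (2 * √2 * √t) := by rw [hsdef]; field_simp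
    have hE' : E = Real.exp (-(s ^ 2)) := by
      rw [hE]
      congr 1
      rw [hx, mul_pow, mul_pow, mul_pow, sq (√2), sq (√t), hs, h2]
      field_simp
      ring
    have hs0' : 0 ≤ s := by positivity
    have h1 : s ≤ Real.exp (s ^ 2) := by
      nlinarith [Real.add_one_le_exp (s ^ 2), sq_nonneg (s - 1)]
    have h2 : s * E ≤ 1 := by
      rw [hE', Real.exp_neg, ← div_eq_mul_inv]
      exact (div_le_one (Real.exp_pos _)).2 h1
    calc ‖x‖ * E = (s * E) * (2 * √2 * √t) := by rw [hx]; ring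
      _ ≤ 1 * (2 * √2 * √t) := by gcongr
      _ = _ := one_mul _
  have hP := heatPeak_pos (N := N) (t := 2 * t) (by positivity)
  have hE0 : 0 < E := Real.exp_pos _
  rw [hEE]
  calc 2 ^ ((N : ℝ) / 2) * heatPeak N (2 * t) * (E * E) / (2 * t) * ‖x‖
      = (2 ^ ((N : ℝ) / 2) * heatPeak N (2 * t) * E / (2 * t)) * (‖x‖ * E) := by ring
    _ ≤ (2 ^ ((N : ℝ) / 2) * heatPeak N (2 * t) * E / (2 * t)) * (2 * √2 * √t) := by gcongr
    _ = _ := by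
      unfold gradConst
      have h3 : √t / t = (√t)⁻¹ := Real.sqrt_div_self
      calc _ = 2 ^ ((N : ℝ) / 2) * heatPeak N (2 * t) * E * √2 * (√t / t) := by
            field_simp
        _ = _ := by rw [h3]; ring

lemma norm_gradient_heatKernel_le_peak {t : ℝ} (ht : 0 < t) (x : Space N) :
    ‖gradient (heatKernel t) x‖ ≤ gradConst N * t ^ (-(1 / 2) : ℝ) * heatPeak N (2 * t) := by
  have := gradConst_pos (N := N)
  refine (norm_gradient_heatKernel_le ht x).trans ?_
  gcongr
  exact heatKernel_le (by positivity) x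

lemma lintegral_enorm_gradient_heatKernel_le {t : ℝ} (ht : 0 < t) :
    ∫⁻ x : Space N, ‖gradient (heatKernel t) x‖ₑ ≤
      ENNReal.ofReal (gradConst N * t ^ (-(1 / 2) : ℝ)) := by
  have hc := gradConst_pos (N := N)
  calc ∫⁻ x : Space N, ‖gradient (heatKernel t) x‖ₑ
      ≤ ∫⁻ x : Space N, ENNReal.ofReal (gradConst N * t ^ (-(1 / 2) : ℝ)) *
          ‖heatKernel (2 * t) x‖ₑ := by
        refine lintegral_mono fun x => ?_
        rw [enorm_heatKernel (by positivity), ← ENNReal.ofReal_mul (by positivity),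
          ← ofReal_norm]
        exact ENNReal.ofReal_le_ofReal (norm_gradient_heatKernel_le ht x)
    _ = _ := by
        rw [lintegral_const_mul' _ _ ENNReal.ofReal_ne_top,
          lintegral_enorm_heatKernel (by positivity), mul_one]

lemma integrable_gradient_heatKernel {t : ℝ} (ht : 0 < t) :
    Integrable (gradient (heatKernel (N := N) t)) :=
  ⟨(continuous_gradient_heatKernel t).aestronglyMeasurable,
    (lintegral_enorm_gradient_heatKernel_le ht).trans_lt ENNReal.ofReal_lt_top⟩

/-- Turns first moments of the Gaussian into integrals of its gradient, which are already known or
bounded. -/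
lemma heatKernel_smul_self {t : ℝ} (ht : 0 < t) (x : Space N) :
    heatKernel t x • x = (-(2 * t)) • gradient (heatKernel t) x := by
  rw [gradient_heatKernel, smul_smul]
  congr 1
  field_simp

lemma integral_gradient_heatKernel (t : ℝ) :
    ∫ x : Space N, gradient (heatKernel t) x = 0 := by
  have h := integral_neg_eq_self (fun x : Space N => gradient (heatKernel t) x) volume
  simp_rw [gradient_heatKernel_neg, integral_neg] at h
  have h2 : (2 : ℝ) • ∫ x : Space N, gradient (heatKernel t) x = 0 := by
    rw [two_smul]
    nth_rewrite 1 [← h]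
    exact neg_add_cancel _
  exact (smul_eq_zero.1 h2).resolve_left two_ne_zero

/-- Since `∇G` is `G` times a linear factor, completing the square reduces the integral to the mean
of a Gaussian centred at `m`; no differentiation under the integral is needed. -/
lemma integral_heatKernel_smul_gradient {a b : ℝ} (ha : 0 < a) (hb : 0 < b) (x y : Space N) :
    ∫ z, heatKernel a (x - z) • gradient (heatKernel b) (z - y) =
      gradient (heatKernel (a + b)) (x - y) := by
  have hab : 0 < a + b := by positivity
  have h1 := integral_sub_right_eq_self
    (fun z : Space N => heatKernel a ((x - y) - z) • gradient (heatKernel b) z) y (μ := volume)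
  simp only [sub_sub_sub_cancel_right] at h1
  rw [h1]
  generalize x - y = u
  set c := a * b / (a + b) with hc
  have hc0 : 0 < c := by positivity
  set m := (b / (a + b)) • u with hm
  have h2 : ∀ z, heatKernel a (u - z) • gradient (heatKernel b) z =
      (-(1 / (2 * b)) * heatKernel (a + b) u) • (heatKernel c (z - m) • z) := by
    intro z
    rw [gradient_heatKernel, smul_smul, smul_smul]
    congr 1
    have := heatKernel_mul_heatKernel ha hb u z
    rw [← hc, ← hm] at this
    calc heatKernel a (u - z) * -(heatKernel b z / (2 * b))
        = -(1 / (2 * b)) * (heatKernel a (u - z) * heatKernel b z) := by ring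
      _ = _ := by rw [this]; ring
  simp_rw [h2]
  rw [integral_smul]
  have h3 : ∫ z, heatKernel c (z - m) • z = m := by
    have h4 := integral_add_right_eq_self (fun z : Space N => heatKernel c (z - m) • z) m
      (μ := volume)
    simp only [add_sub_cancel_right, smul_add] at h4
    rw [← h4]
    simp_rw [heatKernel_smul_self hc0]
    have h5 : Integrable fun x : Space N => -(2 * c) • gradient (heatKernel c) x :=
      (integrable_gradient_heatKernel hc0).smul (-(2 * c))
    have h6 : Integrable fun x : Space N => heatKernel c x • m :=
      (integrable_heatKernel hc0).smul_const m
    rw [integral_add h5 h6, integral_smul, integral_gradient_heatKernel,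
      smul_zero, zero_add, integral_smul_const, integral_heatKernel hc0, one_smul]
  rw [h3, hm, gradient_heatKernel, smul_smul]
  congr 1
  field_simp

/-! ### Shift estimates for the heat kernel -/

lemma hasDerivAt_heatKernel_line (t : ℝ) (x v : Space N) (θ : ℝ) :
    HasDerivAt (fun θ : ℝ => heatKernel t (x + θ • v))
      (inner ℝ (gradient (heatKernel t) (x + θ • v)) v) θ := by
  have h1 : HasDerivAt (fun θ : ℝ => x + θ • v) v θ := by
    simpa using ((hasDerivAt_id θ).smul_const v).const_add x
  have h2 : HasFDerivAt (heatKernel t) _ (x + θ • v) :=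
    (hasGradientAt_iff_hasFDerivAt.1 (hasGradientAt_heatKernel (t := t) (x + θ • v)))
  have h3 := h2.comp_hasDerivAt θ h1
  rw [gradient_heatKernel]
  rw [InnerProductSpace.toDual_apply_apply] at h3
  exact h3

lemma heatKernel_add_sub (t : ℝ) (x v : Space N) :
    heatKernel t (x + v) - heatKernel t x =
      ∫ θ in (0 : ℝ)..1, inner ℝ (gradient (heatKernel t) (x + θ • v)) v := by
  have hc : Continuous fun θ : ℝ => inner ℝ (gradient (heatKernel t) (x + θ • v)) v := by
    have := continuous_gradient_heatKernel (N := N) t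
    fun_prop
  have := intervalIntegral.integral_eq_sub_of_hasDerivAt
    (fun θ _ => hasDerivAt_heatKernel_line t x v θ) (hc.intervalIntegrable 0 1)
  rw [this]
  simp

lemma enorm_inner_le {E : Type*} [NormedAddCommGroup E] [InnerProductSpace ℝ E] (x y : E) :
    ‖inner ℝ x y‖ₑ ≤ ‖x‖ₑ * ‖y‖ₑ := by
  rw [← ofReal_norm, ← ofReal_norm, ← ofReal_norm, ← ENNReal.ofReal_mul (norm_nonneg _)]
  exact ENNReal.ofReal_le_ofReal (norm_inner_le_norm x y)

/-- A mean value estimate in `L¹`. -/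
lemma lintegral_enorm_integral_inner_le {g : Space N → ℝ → Space N} (hg : Continuous ↿g)
    (v : Space N) {A : ℝ≥0∞} (hA : ∀ θ, ∫⁻ x, ‖g x θ‖ₑ ≤ A) :
    ∫⁻ x, ‖∫ θ in (0 : ℝ)..1, inner ℝ (g x θ) v‖ₑ ≤ A * ‖v‖ₑ := by
  calc ∫⁻ x, ‖∫ θ in (0 : ℝ)..1, inner ℝ (g x θ) v‖ₑ
      ≤ ∫⁻ x, ∫⁻ θ in Ioc (0 : ℝ) 1, ‖g x θ‖ₑ * ‖v‖ₑ := by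
        refine lintegral_mono fun x => ?_
        rw [intervalIntegral.integral_of_le zero_le_one]
        refine (enorm_integral_le_lintegral_enorm _).trans (lintegral_mono fun θ => ?_)
        exact enorm_inner_le _ _
    _ = ∫⁻ θ in Ioc (0 : ℝ) 1, ∫⁻ x, ‖g x θ‖ₑ * ‖v‖ₑ := by
        refine lintegral_lintegral_swap ?_
        have : Continuous fun p : Space N × ℝ => g p.1 p.2 := hg
        exact (this.enorm.measurable.mul_const _).aemeasurable
    _ ≤ ∫⁻ _ in Ioc (0 : ℝ) 1, A * ‖v‖ₑ := by
        refine lintegral_mono fun θ => ?_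
        rw [lintegral_mul_const' _ _ enorm_ne_top]
        gcongr
        exact hA θ
    _ = A * ‖v‖ₑ := by simp

lemma lintegral_heatKernel_shift_le {t : ℝ} (ht : 0 < t) (v : Space N) :
    ∫⁻ x, ‖heatKernel t (x + v) - heatKernel t x‖ₑ ≤
      ENNReal.ofReal (gradConst N * t ^ (-(1 / 2) : ℝ)) * ‖v‖ₑ := by
  simp_rw [heatKernel_add_sub]
  refine lintegral_enorm_integral_inner_le (g := fun x θ => gradient (heatKernel t) (x + θ • v))
    ?_ v fun θ => ?_
  · have := continuous_gradient_heatKernel (N := N) t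
    show Continuous fun p : Space N × ℝ => gradient (heatKernel t) (p.1 + p.2 • v)
    fun_prop
  · rw [lintegral_add_right_eq_self (fun x => ‖gradient (heatKernel t) x‖ₑ)]
    exact lintegral_enorm_gradient_heatKernel_le ht

lemma integrable_heatKernel_smul_gradient {a b : ℝ} (ha : 0 < a) (hb : 0 < b) (x y : Space N) :
    Integrable fun z => heatKernel a (x - z) • gradient (heatKernel b) (z - y) := by
  refine Integrable.bdd_smul (𝕜 := ℝ) (C := heatPeak N a)
    ((integrable_gradient_heatKernel hb).comp_sub_right y) ?_ ?_
  · have := continuous_heatKernel (N := N) a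
    exact (by fun_prop : Continuous fun z : Space N => heatKernel a (x - z)).aestronglyMeasurable
  · refine ae_of_all _ fun z => ?_
    rw [Real.norm_of_nonneg (heatKernel_pos ha _).le]
    exact heatKernel_le ha _

lemma gradient_heatKernel_add_sub {a b : ℝ} (ha : 0 < a) (hb : 0 < b) (x v : Space N) :
    gradient (heatKernel (a + b)) (x + v) - gradient (heatKernel (a + b)) x =
      ∫ z, (heatKernel a (x - z + v) - heatKernel a (x - z)) • gradient (heatKernel b) z := by
  have h1 := integral_heatKernel_smul_gradient ha hb (x + v) 0
  have h2 := integral_heatKernel_smul_gradient ha hb x 0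
  have i1 := integrable_heatKernel_smul_gradient ha hb (x + v) 0
  have i2 := integrable_heatKernel_smul_gradient ha hb x 0
  simp only [sub_zero] at h1 h2 i1 i2
  rw [← h1, ← h2, ← integral_sub i1 i2]
  refine integral_congr_ae (ae_of_all _ fun z => ?_)
  simp only [sub_smul]
  rw [sub_add_eq_add_sub]

/-- Replaces a bound on second derivatives of `G`: write `∇G(t) = G(t/2) * ∇G(t/2)` and let the
shift act on the first factor. Each factor costs `gradConst N * (t/2)^{-1/2}`, whence the constant
`2 * gradConst N ^ 2 / t`. -/
lemma lintegral_gradient_heatKernel_shift_le {t : ℝ} (ht : 0 < t) (v : Space N) :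
    ∫⁻ x, ‖gradient (heatKernel t) (x + v) - gradient (heatKernel t) x‖ₑ ≤
      ENNReal.ofReal (2 * gradConst N ^ 2 / t) * ‖v‖ₑ := by
  have ht2 : 0 < t / 2 := by positivity
  have hc := gradConst_pos (N := N)
  set A := ENNReal.ofReal (gradConst N * (t / 2) ^ (-(1 / 2) : ℝ)) with hA
  have hk := continuous_heatKernel (N := N) (t / 2)
  have hgk := continuous_gradient_heatKernel (N := N) (t / 2)
  calc ∫⁻ x, ‖gradient (heatKernel t) (x + v) - gradient (heatKernel t) x‖ₑ
      ≤ ∫⁻ x, ∫⁻ z, ‖heatKernel (t / 2) (x - z + v) - heatKernel (t / 2) (x - z)‖ₑ *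
          ‖gradient (heatKernel (t / 2)) z‖ₑ := by
        refine lintegral_mono fun x => ?_
        have h := gradient_heatKernel_add_sub ht2 ht2 x v
        rw [add_halves] at h
        rw [h]
        refine (enorm_integral_le_lintegral_enorm _).trans (lintegral_mono fun z => ?_)
        rw [enorm_smul]
    _ = ∫⁻ z, ∫⁻ x, ‖heatKernel (t / 2) (x - z + v) - heatKernel (t / 2) (x - z)‖ₑ *
          ‖gradient (heatKernel (t / 2)) z‖ₑ := by
        refine lintegral_lintegral_swap ?_
        refine Measurable.aemeasurable (Measurable.fun_mul ?_ ?_)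
        · exact Continuous.measurable (by fun_prop : Continuous fun p : Space N × Space N =>
            ‖heatKernel (t / 2) (p.1 - p.2 + v) - heatKernel (t / 2) (p.1 - p.2)‖ₑ)
        · exact Continuous.measurable (by fun_prop : Continuous fun p : Space N × Space N =>
            ‖gradient (heatKernel (t / 2)) p.2‖ₑ)
    _ ≤ ∫⁻ z, (A * ‖v‖ₑ) * ‖gradient (heatKernel (t / 2)) z‖ₑ := by
        refine lintegral_mono fun z => ?_
        rw [lintegral_mul_const' _ _ enorm_ne_top]
        gcongr
        rw [lintegral_sub_right_eq_self
          (fun x => ‖heatKernel (t / 2) (x + v) - heatKernel (t / 2) x‖ₑ)]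
        exact lintegral_heatKernel_shift_le ht2 v
    _ ≤ (A * ‖v‖ₑ) * A := by
        rw [lintegral_const_mul' _ _ (ENNReal.mul_ne_top ENNReal.ofReal_ne_top enorm_ne_top)]
        gcongr
        exact lintegral_enorm_gradient_heatKernel_le ht2
    _ = (A * A) * ‖v‖ₑ := by ring
    _ = _ := by
        rw [hA, ← ENNReal.ofReal_mul (by positivity)]
        congr 2
        rw [mul_mul_mul_comm, ← Real.rpow_add ht2]
        norm_num
        rw [Real.rpow_neg_one]
        field_simp

lemma lintegral_heatKernel_taylor_le {t : ℝ} (ht : 0 < t) (v : Space N) :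
    ∫⁻ x, ‖heatKernel t (x + v) - heatKernel t x - inner ℝ (gradient (heatKernel t) x) v‖ₑ ≤
      ENNReal.ofReal (2 * gradConst N ^ 2 / t) * ‖v‖ₑ * ‖v‖ₑ := by
  have hgk := continuous_gradient_heatKernel (N := N) t
  have h : ∀ x : Space N,
      heatKernel t (x + v) - heatKernel t x - inner ℝ (gradient (heatKernel t) x) v =
      ∫ θ in (0 : ℝ)..1,
        inner ℝ (gradient (heatKernel t) (x + θ • v) - gradient (heatKernel t) x) v := by
    intro x
    simp_rw [inner_sub_left]
    rw [intervalIntegral.integral_sub (Continuous.intervalIntegrable (by fun_prop) _ _)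
      (Continuous.intervalIntegrable (by fun_prop) _ _), heatKernel_add_sub]
    simp
  simp_rw [h]
  set A := ENNReal.ofReal (2 * gradConst N ^ 2 / t)
  calc ∫⁻ x, ‖∫ θ in (0 : ℝ)..1,
        inner ℝ (gradient (heatKernel t) (x + θ • v) - gradient (heatKernel t) x) v‖ₑ
      ≤ ∫⁻ x, ∫⁻ θ in Ioc (0 : ℝ) 1,
        ‖gradient (heatKernel t) (x + θ • v) - gradient (heatKernel t) x‖ₑ * ‖v‖ₑ := by
        refine lintegral_mono fun x => ?_
        rw [intervalIntegral.integral_of_le zero_le_one]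
        exact (enorm_integral_le_lintegral_enorm _).trans
          (lintegral_mono fun θ => enorm_inner_le _ _)
    _ = ∫⁻ θ in Ioc (0 : ℝ) 1, ∫⁻ x,
        ‖gradient (heatKernel t) (x + θ • v) - gradient (heatKernel t) x‖ₑ * ‖v‖ₑ := by
        refine lintegral_lintegral_swap (Measurable.aemeasurable (Measurable.mul_const ?_ _))
        exact Continuous.measurable (by fun_prop : Continuous fun p : Space N × ℝ =>
            ‖gradient (heatKernel t) (p.1 + p.2 • v) - gradient (heatKernel t) p.1‖ₑ)
    _ ≤ ∫⁻ _ in Ioc (0 : ℝ) 1, A * ‖v‖ₑ * ‖v‖ₑ := by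
        refine setLIntegral_mono measurable_const fun θ hθ => ?_
        rw [lintegral_mul_const' _ _ enorm_ne_top]
        gcongr
        refine (lintegral_gradient_heatKernel_shift_le ht (θ • v)).trans ?_
        gcongr
        rw [enorm_smul, Real.enorm_of_nonneg hθ.1.le]
        exact mul_le_of_le_one_left' (ENNReal.ofReal_le_one.2 hθ.2)
    _ = _ := by simp

/-- `G(δ)` is a probability density, so `∇G(δ+t) - ∇G(t)` is an average of spatial shifts by `-z`,
each costing `‖z‖ / t`. The first moment of `G(δ)` is `2δ ‖∇G(δ)‖₁`, of order `δ^{1/2}`. -/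
lemma lintegral_gradient_heatKernel_time_le' {t δ : ℝ} (ht : 0 < t) (hδ : 0 < δ) :
    ∫⁻ x : Space N, ‖gradient (heatKernel (δ + t)) x - gradient (heatKernel t) x‖ₑ ≤
      ENNReal.ofReal (4 * gradConst N ^ 3 * (δ ^ (1 / 2 : ℝ) / t)) := by
  have hc := gradConst_pos (N := N)
  have hk := continuous_heatKernel (N := N) δ
  have hgk := continuous_gradient_heatKernel (N := N) t
  have h : ∀ x : Space N, gradient (heatKernel (δ + t)) x - gradient (heatKernel t) x =
      ∫ z, heatKernel δ z • (gradient (heatKernel t) (x - z) - gradient (heatKernel t) x) := by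
    intro x
    have h1 := integral_heatKernel_smul_gradient hδ ht x 0
    have i1 := integrable_heatKernel_smul_gradient hδ ht x 0
    rw [← integral_sub_left_eq_self _ _ x] at h1
    replace i1 := i1.comp_sub_left x
    simp only [sub_zero, sub_sub_cancel] at h1 i1
    simp_rw [smul_sub]
    rw [integral_sub i1 ((integrable_heatKernel hδ).smul_const _), h1, integral_smul_const,
      integral_heatKernel hδ, one_smul]
  simp_rw [h]
  set A := ENNReal.ofReal (2 * gradConst N ^ 2 / t) with hA
  calc ∫⁻ x, ‖∫ z, heatKernel δ z •
          (gradient (heatKernel t) (x - z) - gradient (heatKernel t) x)‖ₑ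
      ≤ ∫⁻ x, ∫⁻ z, ‖heatKernel δ z‖ₑ *
          ‖gradient (heatKernel t) (x - z) - gradient (heatKernel t) x‖ₑ := by
        refine lintegral_mono fun x => (enorm_integral_le_lintegral_enorm _).trans
          (lintegral_mono fun z => ?_)
        rw [enorm_smul]
    _ = ∫⁻ z, ∫⁻ x, ‖heatKernel δ z‖ₑ *
          ‖gradient (heatKernel t) (x - z) - gradient (heatKernel t) x‖ₑ := by
        refine lintegral_lintegral_swap (Measurable.aemeasurable (Measurable.fun_mul ?_ ?_))
        · exact Continuous.measurable (by fun_prop : Continuous fun p : Space N × Space N =>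
            ‖heatKernel δ p.2‖ₑ)
        · exact Continuous.measurable (by fun_prop : Continuous fun p : Space N × Space N =>
            ‖gradient (heatKernel t) (p.1 - p.2) - gradient (heatKernel t) p.1‖ₑ)
    _ ≤ ∫⁻ z, (A * ENNReal.ofReal (2 * δ)) * ‖gradient (heatKernel δ) z‖ₑ := by
        refine lintegral_mono fun z => ?_
        rw [lintegral_const_mul' _ _ enorm_ne_top]
        calc _ ≤ ‖heatKernel δ z‖ₑ * (A * ‖-z‖ₑ) := by
              gcongr
              simp_rw [sub_eq_add_neg]
              exact lintegral_gradient_heatKernel_shift_le ht (-z)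
          _ = A * (‖heatKernel δ z • z‖ₑ) := by rw [enorm_neg, enorm_smul]; ring
          _ = _ := by
            rw [heatKernel_smul_self hδ, enorm_smul, enorm_neg,
              Real.enorm_of_nonneg (by positivity), mul_assoc]
    _ ≤ (A * ENNReal.ofReal (2 * δ)) * ENNReal.ofReal (gradConst N * δ ^ (-(1 / 2) : ℝ)) := by
        rw [lintegral_const_mul' _ _ (ENNReal.mul_ne_top ENNReal.ofReal_ne_top
          ENNReal.ofReal_ne_top)]
        gcongr
        exact lintegral_enorm_gradient_heatKernel_le hδ
    _ = _ := by
        rw [hA, ← ENNReal.ofReal_mul (by positivity), ← ENNReal.ofReal_mul (by positivity)]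
        congr 1
        have : δ ^ (1 / 2 : ℝ) = δ * δ ^ (-(1 / 2) : ℝ) := by
          nth_rewrite 2 [← Real.rpow_one δ]
          rw [← Real.rpow_add hδ]
          norm_num
        rw [this]
        field_simp
        ring

/-- The constant in the bound for the time variation of `∇G`. -/
def gradTimeConst (N : ℕ) : ℝ := 4 * gradConst N ^ 3 + 2 * gradConst N

lemma gradTimeConst_pos : 0 < gradTimeConst N := by
  have := gradConst_pos (N := N)
  unfold gradTimeConst; positivity

/-- The rate `δ^{1/2} / t` is not integrable at `t = 0`. Interpolating it with the trivial bound of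
order `t^{-1/2}`, used when `δ ≥ t`, gives the power `-3/4`, which is. -/
lemma lintegral_gradient_heatKernel_time_le {t δ : ℝ} (ht : 0 < t) (hδ : 0 ≤ δ) :
    ∫⁻ x : Space N, ‖gradient (heatKernel (δ + t)) x - gradient (heatKernel t) x‖ₑ ≤
      ENNReal.ofReal (gradTimeConst N * δ ^ (1 / 4 : ℝ) * t ^ (-(3 / 4) : ℝ)) := by
  have hc := gradConst_pos (N := N)
  rcases hδ.eq_or_lt with rfl | hδ
  · simp
  have hC : (0 : ℝ) < gradTimeConst N := gradTimeConst_pos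
  rcases le_total δ t with h | h
  · refine (lintegral_gradient_heatKernel_time_le' ht hδ).trans (ENNReal.ofReal_le_ofReal ?_)
    have h1 : δ ^ (1 / 2 : ℝ) / t ≤ δ ^ (1 / 4 : ℝ) * t ^ (-(3 / 4) : ℝ) := by
      have e1 : δ ^ (1 / 2 : ℝ) = δ ^ (1 / 4 : ℝ) * δ ^ (1 / 4 : ℝ) := by
        rw [← Real.rpow_add hδ]; norm_num
      have e2 : t ^ (-(3 / 4) : ℝ) = t ^ (1 / 4 : ℝ) / t := by
        rw [← Real.rpow_sub_one ht.ne']; norm_num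
      have e3 : δ ^ (1 / 4 : ℝ) ≤ t ^ (1 / 4 : ℝ) :=
        Real.rpow_le_rpow hδ.le h (by norm_num)
      rw [e1, e2, mul_div_assoc]
      gcongr
    have h2 : 4 * gradConst N ^ 3 ≤ gradTimeConst N := by unfold gradTimeConst; linarith
    calc _ ≤ gradTimeConst N * (δ ^ (1 / 4 : ℝ) * t ^ (-(3 / 4) : ℝ)) := by gcongr
      _ = _ := by ring
  · calc ∫⁻ x : Space N, ‖gradient (heatKernel (δ + t)) x - gradient (heatKernel t) x‖ₑ
        ≤ ∫⁻ x : Space N, (‖gradient (heatKernel (δ + t)) x‖ₑ + ‖gradient (heatKernel t) x‖ₑ) :=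
          lintegral_mono fun x => enorm_sub_le
      _ = (∫⁻ x : Space N, ‖gradient (heatKernel (δ + t)) x‖ₑ) +
            ∫⁻ x : Space N, ‖gradient (heatKernel t) x‖ₑ :=
          lintegral_add_left (continuous_gradient_heatKernel _).enorm.measurable _
      _ ≤ ENNReal.ofReal (gradConst N * (δ + t) ^ (-(1 / 2) : ℝ)) +
            ENNReal.ofReal (gradConst N * t ^ (-(1 / 2) : ℝ)) := by
          gcongr
          · exact lintegral_enorm_gradient_heatKernel_le (by positivity)
          · exact lintegral_enorm_gradient_heatKernel_le ht
      _ = ENNReal.ofReal (gradConst N * (δ + t) ^ (-(1 / 2) : ℝ) +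
            gradConst N * t ^ (-(1 / 2) : ℝ)) :=
          (ENNReal.ofReal_add (by positivity) (by positivity)).symm
      _ ≤ _ := by
          refine ENNReal.ofReal_le_ofReal ?_
          have e0 : (δ + t) ^ (-(1 / 2) : ℝ) ≤ t ^ (-(1 / 2) : ℝ) :=
            Real.rpow_le_rpow_of_nonpos ht (by linarith) (by norm_num)
          have e1 : t ^ (-(1 / 2) : ℝ) = t ^ (1 / 4 : ℝ) * t ^ (-(3 / 4) : ℝ) := by
            rw [← Real.rpow_add ht]; norm_num
          have e3 : t ^ (1 / 4 : ℝ) ≤ δ ^ (1 / 4 : ℝ) :=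
            Real.rpow_le_rpow ht.le h (by norm_num)
          have h2 : 2 * gradConst N ≤ gradTimeConst N := by
            unfold gradTimeConst
            have : 0 < gradConst N ^ 3 := by positivity
            linarith
          calc _ ≤ gradConst N * t ^ (-(1 / 2) : ℝ) + gradConst N * t ^ (-(1 / 2) : ℝ) := by gcongr
            _ = 2 * gradConst N * t ^ (1 / 4 : ℝ) * t ^ (-(3 / 4) : ℝ) := by rw [e1]; ring
            _ ≤ _ := by gcongr

/-! ### Minkowski's integral inequality -/

/-- Hölder's inequality for `f = (f w^{-1/q}) w^{1/q}`, followed by Tonelli. The weight `w` records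
the size of each member of the family, so that every member contributes in proportion. -/
lemma lintegral_rpow_lintegral_le {α X : Type*} [MeasurableSpace α] [MeasurableSpace X]
    {μ : Measure α} {ν : Measure X} [SFinite μ] [SFinite ν] {p : ℝ} (hp : 1 < p)
    {f : α → X → ℝ≥0∞} (hf : Measurable (Function.uncurry f)) {w : α → ℝ≥0∞}
    (hw : AEMeasurable w μ) (hw0 : ∀ᵐ a ∂μ, w a ≠ 0) (hwt : ∀ᵐ a ∂μ, w a ≠ ⊤) {R : ℝ≥0∞}
    (h : ∀ᵐ a ∂μ, ∫⁻ x, f a x ^ p ∂ν ≤ w a ^ p * R) :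
    ∫⁻ x, (∫⁻ a, f a x ∂μ) ^ p ∂ν ≤ (∫⁻ a, w a ∂μ) ^ p * R := by
  have hp0 : 0 < p := by linarith
  set q := p.conjExponent with hq
  have hpq : p.HolderConjugate q := Real.HolderConjugate.conjExponent hp
  have hq0 : 0 < q := hpq.symm.pos
  have hfx : ∀ x, Measurable fun a => f a x := fun x => hf.comp (measurable_id.prodMk measurable_const)
  have key : ∀ x, (∫⁻ a, f a x ∂μ) ^ p ≤
      (∫⁻ a, f a x ^ p * w a ^ (1 - p) ∂μ) * (∫⁻ a, w a ∂μ) ^ (p - 1) := by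
    intro x
    have h1 : ∫⁻ a, f a x ∂μ ≤ (∫⁻ a, f a x ^ p * w a ^ (1 - p) ∂μ) ^ (1 / p) *
        (∫⁻ a, w a ∂μ) ^ (1 / q) := by
      have h2 := ENNReal.lintegral_mul_le_Lp_mul_Lq μ hpq
        (f := fun a => f a x * w a ^ (-(1 / q))) (g := fun a => w a ^ (1 / q))
        ((hfx x).aemeasurable.mul (hw.pow_const _)) (hw.pow_const _)
      refine le_trans (le_of_eq ?_) (h2.trans (le_of_eq ?_))
      · refine lintegral_congr_ae ?_
        filter_upwards [hw0, hwt] with a h0 ht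
        simp only [Pi.mul_apply]
        rw [mul_assoc, ← ENNReal.rpow_add _ _ h0 ht]
        simp
      · congr 2
        · refine lintegral_congr fun a => ?_
          rw [ENNReal.mul_rpow_of_nonneg _ _ hp0.le, ← ENNReal.rpow_mul]
          congr 2
          have := hpq.inv_add_inv_eq_one
          field_simp
          field_simp at this
          linarith
        · refine lintegral_congr fun a => ?_
          rw [← ENNReal.rpow_mul]
          field_simp
          simp
    calc (∫⁻ a, f a x ∂μ) ^ p ≤ ((∫⁻ a, f a x ^ p * w a ^ (1 - p) ∂μ) ^ (1 / p) *
        (∫⁻ a, w a ∂μ) ^ (1 / q)) ^ p := by gcongr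
      _ = _ := by
        rw [ENNReal.mul_rpow_of_nonneg _ _ hp0.le, ← ENNReal.rpow_mul, ← ENNReal.rpow_mul]
        congr 1
        · rw [one_div_mul_cancel hp0.ne', ENNReal.rpow_one]
        · congr 1
          have := hpq.inv_add_inv_eq_one
          field_simp
          field_simp at this
          linarith
  have hmeas : AEMeasurable (Function.uncurry fun a x => f a x ^ p * w a ^ (1 - p))
      (μ.prod ν) :=
    (hf.pow_const p).aemeasurable.mul ((hw.pow_const (1 - p)).comp_quasiMeasurePreserving
      Measure.quasiMeasurePreserving_fst)
  calc ∫⁻ x, (∫⁻ a, f a x ∂μ) ^ p ∂ν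
      ≤ ∫⁻ x, (∫⁻ a, f a x ^ p * w a ^ (1 - p) ∂μ) * (∫⁻ a, w a ∂μ) ^ (p - 1) ∂ν :=
        lintegral_mono key
    _ = (∫⁻ x, ∫⁻ a, f a x ^ p * w a ^ (1 - p) ∂μ ∂ν) * (∫⁻ a, w a ∂μ) ^ (p - 1) := by
        refine lintegral_mul_const'' _ ?_
        exact hmeas.prod_swap.lintegral_prod_right'
    _ = (∫⁻ a, ∫⁻ x, f a x ^ p * w a ^ (1 - p) ∂ν ∂μ) * (∫⁻ a, w a ∂μ) ^ (p - 1) := by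
        rw [lintegral_lintegral_swap hmeas]
    _ ≤ (∫⁻ a, w a * R ∂μ) * (∫⁻ a, w a ∂μ) ^ (p - 1) := by
        gcongr 1
        refine lintegral_mono_ae ?_
        filter_upwards [hw0, hwt, h] with a h0 ht h
        have hfa : Measurable fun x => f a x ^ p := (hf.comp measurable_prodMk_left).pow_const p
        rw [lintegral_mul_const _ hfa]
        calc _ ≤ w a ^ p * R * w a ^ (1 - p) := by gcongr
          _ = (w a ^ p * w a ^ (1 - p)) * R := by ring
          _ = w a * R := by rw [← ENNReal.rpow_add _ _ h0 ht]; simp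
    _ = _ := by
        rw [lintegral_mul_const'' _ hw, mul_right_comm]
        congr 1
        nth_rewrite 1 [← ENNReal.rpow_one (∫⁻ a, w a ∂μ)]
        rw [← ENNReal.rpow_add_of_nonneg _ _ zero_le_one (by linarith)]
        simp

/-- Minkowski's integral inequality, for a family with `‖f a‖_p ≤ w a * R`. -/
lemma eLpNorm_lintegral_le {α X : Type*} [MeasurableSpace α] [MeasurableSpace X]
    {μ : Measure α} {ν : Measure X} [SFinite μ] [SFinite ν] {p : ℝ≥0∞} (hp : 1 ≤ p)
    {f : α → X → ℝ≥0∞} (hf : AEMeasurable (Function.uncurry f) (μ.prod ν)) {w : α → ℝ≥0∞}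
    (hw : AEMeasurable w μ) (hw0 : ∀ᵐ a ∂μ, w a ≠ 0) (hwt : ∀ᵐ a ∂μ, w a ≠ ⊤) {R : ℝ≥0∞}
    (h : ∀ᵐ a ∂μ, eLpNorm (f a) p ν ≤ w a * R) :
    eLpNorm (fun x => ∫⁻ a, f a x ∂μ) p ν ≤ (∫⁻ a, w a ∂μ) * R := by
  wlog hfm : Measurable (Function.uncurry f) generalizing f
  · have e1 : ∀ᵐ a ∂μ, f a =ᵐ[ν] fun x => hf.mk _ (a, x) :=
      Measure.ae_ae_of_ae_prod hf.ae_eq_mk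
    have e2 : ∀ᵐ x ∂ν, ∀ᵐ a ∂μ, f a x = hf.mk _ (a, x) :=
      Measure.ae_ae_of_ae_prod (Measure.measurePreserving_swap.quasiMeasurePreserving.ae hf.ae_eq_mk)
    have := this (f := fun a x => hf.mk _ (a, x)) hf.measurable_mk.aemeasurable
      (by
        filter_upwards [e1, h] with a ha h
        rwa [← eLpNorm_congr_ae ha]) hf.measurable_mk
    refine le_trans (le_of_eq (eLpNorm_congr_ae ?_)) this
    filter_upwards [e2] with x hx
    exact lintegral_congr_ae hx
  have hfa : ∀ a, Measurable (f a) := fun a => hfm.comp measurable_prodMk_left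
  rcases eq_or_ne p ⊤ with rfl | hpt
  · have h1 : ∀ᵐ a ∂μ, ∀ᵐ x ∂ν, f a x ≤ w a * R := by
      filter_upwards [h] with a ha
      filter_upwards [enorm_ae_le_eLpNormEssSup (f a) ν] with x hx
      rw [enorm_eq_self] at hx
      exact hx.trans (by simpa using ha)
    -- Exchanging the two almost-everywhere quantifiers requires a measurable set, hence the detour
    -- through a measurable representative of `w`.
    have h2 : ∀ᵐ x ∂ν, ∀ᵐ a ∂μ, f a x ≤ w a * R := by
      have h3 : ∀ᵐ a ∂μ, ∀ᵐ x ∂ν, f a x ≤ hw.mk w a * R := by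
        filter_upwards [h1, hw.ae_eq_mk] with a ha hb
        rwa [← hb]
      rw [Measure.ae_ae_comm] at h3
      · filter_upwards [h3] with x hx
        filter_upwards [hx, hw.ae_eq_mk] with a ha hb
        rwa [hb]
      · exact measurableSet_le hfm ((hw.measurable_mk.comp measurable_fst).mul_const R)
    rw [eLpNorm_exponent_top]
    refine eLpNormEssSup_le_of_ae_enorm_bound ?_
    filter_upwards [h2] with x hx
    rw [enorm_eq_self, ← lintegral_mul_const'' _ hw]
    exact lintegral_mono_ae hx
  rcases hp.eq_or_lt with rfl | hp1
  · simp_rw [eLpNorm_one_eq_lintegral_enorm, enorm_eq_self] at h ⊢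
    rw [← lintegral_lintegral_swap hf, ← lintegral_mul_const'' _ hw]
    exact lintegral_mono_ae h
  have hp0 : p ≠ 0 := by positivity
  have hpr : 1 < p.toReal := by
    rw [← ENNReal.toReal_one]
    exact (ENNReal.toReal_lt_toReal ENNReal.one_ne_top hpt).2 hp1
  simp_rw [eLpNorm_eq_lintegral_rpow_enorm_toReal hp0 hpt, enorm_eq_self] at h ⊢
  rw [one_div, ENNReal.rpow_inv_le_iff (by linarith), ENNReal.mul_rpow_of_nonneg _ _ (by linarith)]
  refine lintegral_rpow_lintegral_le hpr hfm hw hw0 hwt ?_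
  filter_upwards [h] with a ha
  rwa [one_div, ENNReal.rpow_inv_le_iff (by linarith), ENNReal.mul_rpow_of_nonneg _ _ (by linarith)]
    at ha

lemma lintegral_enorm_integral_le {α X E : Type*} [MeasurableSpace α] [MeasurableSpace X]
    [NormedAddCommGroup E] [NormedSpace ℝ E]
    {μ : Measure α} {ν : Measure X} [SFinite μ] [SFinite ν] {k : X → α → E}
    (hk : AEStronglyMeasurable (Function.uncurry k) (ν.prod μ)) :
    ∫⁻ x, ‖∫ a, k x a ∂μ‖ₑ ∂ν ≤ ∫⁻ a, ∫⁻ x, ‖k x a‖ₑ ∂ν ∂μ := by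
  rw [← lintegral_lintegral_swap hk.enorm]
  exact lintegral_mono fun x => enorm_integral_le_lintegral_enorm _

/-! ### Heat operators with displaced sources -/

/-- The heat flow at time `t` of `f` after moving the mass at `y` to `y - v y`. -/
def driftHeat (t : ℝ) (v : Space N → Space N) (f : Space N → ℝ) (x : Space N) : ℝ :=
  ∫ y, heatKernel t (x - y + v y) * f y

lemma driftHeat_zero (t : ℝ) (f : Space N → ℝ) : driftHeat t 0 f = heatSemigroup t f := by
  ext x; simp [driftHeat, heatSemigroup]

lemma integrable_uncurry_of_lintegral {α X E : Type*} [MeasurableSpace α] [MeasurableSpace X]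
    [NormedAddCommGroup E] {μ : Measure α} {ν : Measure X} [SFinite μ] [SFinite ν] {k : X → α → E}
    (hk : AEStronglyMeasurable (Function.uncurry k) (ν.prod μ))
    (h : ∫⁻ a, ∫⁻ x, ‖k x a‖ₑ ∂ν ∂μ < ⊤) : Integrable (Function.uncurry k) (ν.prod μ) := by
  refine ⟨hk, ?_⟩
  rw [HasFiniteIntegral, lintegral_prod_symm _ hk.enorm]
  exact h

lemma aestronglyMeasurable_displaced {E : Type*} [TopologicalSpace E] {Φ : Space N → E}
    (hΦ : Continuous Φ) {v : Space N → Space N} (hv : AEStronglyMeasurable v volume) :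
    AEStronglyMeasurable (fun p : Space N × Space N => Φ (p.1 - p.2 + v p.2))
      (volume.prod volume) :=
  hΦ.comp_aestronglyMeasurable
    ((by fun_prop : Continuous fun p : Space N × Space N => p.1 - p.2).aestronglyMeasurable.add
      hv.comp_snd)

lemma lintegral_displaced (g : Space N → ℝ≥0∞) (y w : Space N) :
    ∫⁻ x, g (x - y + w) = ∫⁻ x, g x := by
  simp_rw [sub_add]
  exact lintegral_sub_right_eq_self g _

lemma integrable_driftHeat_integrand {t : ℝ} (ht : 0 < t) {v : Space N → Space N}
    (hv : AEStronglyMeasurable v volume) {f : Space N → ℝ} (hf : Integrable f) (x : Space N) :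
    Integrable fun y => heatKernel t (x - y + v y) * f y := by
  refine hf.bdd_mul (c := heatPeak N t) ?_ (ae_of_all _ fun y => ?_)
  · exact (continuous_heatKernel t).comp_aestronglyMeasurable
      ((by fun_prop : Continuous fun y : Space N => x - y).aestronglyMeasurable.add hv)
  · rw [Real.norm_of_nonneg (heatKernel_pos ht _).le]
    exact heatKernel_le ht _

lemma integrable_uncurry_driftHeat {t : ℝ} (ht : 0 < t) {v : Space N → Space N}
    (hv : AEStronglyMeasurable v volume) {f : Space N → ℝ} (hf : Integrable f) :
    Integrable (Function.uncurry fun x y => heatKernel t (x - y + v y) * f y)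
      (volume.prod volume) := by
  refine integrable_uncurry_of_lintegral
    ((aestronglyMeasurable_displaced (continuous_heatKernel t) hv).mul hf.1.comp_snd) ?_
  simp_rw [enorm_mul]
  calc _ = ∫⁻ y, ‖f y‖ₑ := by
        refine lintegral_congr fun y => ?_
        rw [lintegral_mul_const' _ _ enorm_ne_top,
          lintegral_displaced (fun x => ‖heatKernel t x‖ₑ), lintegral_enorm_heatKernel ht, one_mul]
    _ < ⊤ := hf.2

lemma integrable_driftHeat {t : ℝ} (ht : 0 < t) {v : Space N → Space N}
    (hv : AEStronglyMeasurable v volume) {f : Space N → ℝ} (hf : Integrable f) :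
    Integrable (driftHeat t v f) :=
  (integrable_uncurry_driftHeat ht hv hf).integral_prod_left

lemma integrable_heatSemigroup {t : ℝ} (ht : 0 < t) {f : Space N → ℝ} (hf : Integrable f) :
    Integrable (heatSemigroup t f) :=
  driftHeat_zero t f ▸ integrable_driftHeat ht aestronglyMeasurable_zero hf

lemma integral_driftHeat {t : ℝ} (ht : 0 < t) {v : Space N → Space N}
    (hv : AEStronglyMeasurable v volume) {f : Space N → ℝ} (hf : Integrable f) :
    ∫ x, driftHeat t v f x = ∫ x, f x := by
  unfold driftHeat
  rw [integral_integral_swap (integrable_uncurry_driftHeat ht hv hf)]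
  refine integral_congr_ae (ae_of_all _ fun y => ?_)
  simp only
  rw [integral_mul_const]
  simp_rw [sub_add]
  rw [integral_sub_right_eq_self (fun x => heatKernel t x), integral_heatKernel ht, one_mul]

lemma lintegral_driftHeat_le {t : ℝ} (ht : 0 < t) {v : Space N → Space N}
    (hv : AEStronglyMeasurable v volume) {f : Space N → ℝ} (hf : Integrable f) :
    ∫⁻ x, ‖driftHeat t v f x‖ₑ ≤ ∫⁻ x, ‖f x‖ₑ := by
  refine (lintegral_enorm_integral_le (integrable_uncurry_driftHeat ht hv hf).1).trans
    (le_of_eq (lintegral_congr fun y => ?_))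
  simp_rw [enorm_mul]
  rw [lintegral_mul_const' _ _ enorm_ne_top,
    lintegral_displaced (fun x => ‖heatKernel t x‖ₑ), lintegral_enorm_heatKernel ht, one_mul]

lemma driftHeat_sub {t : ℝ} (ht : 0 < t) {v : Space N → Space N}
    (hv : AEStronglyMeasurable v volume) {f g : Space N → ℝ} (hf : Integrable f)
    (hg : Integrable g) (x : Space N) :
    driftHeat t v (f - g) x = driftHeat t v f x - driftHeat t v g x := by
  unfold driftHeat
  rw [← integral_sub (integrable_driftHeat_integrand ht hv hf x)
    (integrable_driftHeat_integrand ht hv hg x)]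
  simp [mul_sub]

/-- The displacement acts on the source before diffusion, so further diffusion only lengthens the
time. This is what makes the steps of the scheme telescope. -/
lemma heatSemigroup_driftHeat {a b : ℝ} (ha : 0 < a) (hb : 0 < b) {v : Space N → Space N}
    (hv : AEStronglyMeasurable v volume) {f : Space N → ℝ} (hf : Integrable f) (x : Space N) :
    heatSemigroup a (driftHeat b v f) x = driftHeat (a + b) v f x := by
  unfold heatSemigroup driftHeat
  simp_rw [← integral_const_mul]
  rw [integral_integral_swap]
  · refine integral_congr_ae (ae_of_all _ fun y => ?_)
    simp only
    simp_rw [← mul_assoc]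
    rw [integral_mul_const]
    simp_rw [sub_add]
    rw [integral_heatKernel_mul_heatKernel ha hb]
  · refine (integrable_uncurry_driftHeat hb hv hf).bdd_mul (c := heatPeak N a)
      (f := fun p : Space N × Space N => heatKernel a (x - p.1)) ?_ (ae_of_all _ fun y => ?_)
    · have := continuous_heatKernel (N := N) a
      exact (by fun_prop : Continuous fun p : Space N × Space N =>
        heatKernel a (x - p.1)).aestronglyMeasurable
    · rw [Real.norm_of_nonneg (heatKernel_pos ha _).le]
      exact heatKernel_le ha _

lemma heatSemigroup_heatSemigroup {a b : ℝ} (ha : 0 < a) (hb : 0 < b)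
    {f : Space N → ℝ} (hf : Integrable f) (x : Space N) :
    heatSemigroup a (heatSemigroup b f) x = heatSemigroup (a + b) f x := by
  simp_rw [← driftHeat_zero b f, ← driftHeat_zero (a + b) f]
  exact heatSemigroup_driftHeat ha hb aestronglyMeasurable_zero hf x

/-! ### The operator `∇ e^{tΔ}` -/

lemma aestronglyMeasurable_conv {E : Type*} [NormedAddCommGroup E] {Φ : Space N → E}
    (hΦ : Continuous Φ) :
    AEStronglyMeasurable (fun p : Space N × Space N => Φ (p.1 - p.2)) (volume.prod volume) :=
  (by fun_prop : Continuous fun p : Space N × Space N => Φ (p.1 - p.2)).aestronglyMeasurable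

lemma integrable_uncurry_heatDivergence {t : ℝ} (ht : 0 < t) {F : Space N → Space N}
    (hF : Integrable F) :
    Integrable (Function.uncurry fun x y => inner ℝ (gradient (heatKernel t) (x - y)) (F y))
      (volume.prod volume) := by
  refine integrable_uncurry_of_lintegral
    (AEStronglyMeasurable.inner (aestronglyMeasurable_conv (continuous_gradient_heatKernel t))
      hF.1.comp_snd) ?_
  calc _ ≤ ∫⁻ y, ENNReal.ofReal (gradConst N * t ^ (-(1 / 2) : ℝ)) * ‖F y‖ₑ := by
        refine lintegral_mono fun y => ?_
        refine (lintegral_mono fun x => enorm_inner_le _ _).trans ?_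
        rw [lintegral_mul_const' _ _ enorm_ne_top]
        gcongr
        rw [lintegral_sub_right_eq_self (fun x => ‖gradient (heatKernel t) x‖ₑ)]
        exact lintegral_enorm_gradient_heatKernel_le ht
    _ < ⊤ := by
        rw [lintegral_const_mul' _ _ ENNReal.ofReal_ne_top]
        exact ENNReal.mul_lt_top ENNReal.ofReal_lt_top hF.2

lemma integrable_heatDivergence_integrand {t : ℝ} (ht : 0 < t) {F : Space N → Space N}
    (hF : Integrable F) (x : Space N) :
    Integrable fun y => inner ℝ (gradient (heatKernel t) (x - y)) (F y) := by
  have hm : AEStronglyMeasurable (fun y => gradient (heatKernel t) (x - y)) volume := by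
    have := continuous_gradient_heatKernel (N := N) t
    exact (by fun_prop : Continuous fun y : Space N =>
      gradient (heatKernel t) (x - y)).aestronglyMeasurable
  refine (hF.norm.const_mul (gradConst N * t ^ (-(1 / 2) : ℝ) * heatPeak N (2 * t))).mono'
    (hm.inner hF.1) (ae_of_all _ fun y => ?_)
  refine (norm_inner_le_norm _ _).trans ?_
  gcongr
  exact norm_gradient_heatKernel_le_peak ht _

lemma heatDivergence_sub {t : ℝ} (ht : 0 < t) {F G : Space N → Space N}
    (hF : Integrable F) (hG : Integrable G) (x : Space N) :
    heatDivergence t (F - G) x = heatDivergence t F x - heatDivergence t G x := by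
  unfold heatDivergence
  rw [← integral_sub (integrable_heatDivergence_integrand ht hF x)
    (integrable_heatDivergence_integrand ht hG x)]
  simp [inner_sub_right]

lemma heatDivergence_smul (t c : ℝ) (F : Space N → Space N) (x : Space N) :
    heatDivergence t (c • F) x = c * heatDivergence t F x := by
  unfold heatDivergence
  rw [← integral_const_mul]
  simp [inner_smul_right]

lemma integrable_heatDivergence {t : ℝ} (ht : 0 < t) {F : Space N → Space N}
    (hF : Integrable F) : Integrable (heatDivergence t F) :=
  (integrable_uncurry_heatDivergence ht hF).integral_prod_left

lemma norm_heatDivergence_le {t : ℝ} (ht : 0 < t) {F : Space N → Space N}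
    (hF : Integrable F) (x : Space N) :
    ‖heatDivergence t F x‖ ≤
      gradConst N * t ^ (-(1 / 2) : ℝ) * heatPeak N (2 * t) * ∫ y, ‖F y‖ := by
  rw [← integral_const_mul]
  refine norm_integral_le_of_norm_le (hF.norm.const_mul _) (ae_of_all _ fun y => ?_)
  refine (norm_inner_le_norm _ _).trans ?_
  gcongr
  exact norm_gradient_heatKernel_le_peak ht _

lemma lintegral_heatDivergence_le {t : ℝ} (ht : 0 < t) {F : Space N → Space N}
    (hF : Integrable F) :
    ∫⁻ x, ‖heatDivergence t F x‖ₑ ≤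
      ENNReal.ofReal (gradConst N * t ^ (-(1 / 2) : ℝ)) * ∫⁻ y, ‖F y‖ₑ := by
  rw [← lintegral_const_mul' _ _ ENNReal.ofReal_ne_top]
  refine (lintegral_enorm_integral_le (integrable_uncurry_heatDivergence ht hF).1).trans
    (lintegral_mono fun y => ?_)
  refine (lintegral_mono fun x => enorm_inner_le _ _).trans ?_
  rw [lintegral_mul_const' _ _ enorm_ne_top]
  gcongr
  rw [lintegral_sub_right_eq_self (fun x => ‖gradient (heatKernel t) x‖ₑ)]
  exact lintegral_enorm_gradient_heatKernel_le ht

lemma heatSemigroup_heatDivergence {a b : ℝ} (ha : 0 < a) (hb : 0 < b) {F : Space N → Space N}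
    (hF : Integrable F) (x : Space N) :
    heatSemigroup a (heatDivergence b F) x = heatDivergence (a + b) F x := by
  unfold heatSemigroup heatDivergence
  simp_rw [← integral_const_mul]
  rw [integral_integral_swap]
  · refine integral_congr_ae (ae_of_all _ fun y => ?_)
    simp only
    have h := integral_inner (𝕜 := ℝ) (integrable_heatKernel_smul_gradient ha hb x y) (F y)
    rw [integral_heatKernel_smul_gradient ha hb] at h
    rw [real_inner_comm, ← h]
    simp_rw [inner_smul_right, real_inner_comm (F y)]
  · refine (integrable_uncurry_heatDivergence hb hF).bdd_mul (c := heatPeak N a)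
      (f := fun p : Space N × Space N => heatKernel a (x - p.1)) ?_ (ae_of_all _ fun y => ?_)
    · have := continuous_heatKernel (N := N) a
      exact (by fun_prop : Continuous fun p : Space N × Space N =>
        heatKernel a (x - p.1)).aestronglyMeasurable
    · rw [Real.norm_of_nonneg (heatKernel_pos ha _).le]
      exact heatKernel_le ha _

lemma lintegral_heatDivergence_time_le {t δ : ℝ} (ht : 0 < t) (hδ : 0 ≤ δ)
    {F : Space N → Space N} (hF : Integrable F) :
    ∫⁻ x, ‖heatDivergence (δ + t) F x - heatDivergence t F x‖ₑ ≤
      ENNReal.ofReal (gradTimeConst N * δ ^ (1 / 4 : ℝ) * t ^ (-(3 / 4) : ℝ)) *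
        ∫⁻ y, ‖F y‖ₑ := by
  rw [← lintegral_const_mul' _ _ ENNReal.ofReal_ne_top]
  have h : ∀ x, heatDivergence (δ + t) F x - heatDivergence t F x = ∫ y,
      inner ℝ (gradient (heatKernel (δ + t)) (x - y) - gradient (heatKernel t) (x - y)) (F y) := by
    intro x
    unfold heatDivergence
    rw [← integral_sub (integrable_heatDivergence_integrand (by positivity) hF x)
      (integrable_heatDivergence_integrand ht hF x)]
    simp_rw [inner_sub_left]
  simp_rw [h]
  have h1 := continuous_gradient_heatKernel (N := N) (δ + t)
  have h2 := continuous_gradient_heatKernel (N := N) t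
  refine (lintegral_enorm_integral_le ?_).trans (lintegral_mono fun y => ?_)
  · exact AEStronglyMeasurable.inner (aestronglyMeasurable_conv (h1.sub h2)) hF.1.comp_snd
  refine (lintegral_mono fun x => enorm_inner_le _ _).trans ?_
  rw [lintegral_mul_const' _ _ enorm_ne_top]
  gcongr
  rw [lintegral_sub_right_eq_self
    (fun x => ‖gradient (heatKernel (δ + t)) x - gradient (heatKernel t) x‖ₑ)]
  exact lintegral_gradient_heatKernel_time_le ht hδ

/-! ### Comparison of the displacement with the drift term -/

/-- Stability estimate, to be applied to the error of the scheme: its singularity `t^{-1/2}` is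
integrable. -/
lemma lintegral_driftHeat_sub_le {t δ : ℝ} (ht : 0 < t) {v : Space N → Space N}
    (hv : AEStronglyMeasurable v volume) (hδ : ∀ y, ‖v y‖ ≤ δ)
    {f : Space N → ℝ} (hf : Integrable f) :
    ∫⁻ x, ‖driftHeat t v f x - heatSemigroup t f x‖ₑ ≤
      ENNReal.ofReal (gradConst N * t ^ (-(1 / 2) : ℝ)) * ENNReal.ofReal δ * ∫⁻ y, ‖f y‖ₑ := by
  rw [← lintegral_const_mul' _ _ (ENNReal.mul_ne_top ENNReal.ofReal_ne_top ENNReal.ofReal_ne_top)]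
  have h : ∀ x, driftHeat t v f x - heatSemigroup t f x =
      ∫ y, (heatKernel t (x - y + v y) - heatKernel t (x - y)) * f y := by
    intro x
    have := integrable_driftHeat_integrand ht (aestronglyMeasurable_zero : AEStronglyMeasurable
      (0 : Space N → Space N) volume) hf x
    simp only [Pi.zero_apply, add_zero] at this
    unfold driftHeat heatSemigroup
    rw [← integral_sub (integrable_driftHeat_integrand ht hv hf x) this]
    simp_rw [sub_mul]
  simp_rw [h]
  refine (lintegral_enorm_integral_le ?_).trans (lintegral_mono fun y => ?_)
  · exact ((aestronglyMeasurable_displaced (continuous_heatKernel t) hv).sub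
      (aestronglyMeasurable_conv (continuous_heatKernel t))).mul hf.1.comp_snd
  simp_rw [enorm_mul]
  rw [lintegral_mul_const' _ _ enorm_ne_top]
  gcongr
  rw [lintegral_sub_right_eq_self (fun x => ‖heatKernel t (x + v y) - heatKernel t x‖ₑ)]
  refine (lintegral_heatKernel_shift_le ht (v y)).trans ?_
  gcongr
  rw [← ofReal_norm]
  exact ENNReal.ofReal_le_ofReal (hδ y)

/-- Consistency estimate: to first order in `v`, moving the mass from `y` to `y - v y` adds the
drift term `∇e^{tΔ}(f v)`. The nonintegrable `1/t` is compensated later by the second factor `δ`. -/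
lemma lintegral_driftHeat_taylor_le {t δ : ℝ} (ht : 0 < t) {v : Space N → Space N}
    (hv : AEStronglyMeasurable v volume) (hδ : ∀ y, ‖v y‖ ≤ δ)
    {f : Space N → ℝ} (hf : Integrable f) :
    ∫⁻ x, ‖driftHeat t v f x - heatSemigroup t f x - heatDivergence t (fun y => f y • v y) x‖ₑ ≤
      ENNReal.ofReal (2 * gradConst N ^ 2 / t) * ENNReal.ofReal δ * ENNReal.ofReal δ *
        ∫⁻ y, ‖f y‖ₑ := by
  rw [← lintegral_const_mul' _ _ (ENNReal.mul_ne_top (ENNReal.mul_ne_top ENNReal.ofReal_ne_top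
    ENNReal.ofReal_ne_top) ENNReal.ofReal_ne_top)]
  have hF : Integrable fun y => f y • v y := hf.smul_bdd δ hv (ae_of_all _ hδ)
  have h : ∀ x, driftHeat t v f x - heatSemigroup t f x -
      heatDivergence t (fun y => f y • v y) x =
      ∫ y, (heatKernel t (x - y + v y) - heatKernel t (x - y) -
        inner ℝ (gradient (heatKernel t) (x - y)) (v y)) * f y := by
    intro x
    have h0 := integrable_driftHeat_integrand ht (aestronglyMeasurable_zero : AEStronglyMeasurable
      (0 : Space N → Space N) volume) hf x
    simp only [Pi.zero_apply, add_zero] at h0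
    have h1 := integrable_driftHeat_integrand ht hv hf x
    have h2 : Integrable fun y =>
        heatKernel t (x - y + v y) * f y - heatKernel t (x - y) * f y := h1.sub h0
    unfold driftHeat heatSemigroup heatDivergence
    rw [← integral_sub h1 h0, ← integral_sub h2
      (integrable_heatDivergence_integrand ht hF x)]
    refine integral_congr_ae (ae_of_all _ fun y => ?_)
    simp only [inner_smul_right]
    ring
  simp_rw [h]
  refine (lintegral_enorm_integral_le ?_).trans (lintegral_mono fun y => ?_)
  · exact (((aestronglyMeasurable_displaced (continuous_heatKernel t) hv).sub
      (aestronglyMeasurable_conv (continuous_heatKernel t))).sub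
      (AEStronglyMeasurable.inner (aestronglyMeasurable_conv (continuous_gradient_heatKernel t))
        hv.comp_snd)).mul hf.1.comp_snd
  simp_rw [enorm_mul]
  rw [lintegral_mul_const' _ _ enorm_ne_top]
  gcongr
  rw [lintegral_sub_right_eq_self (fun x => ‖heatKernel t (x + v y) - heatKernel t x -
    inner ℝ (gradient (heatKernel t) x) (v y)‖ₑ)]
  refine (lintegral_heatKernel_taylor_le ht (v y)).trans ?_
  have : ‖v y‖ₑ ≤ ENNReal.ofReal δ := by
    rw [← ofReal_norm]
    exact ENNReal.ofReal_le_ofReal (hδ y)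
  gcongr

/-! ### Time-dependent fluxes and the Duhamel term -/

/-- A flux `F`, continuous in time on `[a, b]` with values in `L¹` and bounded there by `A`. -/
structure IsFlux (a b : ℝ) (A : ℝ≥0) (F : ℝ → Space N → Space N) : Prop where
  integrable : ∀ s ∈ Icc a b, Integrable (F s)
  lintegral_le : ∀ s ∈ Icc a b, ∫⁻ y, ‖F s y‖ₑ ≤ A
  tendsto : ∀ s₀ ∈ Icc a b,
    Tendsto (fun s => ∫⁻ y, ‖F s y - F s₀ y‖ₑ) (𝓝[Icc a b] s₀) (𝓝 0)

lemma IsFlux.mono {a b a' b' : ℝ} {A : ℝ≥0} {F : ℝ → Space N → Space N} (h : IsFlux a b A F)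
    (ha : a ≤ a') (hb : b' ≤ b) : IsFlux a' b' A F where
  integrable s hs := h.integrable s (Icc_subset_Icc ha hb hs)
  lintegral_le s hs := h.lintegral_le s (Icc_subset_Icc ha hb hs)
  tendsto s hs := (h.tendsto s (Icc_subset_Icc ha hb hs)).mono_left
    (nhdsWithin_mono _ (Icc_subset_Icc ha hb))

lemma continuousAt_heatDivergence {F : Space N → Space N} (hF : Integrable F) {t s₀ : ℝ}
    (h : s₀ < t) (x₀ : Space N) :
    ContinuousAt (fun p : ℝ × Space N => heatDivergence (t - p.1) F p.2) (s₀, x₀) := by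
  have hpos : 0 < t - s₀ := sub_pos.2 h
  have hev : ∀ᶠ p : ℝ × Space N in 𝓝 (s₀, x₀), p.1 < (s₀ + t) / 2 :=
    continuousAt_fst.eventually (gt_mem_nhds (by simp only; linarith))
  set σ := (t - s₀) / 2 with hσ
  have hσ0 : 0 < σ := by positivity
  have hc := gradConst_pos (N := N)
  unfold heatDivergence
  refine tendsto_integral_filter_of_dominated_convergence
    (fun y => gradConst N * σ ^ (-(1 / 2) : ℝ) * heatPeak N (2 * σ) * ‖F y‖) ?_ ?_
    (hF.norm.const_mul _) ?_
  · filter_upwards [hev] with p hp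
    exact (integrable_heatDivergence_integrand (by linarith) hF p.2).1
  · filter_upwards [hev] with p hp
    refine ae_of_all _ fun y => (norm_inner_le_norm _ _).trans ?_
    have hp' : σ ≤ t - p.1 := by linarith
    have hpp : 0 < t - p.1 := hσ0.trans_le hp'
    gcongr
    refine (norm_gradient_heatKernel_le_peak hpp _).trans ?_
    have h1 : (t - p.1) ^ (-(1 / 2) : ℝ) ≤ σ ^ (-(1 / 2) : ℝ) :=
      Real.rpow_le_rpow_of_nonpos hσ0 hp' (by norm_num)
    have h2 : heatPeak N (2 * (t - p.1)) ≤ heatPeak N (2 * σ) := by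
      have := Real.pi_pos
      unfold heatPeak
      gcongr
    have h3 := heatPeak_pos (N := N) (t := 2 * (t - p.1)) (by positivity)
    gcongr
  · refine ae_of_all _ fun y => Tendsto.inner ?_ tendsto_const_nhds
    have h1 := continuousAt_uncurry_gradient_heatKernel hpos (x₀ - y)
    have h2 : ContinuousAt (fun p : ℝ × Space N => (t - p.1, p.2 - y)) (s₀, x₀) := by fun_prop
    exact ContinuousAt.comp (f := fun p : ℝ × Space N => (t - p.1, p.2 - y)) h1 h2

lemma toReal_lintegral_enorm {α E : Type*} [MeasurableSpace α] {μ : Measure α}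
    [NormedAddCommGroup E] {f : α → E} (hf : AEStronglyMeasurable f μ) :
    ∫ x, ‖f x‖ ∂μ = (∫⁻ x, ‖f x‖ₑ ∂μ).toReal :=
  integral_norm_eq_lintegral_enorm hf

/-- The functions `F s` are representatives chosen separately for each `s`, so `(s, y) ↦ F s y` need
not be measurable. The heat kernel removes this dependence: for `s < t` the Duhamel integrand is
jointly continuous in `(s, x)`, which provides the measurability behind every use of Fubini below.
-/
lemma IsFlux.continuousOn {a b : ℝ} {A : ℝ≥0} {F : ℝ → Space N → Space N} (h : IsFlux a b A F)
    (t : ℝ) : ContinuousOn (fun p : ℝ × Space N => heatDivergence (t - p.1) (F p.1) p.2)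
      ((Icc a b ∩ Iio t) ×ˢ univ) := by
  rintro ⟨s₀, x₀⟩ ⟨⟨hs₀, hst⟩, -⟩
  simp only [mem_Iio] at hs₀ hst
  have hpos : 0 < t - s₀ := sub_pos.2 hst
  have hc := gradConst_pos (N := N)
  set l := 𝓝[(Icc a b ∩ Iio t) ×ˢ (univ : Set (Space N))] (s₀, x₀) with hl
  have hmem : ∀ᶠ p in l, p.1 ∈ Icc a b ∩ Iio t := by
    filter_upwards [self_mem_nhdsWithin] with p hp using hp.1
  have hfst : Tendsto (fun p : ℝ × Space N => p.1) l (𝓝[Icc a b] s₀) :=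
    tendsto_nhdsWithin_iff.2 ⟨continuousAt_fst.mono_left nhdsWithin_le_nhds,
      hmem.mono fun p hp => hp.1⟩
  have h2 : Tendsto (fun p : ℝ × Space N => heatDivergence (t - p.1) (F s₀) p.2) l
      (𝓝 (heatDivergence (t - s₀) (F s₀) x₀)) :=
    (continuousAt_heatDivergence (h.integrable s₀ hs₀) hst x₀).mono_left nhdsWithin_le_nhds
  have h1 : Tendsto (fun p : ℝ × Space N => heatDivergence (t - p.1) (F p.1 - F s₀) p.2) l
      (𝓝 0) := by
    have hlim : Tendsto (fun p : ℝ × Space N => gradConst N * (t - p.1) ^ (-(1 / 2) : ℝ) *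
        heatPeak N (2 * (t - p.1)) * (∫⁻ y, ‖F p.1 y - F s₀ y‖ₑ).toReal) l
        (𝓝 (gradConst N * (t - s₀) ^ (-(1 / 2) : ℝ) * heatPeak N (2 * (t - s₀)) *
          (0 : ℝ≥0∞).toReal)) := by
      refine Tendsto.mul ?_ ((ENNReal.tendsto_toReal ENNReal.zero_ne_top).comp
        ((h.tendsto s₀ hs₀).comp hfst))
      refine Tendsto.mono_left (x := 𝓝 (s₀, x₀)) ?_ nhdsWithin_le_nhds
      have e1 : ContinuousAt (fun p : ℝ × Space N => (t - p.1) ^ (-(1 / 2) : ℝ)) (s₀, x₀) :=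
        ContinuousAt.rpow (by fun_prop) continuousAt_const (Or.inl hpos.ne')
      have e2 : ContinuousAt (fun p : ℝ × Space N => heatPeak N (2 * (t - p.1))) (s₀, x₀) := by
        have := Real.pi_pos
        unfold heatPeak
        refine ContinuousAt.div continuousAt_const
          (ContinuousAt.rpow (by fun_prop) continuousAt_const (Or.inl ?_)) ?_
        · simp only; positivity
        · simp only; positivity
      exact (continuousAt_const.mul e1).mul e2
    rw [ENNReal.toReal_zero, mul_zero] at hlim
    refine squeeze_zero_norm' ?_ hlim
    filter_upwards [hmem] with p hp
    have hi := (h.integrable p.1 hp.1).sub (h.integrable s₀ hs₀)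
    have := norm_heatDivergence_le (sub_pos.2 hp.2) hi p.2
    rw [toReal_lintegral_enorm hi.1] at this
    exact this
  have h3 := h1.add h2
  rw [zero_add] at h3
  refine h3.congr' ?_
  filter_upwards [hmem] with p hp
  rw [heatDivergence_sub (sub_pos.2 hp.2) (h.integrable p.1 hp.1) (h.integrable s₀ hs₀)]
  ring

lemma lintegral_sub_rpow {r a b t : ℝ} (hr : -1 < r) (hab : a ≤ b) (hbt : b ≤ t) :
    ∫⁻ s in Ioo a b, ENNReal.ofReal ((t - s) ^ r) =
      ENNReal.ofReal (((t - a) ^ (r + 1) - (t - b) ^ (r + 1)) / (r + 1)) := by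
  have hi : IntervalIntegrable (fun s => (t - s) ^ r) volume a b := by
    have h1 := (intervalIntegral.intervalIntegrable_rpow' (a := t - a) (b := t - b) hr).comp_sub_left
      (c := t)
    simpa using h1
  rw [← integral_rpow (Or.inl hr), ← intervalIntegral.integral_comp_sub_left (fun s => s ^ r) t,
    intervalIntegral.integral_of_le hab, integral_Ioc_eq_integral_Ioo]
  refine (ofReal_integral_eq_lintegral_ofReal ?_ ?_).symm
  · exact ((intervalIntegrable_iff_integrableOn_Ioc_of_le hab).1 hi).mono_set Ioo_subset_Ioc_self
  · filter_upwards [ae_restrict_mem measurableSet_Ioo] with s hs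
    exact Real.rpow_nonneg (by linarith [hs.2]) _

/-- The contribution of the times `[a, b]` to the Duhamel term at time `t`. -/
def fluxIntegral (F : ℝ → Space N → Space N) (t a b : ℝ) (x : Space N) : ℝ :=
  ∫ s in Ioo a b, heatDivergence (t - s) (F s) x

lemma fluxIntegral_eq (F : ℝ → Space N → Space N) (t : ℝ) {a b : ℝ} (hab : a ≤ b)
    (x : Space N) :
    ∫ s in a..b, heatDivergence (t - s) (F s) x = fluxIntegral F t a b x := by
  rw [intervalIntegral.integral_of_le hab, integral_Ioc_eq_integral_Ioo]
  rfl

section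
variable {a b : ℝ} {A : ℝ≥0} {F : ℝ → Space N → Space N}

lemma IsFlux.aestronglyMeasurable (h : IsFlux a b A F) {t : ℝ} (hbt : b ≤ t) :
    AEStronglyMeasurable (fun p : ℝ × Space N => heatDivergence (t - p.1) (F p.1) p.2)
      ((volume.restrict (Ioo a b)).prod volume) := by
  have h1 : ((volume.restrict (Ioo a b)).prod (volume : Measure (Space N))) =
      ((volume : Measure ℝ).prod (volume : Measure (Space N))).restrict (Ioo a b ×ˢ univ) := by
    rw [← Measure.prod_restrict, Measure.restrict_univ]
  rw [h1]
  refine ContinuousOn.aestronglyMeasurable ((h.continuousOn t).mono ?_)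
    (measurableSet_Ioo.prod MeasurableSet.univ)
  rintro ⟨s, x⟩ ⟨hs, -⟩
  exact ⟨⟨Ioo_subset_Icc_self hs, hs.2.trans_le hbt⟩, mem_univ _⟩

lemma IsFlux.lintegral_lintegral_le (h : IsFlux a b A F) {t : ℝ} (hab : a ≤ b) (hbt : b ≤ t) :
    ∫⁻ s in Ioo a b, ∫⁻ x, ‖heatDivergence (t - s) (F s) x‖ₑ ≤
      ENNReal.ofReal (2 * gradConst N * ((t - a) ^ (1 / 2 : ℝ) - (t - b) ^ (1 / 2 : ℝ))) * A := by
  have hc := gradConst_pos (N := N)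
  calc ∫⁻ s in Ioo a b, ∫⁻ x, ‖heatDivergence (t - s) (F s) x‖ₑ
      ≤ ∫⁻ s in Ioo a b, (ENNReal.ofReal (gradConst N) * A) *
          ENNReal.ofReal ((t - s) ^ (-(1 / 2) : ℝ)) := by
        refine setLIntegral_mono_ae' measurableSet_Ioo (ae_of_all _ fun s hs => ?_)
        have hst : 0 < t - s := by linarith [hs.2]
        refine (lintegral_heatDivergence_le hst (h.integrable s (Ioo_subset_Icc_self hs))).trans ?_
        rw [ENNReal.ofReal_mul hc.le]
        calc _ ≤ ENNReal.ofReal (gradConst N) * ENNReal.ofReal ((t - s) ^ (-(1 / 2) : ℝ)) * A := by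
              gcongr
              exact h.lintegral_le s (Ioo_subset_Icc_self hs)
          _ = _ := by ring
    _ = _ := by
        rw [lintegral_const_mul' _ _ (ENNReal.mul_ne_top ENNReal.ofReal_ne_top ENNReal.coe_ne_top),
          lintegral_sub_rpow (by norm_num) hab hbt, mul_right_comm, ← ENNReal.ofReal_mul hc.le]
        norm_num
        congr 2
        ring

lemma IsFlux.integrable_uncurry (h : IsFlux a b A F) {t : ℝ} (hab : a ≤ b) (hbt : b ≤ t) :
    Integrable (Function.uncurry fun (x : Space N) s => heatDivergence (t - s) (F s) x)
      (volume.prod (volume.restrict (Ioo a b))) := by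
  refine integrable_uncurry_of_lintegral ((h.aestronglyMeasurable hbt).prod_swap) ?_
  exact (h.lintegral_lintegral_le hab hbt).trans_lt
    (ENNReal.mul_lt_top ENNReal.ofReal_lt_top ENNReal.coe_lt_top)

lemma IsFlux.integrable_fluxIntegral (h : IsFlux a b A F) {t : ℝ} (hab : a ≤ b) (hbt : b ≤ t) :
    Integrable (fluxIntegral F t a b) :=
  (h.integrable_uncurry hab hbt).integral_prod_left

/-- Holds only for almost every `x`, because Fubini gives integrability in `s` only there. -/
lemma IsFlux.fluxIntegral_add (h : IsFlux a b A F) {t c : ℝ} (hac : a ≤ c) (hcb : c ≤ b)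
    (hbt : b ≤ t) :
    ∀ᵐ x, fluxIntegral F t a b x = fluxIntegral F t a c x + fluxIntegral F t c b x := by
  filter_upwards [(h.integrable_uncurry (hac.trans hcb) hbt).prod_right_ae] with x hx
  simp only [Function.uncurry] at hx
  have hx' : IntegrableOn (fun s => heatDivergence (t - s) (F s) x) (Ioc a b) :=
    (integrableOn_Ioc_iff_integrableOn_Ioo (by simp)).2 hx
  rw [← fluxIntegral_eq F t (hac.trans hcb), ← fluxIntegral_eq F t hac, ← fluxIntegral_eq F t hcb]
  refine (intervalIntegral.integral_add_adjacent_intervals ?_ ?_).symm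
  · exact (intervalIntegrable_iff_integrableOn_Ioc_of_le hac).2
      (hx'.mono_set (Ioc_subset_Ioc_right hcb))
  · exact (intervalIntegrable_iff_integrableOn_Ioc_of_le hcb).2
      (hx'.mono_set (Ioc_subset_Ioc_left hac))

lemma IsFlux.heatSemigroup_fluxIntegral (h : IsFlux a b A F) {t τ : ℝ} (hab : a ≤ b)
    (hbt : b ≤ t) (hτ : 0 < τ) (x : Space N) :
    heatSemigroup τ (fluxIntegral F t a b) x = fluxIntegral F (τ + t) a b x := by
  unfold heatSemigroup fluxIntegral
  simp_rw [← integral_const_mul]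
  rw [integral_integral_swap]
  · refine setIntegral_congr_fun measurableSet_Ioo fun s hs => ?_
    have := heatSemigroup_heatDivergence hτ (by linarith [hs.2] : 0 < t - s)
      (h.integrable s (Ioo_subset_Icc_self hs)) x
    rw [add_sub_assoc, ← this]
    rfl
  · refine (h.integrable_uncurry hab hbt).bdd_mul (c := heatPeak N τ)
      (f := fun p : Space N × ℝ => heatKernel τ (x - p.1)) ?_ (ae_of_all _ fun y => ?_)
    · have := continuous_heatKernel (N := N) τ
      exact (by fun_prop : Continuous fun p : Space N × ℝ =>
        heatKernel τ (x - p.1)).aestronglyMeasurable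
    · rw [Real.norm_of_nonneg (heatKernel_pos hτ _).le]
      exact heatKernel_le hτ _

end

/-! ### Solutions of the linear equation with bounded drift -/

/-- `ρ` is a mild solution on `[0, t₁]` of `∂ₜρ = ∇ · (ρ b) + Δρ` with `|b| ≤ B`, bounded in `L¹`
and with flux `ρ b` continuous in time with values in `L¹`. -/
structure IsDriftSolution (t₁ : ℝ) (B : ℝ≥0) (b : ℝ → Space N → Space N)
    (ρ : ℝ → Space N → ℝ) : Prop where
  integrable : ∀ s ∈ Icc 0 t₁, Integrable (ρ s)
  bounded : ∃ M : ℝ≥0, ∀ s ∈ Icc 0 t₁, ∫⁻ x, ‖ρ s x‖ₑ ≤ M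
  measurable_drift : ∀ s ∈ Icc 0 t₁, AEStronglyMeasurable (b s) volume
  norm_drift_le : ∀ s ∈ Icc 0 t₁, ∀ y, ‖b s y‖ ≤ B
  tendsto_flux : ∀ s₀ ∈ Icc 0 t₁, Tendsto
    (fun s => ∫⁻ y, ‖ρ s y • b s y - ρ s₀ y • b s₀ y‖ₑ) (𝓝[Icc 0 t₁] s₀) (𝓝 0)
  duhamel : ∀ t ∈ Ioc 0 t₁, ∀ᵐ x, ρ t x =
    heatSemigroup t (ρ 0) x + fluxIntegral (fun s y => ρ s y • b s y) t 0 t x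

section
variable {t₁ : ℝ} {B : ℝ≥0} {b : ℝ → Space N → Space N} {ρ : ℝ → Space N → ℝ}

lemma IsDriftSolution.mono (h : IsDriftSolution t₁ B b ρ) {t : ℝ} (ht : t ≤ t₁) :
    IsDriftSolution t B b ρ where
  integrable s hs := h.integrable s (Icc_subset_Icc_right ht hs)
  bounded := h.bounded.imp fun _ hM s hs => hM s (Icc_subset_Icc_right ht hs)
  measurable_drift s hs := h.measurable_drift s (Icc_subset_Icc_right ht hs)
  norm_drift_le s hs := h.norm_drift_le s (Icc_subset_Icc_right ht hs)
  tendsto_flux s hs := (h.tendsto_flux s (Icc_subset_Icc_right ht hs)).mono_left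
    (nhdsWithin_mono _ (Icc_subset_Icc_right ht))
  duhamel s hs := h.duhamel s (Ioc_subset_Ioc_right ht hs)

lemma enorm_le_coe_of_norm_le {E : Type*} [NormedAddCommGroup E] {x : E} {B : ℝ≥0}
    (h : ‖x‖ ≤ B) : ‖x‖ₑ ≤ B := by
  rw [← ofReal_norm, ← ENNReal.ofReal_coe_nnreal]
  exact ENNReal.ofReal_le_ofReal h

lemma IsDriftSolution.exists_isFlux (h : IsDriftSolution t₁ B b ρ) :
    ∃ A : ℝ≥0, IsFlux 0 t₁ A (fun s y => ρ s y • b s y) := by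
  obtain ⟨M, hM⟩ := h.bounded
  refine ⟨M * B, fun s hs => ?_, fun s hs => ?_, h.tendsto_flux⟩
  · exact (h.integrable s hs).smul_bdd (B : ℝ) (h.measurable_drift s hs)
      (ae_of_all _ (h.norm_drift_le s hs))
  · calc ∫⁻ y, ‖ρ s y • b s y‖ₑ ≤ ∫⁻ y, ‖ρ s y‖ₑ * B := by
          refine lintegral_mono fun y => ?_
          rw [enorm_smul]
          gcongr
          exact enorm_le_coe_of_norm_le (h.norm_drift_le s hs y)
      _ ≤ _ := by
          rw [lintegral_mul_const' _ _ ENNReal.coe_ne_top, ENNReal.coe_mul]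
          gcongr
          exact hM s hs

lemma heatSemigroup_congr {t : ℝ} {f g : Space N → ℝ} (h : f =ᵐ[volume] g) (x : Space N) :
    heatSemigroup t f x = heatSemigroup t g x := by
  refine integral_congr_ae ?_
  filter_upwards [h] with y hy
  rw [hy]

lemma heatSemigroup_add {t : ℝ} (ht : 0 < t) {f g : Space N → ℝ} (hf : Integrable f)
    (hg : Integrable g) (x : Space N) :
    heatSemigroup t (fun y => f y + g y) x = heatSemigroup t f x + heatSemigroup t g x := by
  have h0 : ∀ {f : Space N → ℝ}, Integrable f → Integrable fun y => heatKernel t (x - y) * f y := by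
    intro f hf
    simpa using integrable_driftHeat_integrand ht (aestronglyMeasurable_zero : AEStronglyMeasurable
      (0 : Space N → Space N) volume) hf x
  unfold heatSemigroup
  rw [← integral_add (h0 hf) (h0 hg)]
  simp [mul_add]

/-- The mild formulation started at the time `r`. -/
lemma IsDriftSolution.restart (h : IsDriftSolution t₁ B b ρ) {r t : ℝ} (hr : 0 ≤ r) (hrt : r < t)
    (ht : t ≤ t₁) : ∀ᵐ x, ρ t x =
      heatSemigroup (t - r) (ρ r) x + fluxIntegral (fun s y => ρ s y • b s y) t r t x := by
  rcases hr.eq_or_lt with rfl | hr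
  · simpa using h.duhamel t ⟨hrt, ht⟩
  obtain ⟨A, hF⟩ := h.exists_isFlux
  have hF' := hF.mono le_rfl ht
  have hFr := hF.mono le_rfl (hrt.le.trans ht)
  have h0 := h.integrable 0 ⟨le_rfl, (hr.trans hrt).le.trans ht⟩
  filter_upwards [h.duhamel t ⟨hr.trans hrt, ht⟩, hF'.fluxIntegral_add hr.le hrt.le le_rfl]
    with x hx hx2
  -- Applying `e^{(t-r)Δ}` to Duhamel's formula at time `r` reproduces exactly the part of the
  -- formula at time `t` that comes from times before `r`.
  rw [hx, hx2, heatSemigroup_congr (h.duhamel r ⟨hr, hrt.le.trans ht⟩),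
    heatSemigroup_add (sub_pos.2 hrt) (integrable_heatSemigroup hr h0)
      (hFr.integrable_fluxIntegral hr.le le_rfl),
    heatSemigroup_heatSemigroup (sub_pos.2 hrt) hr h0,
    hFr.heatSemigroup_fluxIntegral hr.le le_rfl (sub_pos.2 hrt), sub_add_cancel, add_assoc]

end

/-! ### The Euler scheme for the drift equation -/

/-- Uniform continuity on a compact interval, for the flux viewed as a curve in the space `L¹`. -/
lemma IsFlux.exists_modulus {a b : ℝ} {A : ℝ≥0} {F : ℝ → Space N → Space N}
    (h : IsFlux a b A F) {ε : ℝ} (hε : 0 < ε) :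
    ∃ δ > 0, ∀ s ∈ Icc a b, ∀ r ∈ Icc a b, |s - r| < δ →
      ∫⁻ y, ‖F s y - F r y‖ₑ ≤ ENNReal.ofReal ε := by
  set φ : Icc a b → Lp (Space N) 1 (volume : Measure (Space N)) :=
    fun s => (h.integrable s s.2).toL1 (F s) with hφ
  have hdist : ∀ s r : Icc a b, edist (φ s) (φ r) = ∫⁻ y, ‖F s y - F r y‖ₑ := by
    intro s r
    rw [hφ]
    rw [Integrable.edist_toL1_toL1]
    simp only [edist_eq_enorm_sub]
  have hcont : Continuous φ := by
    refine continuous_iff_continuousAt.2 fun s => ?_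
    rw [ContinuousAt, tendsto_iff_edist_tendsto_0]
    simp_rw [hdist]
    refine (h.tendsto s s.2).comp (tendsto_nhdsWithin_iff.2
      ⟨continuous_subtype_val.continuousAt, Eventually.of_forall fun r => r.2⟩)
  have hu := CompactSpace.uniformContinuous_of_continuous hcont
  rw [Metric.uniformContinuous_iff] at hu
  obtain ⟨δ, hδ, H⟩ := hu ε hε
  refine ⟨δ, hδ, fun s hs r hr hsr => ?_⟩
  have h1 := H (a := ⟨s, hs⟩) (b := ⟨r, hr⟩) (by simpa [Subtype.dist_eq, Real.dist_eq] using hsr)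
  rw [← hdist ⟨s, hs⟩ ⟨r, hr⟩, edist_dist]
  exact ENNReal.ofReal_le_ofReal h1.le

lemma lintegral_enorm_add_le {α E : Type*} [MeasurableSpace α] {μ : Measure α}
    [NormedAddCommGroup E] {f g : α → E} (hf : AEStronglyMeasurable f μ) :
    ∫⁻ x, ‖f x + g x‖ₑ ∂μ ≤ ∫⁻ x, ‖f x‖ₑ ∂μ + ∫⁻ x, ‖g x‖ₑ ∂μ := by
  rw [← lintegral_add_left' hf.enorm]
  exact lintegral_mono fun x => enorm_add_le _ _

section
variable {t₁ : ℝ} {B : ℝ≥0} {b : ℝ → Space N → Space N} {ρ : ℝ → Space N → ℝ}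

/-- Two things are frozen at `s₀`: the kernel time, costing `η^{1/4} (t-s)^{-3/4}`, and the flux,
costing `ε (t-s)^{-1/2}`. The bound stays an integral over the step, so that summing over the steps
gives integrable singularities. -/
lemma IsFlux.lintegral_step_le {A : ℝ≥0} {F : ℝ → Space N → Space N} (hF : IsFlux 0 t₁ A F)
    {s₀ t η ε : ℝ} (hs₀ : 0 ≤ s₀) (hη : 0 < η) (hst : s₀ + η ≤ t) (ht : t ≤ t₁)
    (hε : ∀ s ∈ Icc s₀ (s₀ + η), ∫⁻ y, ‖F s₀ y - F s y‖ₑ ≤ ENNReal.ofReal ε) :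
    ∫⁻ x, ‖η * heatDivergence (t - s₀) (F s₀) x - fluxIntegral F t s₀ (s₀ + η) x‖ₑ ≤
      ∫⁻ s in Ioo s₀ (s₀ + η),
        (ENNReal.ofReal (gradTimeConst N * η ^ (1 / 4 : ℝ)) *
            ENNReal.ofReal ((t - s) ^ (-(3 / 4) : ℝ)) * A +
          ENNReal.ofReal (gradConst N) * ENNReal.ofReal ((t - s) ^ (-(1 / 2) : ℝ)) *
            ENNReal.ofReal ε) := by
  have hF' := hF.mono hs₀ (hst.trans ht)
  have hs₀' : s₀ ∈ Icc 0 t₁ := ⟨hs₀, by linarith⟩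
  have hF₀ := hF.integrable s₀ hs₀'
  have hσ : 0 < t - s₀ := by linarith
  have hle : s₀ ≤ s₀ + η := by linarith
  have hcg := gradConst_pos (N := N)
  have hct := gradTimeConst_pos (N := N)
  have hint := hF'.integrable_uncurry hle hst
  have hc : Integrable (Function.uncurry fun (x : Space N) (_ : ℝ) =>
      heatDivergence (t - s₀) (F s₀) x) (volume.prod (volume.restrict (Ioo s₀ (s₀ + η)))) :=
    (integrable_heatDivergence hσ hF₀).comp_fst _
  have hae : ∀ᵐ x, η * heatDivergence (t - s₀) (F s₀) x - fluxIntegral F t s₀ (s₀ + η) x =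
      ∫ s in Ioo s₀ (s₀ + η),
        (heatDivergence (t - s₀) (F s₀) x - heatDivergence (t - s) (F s) x) := by
    filter_upwards [hint.prod_right_ae, hc.prod_right_ae] with x hx hx'
    simp only [Function.uncurry] at hx hx'
    rw [integral_sub hx' hx]
    simp [fluxIntegral, hη.le]
  rw [lintegral_congr_ae (hae.mono fun x hx => by simp only [hx] :
    (fun x => ‖η * heatDivergence (t - s₀) (F s₀) x - fluxIntegral F t s₀ (s₀ + η) x‖ₑ)
      =ᵐ[volume] fun x => ‖∫ s in Ioo s₀ (s₀ + η),
        (heatDivergence (t - s₀) (F s₀) x - heatDivergence (t - s) (F s) x)‖ₑ)]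
  refine (lintegral_enorm_integral_le (hc.sub hint).1).trans ?_
  refine setLIntegral_mono_ae' measurableSet_Ioo (ae_of_all _ fun s hs => ?_)
  have hts : 0 < t - s := by linarith [hs.2]
  have hs' : s ∈ Icc 0 t₁ := ⟨hs₀.trans hs.1.le, by linarith [hs.2]⟩
  have hFs := hF.integrable s hs'
  calc ∫⁻ x, ‖heatDivergence (t - s₀) (F s₀) x - heatDivergence (t - s) (F s) x‖ₑ
      = ∫⁻ x, ‖(heatDivergence (t - s₀) (F s₀) x - heatDivergence (t - s) (F s₀) x) +
          heatDivergence (t - s) (F s₀ - F s) x‖ₑ := by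
        refine lintegral_congr fun x => ?_
        rw [heatDivergence_sub hts hF₀ hFs]
        congr 1
        ring
    _ ≤ _ := lintegral_enorm_add_le
        ((integrable_heatDivergence hσ hF₀).sub (integrable_heatDivergence hts hF₀)).1
    _ ≤ _ := by
        gcongr
        · have h1 := lintegral_heatDivergence_time_le hts (by linarith [hs.1] : 0 ≤ s - s₀) hF₀
          rw [show s - s₀ + (t - s) = t - s₀ by ring] at h1
          refine h1.trans ?_
          rw [ENNReal.ofReal_mul (by
            have : 0 ≤ s - s₀ := by linarith [hs.1]
            positivity)]
          gcongr
          · linarith [hs.1]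
          · linarith [hs.2]
          · exact hF.lintegral_le s₀ hs₀'
        · refine (lintegral_heatDivergence_le hts (hF₀.sub hFs)).trans ?_
          rw [ENNReal.ofReal_mul hcg.le]
          gcongr
          exact hε s (Ioo_subset_Icc_self hs)

/-- The error of one step of the Euler scheme, propagated by the heat flow. -/
lemma IsDriftSolution.lintegral_local_error_le (h : IsDriftSolution t₁ B b ρ) {A M : ℝ≥0}
    (hF : IsFlux 0 t₁ A (fun s y => ρ s y • b s y))
    {s₀ t η ε : ℝ} (hs₀ : 0 ≤ s₀) (hη : 0 < η) (hst : s₀ + η ≤ t) (ht : t ≤ t₁)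
    (hM : ∫⁻ x, ‖ρ s₀ x‖ₑ ≤ M)
    (hε : ∀ s ∈ Icc s₀ (s₀ + η), ∫⁻ y, ‖ρ s₀ y • b s₀ y - ρ s y • b s y‖ₑ ≤ ENNReal.ofReal ε)
    {u : Space N → ℝ} (hu : Integrable u) :
    ∫⁻ x, ‖(driftHeat (t - s₀) (fun y => η • b s₀ y) u x - heatSemigroup (t - s₀) u x) -
        fluxIntegral (fun s y => ρ s y • b s y) t s₀ (s₀ + η) x‖ₑ ≤
      ENNReal.ofReal (gradConst N * (t - s₀) ^ (-(1 / 2) : ℝ)) * ENNReal.ofReal (η * B) *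
          (∫⁻ x, ‖u x - ρ s₀ x‖ₑ) +
      ENNReal.ofReal (2 * gradConst N ^ 2 / (t - s₀)) * ENNReal.ofReal (η * B) *
          ENNReal.ofReal (η * B) * M +
      ∫⁻ s in Ioo s₀ (s₀ + η),
        (ENNReal.ofReal (gradTimeConst N * η ^ (1 / 4 : ℝ)) *
            ENNReal.ofReal ((t - s) ^ (-(3 / 4) : ℝ)) * A +
          ENNReal.ofReal (gradConst N) * ENNReal.ofReal ((t - s) ^ (-(1 / 2) : ℝ)) *
            ENNReal.ofReal ε) := by
  have hs₀' : s₀ ∈ Icc 0 t₁ := ⟨hs₀, by linarith⟩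
  have hσ : 0 < t - s₀ := by linarith
  have hle : s₀ ≤ s₀ + η := by linarith
  have hρ := h.integrable s₀ hs₀'
  have hv : AEStronglyMeasurable (fun y => η • b s₀ y) volume :=
    (h.measurable_drift s₀ hs₀').const_smul η
  have hvB : ∀ y, ‖η • b s₀ y‖ ≤ η * B := by
    intro y
    rw [norm_smul, Real.norm_of_nonneg hη.le]
    gcongr
    exact h.norm_drift_le s₀ hs₀' y
  have h0 : AEStronglyMeasurable (0 : Space N → Space N) volume := aestronglyMeasurable_zero
  have hvF : Integrable fun y => ρ s₀ y • (η • b s₀ y) :=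
    hρ.smul_bdd (η * B : ℝ) hv (ae_of_all _ hvB)
  -- `d₁` is the propagated error of the scheme, `d₂` the Taylor remainder, `d₃` the error from
  -- freezing time. The Taylor estimate is applied to `ρ s₀` rather than to `u`, so that the
  -- accumulated error `u - ρ s₀` only meets the integrable singularity.
  set d₁ : Space N → ℝ := fun x => driftHeat (t - s₀) (fun y => η • b s₀ y) (u - ρ s₀) x -
    heatSemigroup (t - s₀) (u - ρ s₀) x with hd₁
  set d₂ : Space N → ℝ := fun x => driftHeat (t - s₀) (fun y => η • b s₀ y) (ρ s₀) x -
    heatSemigroup (t - s₀) (ρ s₀) x -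
      heatDivergence (t - s₀) (fun y => ρ s₀ y • (η • b s₀ y)) x with hd₂
  set d₃ : Space N → ℝ := fun x => η * heatDivergence (t - s₀) (fun y => ρ s₀ y • b s₀ y) x -
    fluxIntegral (fun s y => ρ s y • b s y) t s₀ (s₀ + η) x with hd₃
  have hm₁ : AEStronglyMeasurable d₁ volume :=
    ((integrable_driftHeat hσ hv (hu.sub hρ)).sub (integrable_heatSemigroup hσ (hu.sub hρ))).1
  have hm₂ : AEStronglyMeasurable d₂ volume :=
    (((integrable_driftHeat hσ hv hρ).sub (integrable_heatSemigroup hσ hρ)).sub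
      (integrable_heatDivergence hσ hvF)).1
  have hdec : ∀ x, (driftHeat (t - s₀) (fun y => η • b s₀ y) u x - heatSemigroup (t - s₀) u x) -
      fluxIntegral (fun s y => ρ s y • b s y) t s₀ (s₀ + η) x = d₁ x + d₂ x + d₃ x := by
    intro x
    have e1 := driftHeat_sub hσ hv hu hρ x
    have e2 := driftHeat_sub hσ h0 hu hρ x
    have e3 := heatDivergence_smul (t - s₀) η (fun y => ρ s₀ y • b s₀ y) x
    have e4 : (η • fun y => ρ s₀ y • b s₀ y) = fun y => ρ s₀ y • (η • b s₀ y) := by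
      ext1 y
      simp only [Pi.smul_apply]
      rw [smul_comm]
    simp_rw [driftHeat_zero] at e2
    rw [e4] at e3
    simp only [hd₁, hd₂, hd₃]
    rw [e1, e2, e3]
    ring
  calc _ = ∫⁻ x, ‖d₁ x + d₂ x + d₃ x‖ₑ := by simp_rw [hdec]
    _ ≤ (∫⁻ x, ‖d₁ x + d₂ x‖ₑ) + ∫⁻ x, ‖d₃ x‖ₑ := lintegral_enorm_add_le (hm₁.add hm₂)
    _ ≤ (∫⁻ x, ‖d₁ x‖ₑ) + (∫⁻ x, ‖d₂ x‖ₑ) + ∫⁻ x, ‖d₃ x‖ₑ := by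
        gcongr
        exact lintegral_enorm_add_le hm₁
    _ ≤ _ := by
        gcongr
        · exact lintegral_driftHeat_sub_le hσ hv hvB (hu.sub hρ)
        · refine (lintegral_driftHeat_taylor_le hσ hv hvB hρ).trans ?_
          gcongr
        · exact hF.lintegral_step_le hs₀ hη hst ht hε

/-- The Euler scheme with step `η`: move the mass by the drift, then apply the heat flow. -/
def eulerScheme (b : ℝ → Space N → Space N) (f : Space N → ℝ) (η : ℝ) : ℕ → Space N → ℝ
  | 0 => f
  | k + 1 => driftHeat η (fun y => η • b (k * η) y) (eulerScheme b f η k)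

lemma integrable_eulerScheme {f : Space N → ℝ} (hf : Integrable f) {η : ℝ} (hη : 0 < η) {n : ℕ}
    (hb : ∀ j < n, AEStronglyMeasurable (b (j * η)) volume) {k : ℕ} (hk : k ≤ n) :
    Integrable (eulerScheme b f η k) := by
  induction k with
  | zero => exact hf
  | succ k ih => exact integrable_driftHeat hη ((hb k hk).const_smul η) (ih (by omega))

lemma integral_eulerScheme {f : Space N → ℝ} (hf : Integrable f) {η : ℝ} (hη : 0 < η) {n : ℕ}
    (hb : ∀ j < n, AEStronglyMeasurable (b (j * η)) volume) {k : ℕ} (hk : k ≤ n) :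
    ∫ x, eulerScheme b f η k x = ∫ x, f x := by
  induction k with
  | zero => rfl
  | succ k ih =>
    rw [← ih (by omega)]
    exact integral_driftHeat hη ((hb k hk).const_smul η) (integrable_eulerScheme hf hη hb (by omega))

lemma lintegral_eulerScheme_le {f : Space N → ℝ} (hf : Integrable f) {η : ℝ} (hη : 0 < η) {n : ℕ}
    (hb : ∀ j < n, AEStronglyMeasurable (b (j * η)) volume) {k : ℕ} (hk : k ≤ n) :
    ∫⁻ x, ‖eulerScheme b f η k x‖ₑ ≤ ∫⁻ x, ‖f x‖ₑ := by
  induction k with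
  | zero => exact le_rfl
  | succ k ih =>
    exact (lintegral_driftHeat_le hη ((hb k hk).const_smul η)
      (integrable_eulerScheme hf hη hb (by omega))).trans (ih (by omega))

/-- A discrete Duhamel formula: telescope `e^{(k-j)ηΔ} u_j` from `j = 0` to `j = k`. -/
lemma eulerScheme_eq_sum {f : Space N → ℝ} (hf : Integrable f) {η : ℝ} (hη : 0 < η) {n : ℕ}
    (hb : ∀ j < n, AEStronglyMeasurable (b (j * η)) volume) {k : ℕ} (hk0 : 0 < k) (hk : k ≤ n)
    (x : Space N) :
    eulerScheme b f η k x = heatSemigroup (k * η) f x + ∑ j ∈ Finset.range k,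
      (driftHeat (k * η - j * η) (fun y => η • b (j * η) y) (eulerScheme b f η j) x -
        heatSemigroup (k * η - j * η) (eulerScheme b f η j) x) := by
  -- At `j = k` no time is left, and for `N ≥ 1` the formula for `heatSemigroup 0` gives zero
  -- instead of the identity; the last term is therefore set by hand.
  set a : ℕ → ℝ := fun j => if j = k then eulerScheme b f η k x else
    heatSemigroup (k * η - j * η) (eulerScheme b f η j) x with ha
  have h0 : a 0 = heatSemigroup (k * η) f x := by
    simp only [ha, hk0.ne, if_false]
    simp [eulerScheme]
  have hk' : a k = eulerScheme b f η k x := by simp [ha]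
  have hsum := Finset.sum_range_sub a k
  rw [hk', h0] at hsum
  rw [← sub_eq_iff_eq_add', ← hsum]
  refine Finset.sum_congr rfl fun j hj => ?_
  have hjk := Finset.mem_range.1 hj
  have hv : AEStronglyMeasurable (fun y => η • b (j * η) y) volume :=
    (hb j (by omega)).const_smul η
  have hi : Integrable (eulerScheme b f η j) := integrable_eulerScheme hf hη hb (by omega)
  have e2 : a j = heatSemigroup (k * η - j * η) (eulerScheme b f η j) x := by
    simp only [ha, hjk.ne, if_false]
  rw [e2]
  congr 1
  by_cases hj1 : j + 1 = k
  · subst hj1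
    rw [hk', eulerScheme]
    congr 1
    push_cast
    ring
  · have hlt : j + 1 < k := by omega
    have hpos : (0 : ℝ) < k * η - (j + 1 : ℕ) * η := by
      rw [← sub_mul]
      exact mul_pos (sub_pos.2 (by exact_mod_cast hlt)) hη
    simp only [ha, hj1, if_false]
    rw [eulerScheme, heatSemigroup_driftHeat hpos hη hv hi]
    congr 1
    push_cast
    ring

lemma IsFlux.fluxIntegral_eq_sum {A : ℝ≥0} {F : ℝ → Space N → Space N} {η : ℝ} (hη : 0 ≤ η)
    {k : ℕ} (hF : IsFlux 0 (k * η) A F) :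
    ∀ᵐ x, fluxIntegral F (k * η) 0 (k * η) x =
      ∑ j ∈ Finset.range k, fluxIntegral F (k * η) (j * η) (j * η + η) x := by
  have key : ∀ i ≤ k, ∀ᵐ x, fluxIntegral F (k * η) 0 (i * η) x =
      ∑ j ∈ Finset.range i, fluxIntegral F (k * η) (j * η) (j * η + η) x := by
    intro i
    induction i with
    | zero => intro _; simp [fluxIntegral]
    | succ i ih =>
      intro hi
      have hik : ((i + 1 : ℕ) : ℝ) * η ≤ k * η := by gcongr
      have h1 : (i : ℝ) * η ≤ ((i + 1 : ℕ) : ℝ) * η := by gcongr; omega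
      filter_upwards [ih (by omega), (hF.mono le_rfl hik).fluxIntegral_add
        (by positivity : (0 : ℝ) ≤ i * η) h1 hik] with x hx hx2
      rw [hx2, hx, Finset.sum_range_succ]
      congr 2
      push_cast
      ring
  exact key k le_rfl

end

/-! ### Convergence of the Euler scheme -/

/-- A term of a Riemann sum of the decreasing function `x^{-3/4}`, compared with the increment of
its primitive `4 x^{1/4}`. In this form the sums over the steps telescope. -/
lemma mul_rpow_le_sub_rpow {η x : ℝ} (hη : 0 < η) (hx : η ≤ x) :
    η * x ^ (-(3 / 4) : ℝ) ≤ 4 * (x ^ (1 / 4 : ℝ) - (x - η) ^ (1 / 4 : ℝ)) := by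
  have hx0 : 0 < x := hη.trans_le hx
  set a := x ^ (1 / 4 : ℝ) with ha
  set b := (x - η) ^ (1 / 4 : ℝ) with hb
  have ha0 : 0 < a := Real.rpow_pos_of_pos hx0 _
  have hb0 : 0 ≤ b := Real.rpow_nonneg (by linarith) _
  have hba : b ≤ a := Real.rpow_le_rpow (by linarith) (by linarith) (by norm_num)
  have ha4 : a ^ 4 = x := by
    rw [ha, ← Real.rpow_natCast, ← Real.rpow_mul hx0.le]; norm_num
  have hb4 : b ^ 4 = x - η := by
    rw [hb, ← Real.rpow_natCast, ← Real.rpow_mul (by linarith)]; norm_num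
  have ha3 : x ^ (-(3 / 4) : ℝ) = (a ^ 3)⁻¹ := by
    rw [ha, ← Real.rpow_natCast, ← Real.rpow_mul hx0.le, ← Real.rpow_neg hx0.le]; norm_num
  rw [ha3, ← div_eq_mul_inv, div_le_iff₀ (by positivity)]
  have h1 : η = (a - b) * ((a + b) * (a ^ 2 + b ^ 2)) := by linear_combination hb4 - ha4
  have h2 : (a + b) * (a ^ 2 + b ^ 2) ≤ (a + a) * (a ^ 2 + a ^ 2) := by gcongr
  calc η = (a - b) * ((a + b) * (a ^ 2 + b ^ 2)) := h1
    _ ≤ (a - b) * ((a + a) * (a ^ 2 + a ^ 2)) :=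
      mul_le_mul_of_nonneg_left h2 (by linarith)
    _ = _ := by ring

/-- Trades exponential decay for a small power: `σ^{-1/2} e^{-λσ} ≤ λ^{-1/4} σ^{-3/4}` is still
integrable and carries a factor that is small for large `λ`. -/
lemma exp_neg_le_rpow {y : ℝ} (hy : 0 < y) : Real.exp (-y) ≤ y ^ (-(1 / 4) : ℝ) := by
  rw [Real.exp_neg, Real.rpow_neg hy.le]
  refine inv_anti₀ (Real.rpow_pos_of_pos hy _) ?_
  have h1 := Real.rpow_le_rpow hy.le (by linarith [Real.add_one_le_exp y] : y ≤ Real.exp y)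
    (by norm_num : (0 : ℝ) ≤ 1 / 4)
  refine h1.trans ?_
  rw [← Real.exp_mul]
  exact Real.exp_le_exp.2 (by linarith)

lemma sum_sub_rpow {r : ℝ} (hr : 0 < r) (η : ℝ) (k : ℕ) :
    ∑ j ∈ Finset.range k, ((k * η - j * η) ^ r - (k * η - (j * η + η)) ^ r) = (k * η) ^ r := by
  have h := Finset.sum_range_sub' (fun j : ℕ => (k * η - j * η) ^ r) k
  simp only [Nat.cast_zero, zero_mul, sub_zero, sub_self] at h
  rw [Real.zero_rpow hr.ne', sub_zero] at h
  rw [← h]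
  refine Finset.sum_congr rfl fun j _ => ?_
  congr 2
  push_cast
  ring

section
variable {t₁ : ℝ} {B : ℝ≥0} {b : ℝ → Space N → Space N} {ρ : ℝ → Space N → ℝ}

/-- A discrete Gronwall argument for a singular kernel. `E` bounds the consistency errors summed
over all steps. If the earlier errors obey the bound with weight `e^{λ j η}`, their feedback through
the kernel `σ^{-1/2}` is at most `E e^{λ k η}`, by the choice of `λ` in `hl`; adding the consistency
error reproduces the bound `2E e^{λ k η}`. -/
lemma IsDriftSolution.lintegral_eulerScheme_sub_le (h : IsDriftSolution t₁ B b ρ) {A M : ℝ≥0}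
    (hF : IsFlux 0 t₁ A (fun s y => ρ s y • b s y))
    (hM : ∀ s ∈ Icc 0 t₁, ∫⁻ x, ‖ρ s x‖ₑ ≤ M) {η ε lam : ℝ} (hη : 0 < η) (hε0 : 0 ≤ ε)
    (hlam : 0 < lam) {n : ℕ} (hn : n * η = t₁)
    (hε : ∀ s ∈ Icc 0 t₁, ∀ r ∈ Icc 0 t₁, |s - r| ≤ η →
      ∫⁻ y, ‖ρ s y • b s y - ρ r y • b r y‖ₑ ≤ ENNReal.ofReal ε)
    (hl : 4 * (gradConst N * B * t₁ ^ (1 / 4 : ℝ) * lam ^ (-(1 / 4) : ℝ)) ≤ 1 / 2) {E : ℝ}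
    (hE : E = 8 * (gradConst N ^ 2 * B ^ 2 * M * η ^ (3 / 4 : ℝ) * t₁ ^ (1 / 4 : ℝ)) +
      4 * (gradTimeConst N * A * η ^ (1 / 4 : ℝ) * t₁ ^ (1 / 4 : ℝ)) +
      2 * (gradConst N * ε * t₁ ^ (1 / 2 : ℝ))) (k : ℕ) (hk : k ≤ n) :
    ∫⁻ x, ‖eulerScheme b (ρ 0) η k x - ρ (k * η) x‖ₑ ≤
      ENNReal.ofReal (2 * E * Real.exp (lam * (k * η))) := by
  have hc := gradConst_pos (N := N)
  have hC := gradTimeConst_pos (N := N)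
  have ht0 : 0 ≤ t₁ := by rw [← hn]; positivity
  have hE0 : 0 ≤ E := by rw [hE]; positivity
  induction k using Nat.strong_induction_on with
  | _ k ih =>
  rcases Nat.eq_zero_or_pos k with rfl | hk0
  · simp [eulerScheme]
  have hkt : (k : ℝ) * η ≤ t₁ := by rw [← hn]; gcongr
  have hjt : ∀ j < n, (j : ℝ) * η ∈ Icc 0 t₁ := by
    intro j hj
    refine ⟨by positivity, ?_⟩
    rw [← hn]; gcongr
  have hbm : ∀ j < n, AEStronglyMeasurable (b (j * η)) volume :=
    fun j hj => h.measurable_drift _ (hjt j hj)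
  have hρ0 := h.integrable 0 ⟨le_rfl, ht0⟩
  have hu : ∀ j ≤ n, Integrable (eulerScheme b (ρ 0) η j) := fun j hj =>
    integrable_eulerScheme hρ0 hη hbm hj
  set σ : ℕ → ℝ := fun j => k * η - j * η with hσ
  have hσ0 : ∀ j < k, η ≤ σ j := by
    intro j hj
    have : ((j + 1 : ℕ) : ℝ) * η ≤ k * η := by gcongr; exact hj
    push_cast at this
    simp only [hσ]
    linarith
  set T : ℕ → Space N → ℝ := fun j x =>
    (driftHeat (k * η - j * η) (fun y => η • b (j * η) y) (eulerScheme b (ρ 0) η j) x -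
        heatSemigroup (k * η - j * η) (eulerScheme b (ρ 0) η j) x) -
      fluxIntegral (fun s y => ρ s y • b s y) (k * η) (j * η) (j * η + η) x with hT
  have hdec : ∀ᵐ x, eulerScheme b (ρ 0) η k x - ρ (k * η) x = ∑ j ∈ Finset.range k, T j x := by
    filter_upwards [h.duhamel (k * η) ⟨by positivity, hkt⟩,
      (hF.mono le_rfl hkt).fluxIntegral_eq_sum hη.le] with x hx hx2
    rw [hx, hx2, eulerScheme_eq_sum hρ0 hη hbm hk0 hk]
    simp only [hT]
    rw [add_sub_add_left_eq_sub, ← Finset.sum_sub_distrib]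
  have hTm : ∀ j ∈ Finset.range k, AEMeasurable (fun x => ‖T j x‖ₑ) volume := by
    intro j hj
    have hjk := Finset.mem_range.1 hj
    have hpos : 0 < k * η - j * η := hη.trans_le (hσ0 j hjk)
    refine AEStronglyMeasurable.enorm ?_
    refine (((integrable_driftHeat hpos ((hbm j (by omega)).const_smul η) (hu j (by omega))).sub
      (integrable_heatSemigroup hpos (hu j (by omega)))).sub
      (IsFlux.integrable_fluxIntegral (hF.mono (hjt j (by omega)).1 ?_) (by linarith) ?_)).1
    · have := hσ0 j hjk
      simp only [hσ] at this
      linarith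
    · have := hσ0 j hjk
      simp only [hσ] at this
      linarith
  -- The local error of step `j`, with the induction hypothesis inserted and the time integrals
  -- evaluated as increments of `4 σ^{1/4}` and `2 σ^{1/2}`.
  set r : ℕ → ℝ := fun j =>
    gradConst N * σ j ^ (-(1 / 2) : ℝ) * (η * B) * (2 * E * Real.exp (lam * (j * η))) +
      2 * gradConst N ^ 2 / σ j * (η * B) * (η * B) * M +
      (4 * (gradTimeConst N * η ^ (1 / 4 : ℝ)) * A *
          ((k * η - j * η) ^ (1 / 4 : ℝ) - (k * η - (j * η + η)) ^ (1 / 4 : ℝ)) +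
        2 * gradConst N * ε *
          ((k * η - j * η) ^ (1 / 2 : ℝ) - (k * η - (j * η + η)) ^ (1 / 2 : ℝ))) with hr
  have hg : ∀ (p : ℝ), 0 < p → ∀ j < k,
      0 ≤ (k * η - j * η) ^ p - (k * η - (j * η + η)) ^ p := by
    intro p hp j hj
    have := hσ0 j hj
    simp only [hσ] at this
    exact sub_nonneg.2 (Real.rpow_le_rpow (by linarith) (by linarith) hp.le)
  have hr0 : ∀ j ∈ Finset.range k, 0 ≤ r j := by
    intro j hj
    have hjk := Finset.mem_range.1 hj
    have h1 := hη.trans_le (hσ0 j hjk)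
    have h2 := hg (1 / 4) (by norm_num) j hjk
    have h3 := hg (1 / 2) (by norm_num) j hjk
    simp only [hr]
    positivity
  have hlocal : ∀ j ∈ Finset.range k, ∫⁻ x, ‖T j x‖ₑ ≤ ENNReal.ofReal (r j) := by
    intro j hj
    have hjk := Finset.mem_range.1 hj
    have hσj := hσ0 j hjk
    have hσj' : η ≤ k * η - j * η := hσj
    have hjI := hjt j (by omega)
    have hmod : ∀ s ∈ Icc ((j : ℝ) * η) (j * η + η),
        ∫⁻ y, ‖ρ (j * η) y • b (j * η) y - ρ s y • b s y‖ₑ ≤ ENNReal.ofReal ε := by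
      intro s hs
      refine hε _ hjI s ⟨hjI.1.trans hs.1, by linarith [hs.2]⟩ ?_
      rw [abs_sub_comm, abs_of_nonneg (by linarith [hs.1])]
      linarith [hs.2]
    refine (h.lintegral_local_error_le hF hjI.1 hη (by linarith) hkt (hM _ hjI) hmod
      (hu j (by omega))).trans ?_
    have h1 := hη.trans_le hσj
    have h2 := hg (1 / 4) (by norm_num) j hjk
    have h3 := hg (1 / 2) (by norm_num) j hjk
    simp only [hr]
    rw [ENNReal.ofReal_add (by positivity) (by positivity),
      ENNReal.ofReal_add (by positivity) (by positivity)]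
    refine add_le_add (add_le_add ?_ (le_of_eq ?_)) (le_of_eq ?_)
    · rw [ENNReal.ofReal_mul (p := gradConst N * σ j ^ (-(1 / 2) : ℝ) * (η * B)) (by positivity),
        ENNReal.ofReal_mul (p := gradConst N * σ j ^ (-(1 / 2) : ℝ)) (by positivity)]
      gcongr
      exact ih j hjk (by omega)
    · rw [ENNReal.ofReal_mul (p := 2 * gradConst N ^ 2 / σ j * (η * B) * (η * B)) (by positivity),
        ENNReal.ofReal_mul (p := 2 * gradConst N ^ 2 / σ j * (η * B)) (by positivity),
        ENNReal.ofReal_mul (p := 2 * gradConst N ^ 2 / σ j) (by positivity),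
        ENNReal.ofReal_coe_nnreal]
    · have hmeas : ∀ p : ℝ, Measurable fun s : ℝ => ENNReal.ofReal ((k * η - s) ^ p) := by
        intro p
        fun_prop
      have hle : (j : ℝ) * η ≤ j * η + η := by linarith
      have hle2 : (j : ℝ) * η + η ≤ k * η := by linarith
      rw [lintegral_add_left (((hmeas _).const_mul _).mul_const _),
        lintegral_mul_const _ ((hmeas _).const_mul _),
        lintegral_const_mul _ (hmeas _), lintegral_mul_const _ ((hmeas _).const_mul _),
        lintegral_const_mul _ (hmeas _), lintegral_sub_rpow (by norm_num) hle hle2,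
        lintegral_sub_rpow (by norm_num) hle hle2]
      have e1 : (-(3 / 4) : ℝ) + 1 = 1 / 4 := by norm_num
      have e2 : (-(1 / 2) : ℝ) + 1 = 1 / 2 := by norm_num
      rw [e1, e2, ENNReal.ofReal_add (by positivity) (by positivity)]
      congr 1
      · rw [← ENNReal.ofReal_coe_nnreal (p := A), ← ENNReal.ofReal_mul (by positivity),
          ← ENNReal.ofReal_mul (by positivity)]
        congr 1
        ring
      · rw [← ENNReal.ofReal_mul (by positivity), ← ENNReal.ofReal_mul (by positivity)]
        congr 1
        ring
  calc ∫⁻ x, ‖eulerScheme b (ρ 0) η k x - ρ (k * η) x‖ₑ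
      = ∫⁻ x, ‖∑ j ∈ Finset.range k, T j x‖ₑ :=
        lintegral_congr_ae (hdec.mono fun x hx => by simp only [hx])
    _ ≤ ∫⁻ x, ∑ j ∈ Finset.range k, ‖T j x‖ₑ := lintegral_mono fun x => enorm_sum_le _ _
    _ = ∑ j ∈ Finset.range k, ∫⁻ x, ‖T j x‖ₑ := lintegral_finsetSum' _ hTm
    _ ≤ ∑ j ∈ Finset.range k, ENNReal.ofReal (r j) := Finset.sum_le_sum hlocal
    _ = ENNReal.ofReal (∑ j ∈ Finset.range k, r j) := (ENNReal.ofReal_sum_of_nonneg hr0).symm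
    _ ≤ _ := by
        refine ENNReal.ofReal_le_ofReal ?_
        set X := Real.exp (lam * (k * η)) with hX
        have hX1 : 1 ≤ X := Real.one_le_exp (by positivity)
        set g : ℕ → ℝ := fun j =>
          (k * η - j * η) ^ (1 / 4 : ℝ) - (k * η - (j * η + η)) ^ (1 / 4 : ℝ) with hgdef
        set q : ℕ → ℝ := fun j =>
          (k * η - j * η) ^ (1 / 2 : ℝ) - (k * η - (j * η + η)) ^ (1 / 2 : ℝ) with hqdef
        have hgs : ∑ j ∈ Finset.range k, g j = (k * η) ^ (1 / 4 : ℝ) :=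
          sum_sub_rpow (by norm_num) η k
        have hqs : ∑ j ∈ Finset.range k, q j = (k * η) ^ (1 / 2 : ℝ) :=
          sum_sub_rpow (by norm_num) η k
        have hterm : ∀ j ∈ Finset.range k, r j ≤
            (8 * (gradConst N * B * lam ^ (-(1 / 4) : ℝ)) * (E * X) +
              8 * (gradConst N ^ 2 * B ^ 2 * M * η ^ (3 / 4 : ℝ)) +
              4 * (gradTimeConst N * A * η ^ (1 / 4 : ℝ))) * g j +
            2 * (gradConst N * ε) * q j := by
          intro j hj
          have hjk := Finset.mem_range.1 hj
          have hσj := hσ0 j hjk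
          have hs0 := hη.trans_le hσj
          have hgj : η * σ j ^ (-(3 / 4) : ℝ) ≤ 4 * g j := by
            have := mul_rpow_le_sub_rpow hη hσj
            simp only [hσ] at this
            rwa [sub_sub] at this
          -- Relative to the weight `X` at step `k`, the weight at step `j` is `e^{-λσ}`, which
          -- gains `λ^{-1/4}`.
          have f1 : η * σ j ^ (-(1 / 2) : ℝ) * Real.exp (lam * (j * η)) ≤
              4 * g j * lam ^ (-(1 / 4) : ℝ) * X := by
            have e1 : Real.exp (lam * (j * η)) = X * Real.exp (-(lam * σ j)) := by
              rw [hX, ← Real.exp_add]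
              congr 1
              simp only [hσ]
              ring
            have e2 := exp_neg_le_rpow (mul_pos hlam hs0)
            rw [Real.mul_rpow hlam.le hs0.le] at e2
            have e3 : σ j ^ (-(3 / 4) : ℝ) = σ j ^ (-(1 / 2) : ℝ) * σ j ^ (-(1 / 4) : ℝ) := by
              rw [← Real.rpow_add hs0]; norm_num
            calc _ = η * σ j ^ (-(1 / 2) : ℝ) * X * Real.exp (-(lam * σ j)) := by rw [e1]; ring
              _ ≤ η * σ j ^ (-(1 / 2) : ℝ) * X *
                  (lam ^ (-(1 / 4) : ℝ) * σ j ^ (-(1 / 4) : ℝ)) := by gcongr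
              _ = (η * σ j ^ (-(3 / 4) : ℝ)) * lam ^ (-(1 / 4) : ℝ) * X := by rw [e3]; ring
              _ ≤ _ := by gcongr
          -- Since `η ≤ σ`, the quotient `η/σ` is at most its power `3/4`; the singularity becomes
          -- integrable and a positive power of `η` is left over.
          have f2 : η * η / σ j ≤ η ^ (3 / 4 : ℝ) * (4 * g j) := by
            have e1 : (η / σ j) ≤ η ^ (3 / 4 : ℝ) * σ j ^ (-(3 / 4) : ℝ) := by
              rw [Real.rpow_neg hs0.le, ← div_eq_mul_inv, ← Real.div_rpow hη.le hs0.le]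
              exact Real.self_le_rpow_of_le_one (by positivity) ((div_le_one hs0).2 hσj)
                (by norm_num)
            calc η * η / σ j = η * (η / σ j) := by ring
              _ ≤ η * (η ^ (3 / 4 : ℝ) * σ j ^ (-(3 / 4) : ℝ)) := by gcongr
              _ = η ^ (3 / 4 : ℝ) * (η * σ j ^ (-(3 / 4) : ℝ)) := by ring
              _ ≤ _ := by gcongr
          calc r j = 2 * (gradConst N * B * E) *
                (η * σ j ^ (-(1 / 2) : ℝ) * Real.exp (lam * (j * η))) +
                2 * (gradConst N ^ 2 * B ^ 2 * M) * (η * η / σ j) +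
                4 * (gradTimeConst N * A * η ^ (1 / 4 : ℝ)) * g j +
                2 * (gradConst N * ε) * q j := by
                simp only [hr, hgdef, hqdef]
                ring
            _ ≤ 2 * (gradConst N * B * E) * (4 * g j * lam ^ (-(1 / 4) : ℝ) * X) +
                2 * (gradConst N ^ 2 * B ^ 2 * M) * (η ^ (3 / 4 : ℝ) * (4 * g j)) +
                4 * (gradTimeConst N * A * η ^ (1 / 4 : ℝ)) * g j +
                2 * (gradConst N * ε) * q j := by gcongr
            _ = _ := by ring
        refine (Finset.sum_le_sum hterm).trans ?_
        rw [Finset.sum_add_distrib, ← Finset.mul_sum, ← Finset.mul_sum, hgs, hqs]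
        have m1 : ((k : ℝ) * η) ^ (1 / 4 : ℝ) ≤ t₁ ^ (1 / 4 : ℝ) := by gcongr
        have m2 : ((k : ℝ) * η) ^ (1 / 2 : ℝ) ≤ t₁ ^ (1 / 2 : ℝ) := by gcongr
        calc _ ≤ (8 * (gradConst N * B * lam ^ (-(1 / 4) : ℝ)) * (E * X) +
              8 * (gradConst N ^ 2 * B ^ 2 * M * η ^ (3 / 4 : ℝ)) +
              4 * (gradTimeConst N * A * η ^ (1 / 4 : ℝ))) * t₁ ^ (1 / 4 : ℝ) +
            2 * (gradConst N * ε) * t₁ ^ (1 / 2 : ℝ) := by gcongr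
          _ = 2 * (4 * (gradConst N * B * t₁ ^ (1 / 4 : ℝ) * lam ^ (-(1 / 4) : ℝ))) * (E * X) + E := by
              rw [hE]; ring
          _ ≤ 2 * (1 / 2) * (E * X) + E * X := by
              gcongr
              exact le_mul_of_one_le_right hE0 hX1
          _ = _ := by ring

/-- The Euler scheme converges in `L¹`. -/
lemma IsDriftSolution.tendsto_eulerScheme (h : IsDriftSolution t₁ B b ρ) (ht : 0 < t₁) :
    Tendsto (fun n : ℕ => ∫⁻ x, ‖eulerScheme b (ρ 0) (t₁ / (n + 1)) (n + 1) x - ρ t₁ x‖ₑ)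
      atTop (𝓝 0) := by
  obtain ⟨A, hF⟩ := h.exists_isFlux
  obtain ⟨M, hM⟩ := h.bounded
  have hc := gradConst_pos (N := N)
  set D := 8 * (gradConst N * B * t₁ ^ (1 / 4 : ℝ)) with hD
  have hD0 : 0 ≤ D := by positivity
  -- The fourth power makes `lam^{-1/4}` equal to `1 / (D + 1)`, so the smallness condition becomes
  -- `D / (D + 1) ≤ 1`.
  set lam := (D + 1) ^ 4 with hlam
  have hlam0 : 0 < lam := by positivity
  have hl : 4 * (gradConst N * B * t₁ ^ (1 / 4 : ℝ) * lam ^ (-(1 / 4) : ℝ)) ≤ 1 / 2 := by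
    have : lam ^ (-(1 / 4) : ℝ) = (D + 1)⁻¹ := by
      rw [hlam, ← Real.rpow_natCast, ← Real.rpow_mul (by positivity), ← Real.rpow_neg_one]
      norm_num
    rw [this]
    have h2 : D * (D + 1)⁻¹ ≤ 1 := by
      rw [← div_eq_mul_inv]
      exact (div_le_one (by positivity)).2 (by linarith)
    calc _ = D * (D + 1)⁻¹ / 2 := by rw [hD]; ring
      _ ≤ _ := by linarith
  set K := 2 * Real.exp (lam * t₁) with hK
  have hK0 : 0 < K := by positivity
  rw [ENNReal.tendsto_nhds_zero]
  intro e he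
  rcases eq_or_ne e ⊤ with rfl | het
  · simp
  have he' : 0 < e.toReal := ENNReal.toReal_pos he.ne' het
  -- Chosen so that the modulus of continuity contributes exactly half of the tolerance; the powers
  -- of the step size take the other half.
  set ε := e.toReal / 2 / (K * (2 * (gradConst N * t₁ ^ (1 / 2 : ℝ)))) with hε
  have hε0 : 0 < ε := by positivity
  have hεK : K * (2 * (gradConst N * ε * t₁ ^ (1 / 2 : ℝ))) = e.toReal / 2 := by
    have : 0 < t₁ ^ (1 / 2 : ℝ) := by positivity
    rw [hε]
    field_simp
  obtain ⟨δ, hδ, hmod⟩ := hF.exists_modulus hε0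
  have hη : Tendsto (fun n : ℕ => t₁ / ((n : ℝ) + 1)) atTop (𝓝 0) :=
    by simpa [Function.comp_def] using
      (tendsto_const_div_atTop_nhds_zero_nat t₁).comp (tendsto_add_atTop_nat 1)
  have hsmall : Tendsto (fun n : ℕ => K *
      (8 * (gradConst N ^ 2 * B ^ 2 * M * (t₁ / ((n : ℝ) + 1)) ^ (3 / 4 : ℝ) * t₁ ^ (1 / 4 : ℝ)) +
      4 * (gradTimeConst N * A * (t₁ / ((n : ℝ) + 1)) ^ (1 / 4 : ℝ) * t₁ ^ (1 / 4 : ℝ))))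
      atTop (𝓝 0) := by
    have h1 : ∀ p : ℝ, 0 < p → Tendsto (fun n : ℕ => (t₁ / ((n : ℝ) + 1)) ^ p) atTop (𝓝 0) := by
      intro p hp
      have := hη.rpow_const (p := p) (Or.inr hp.le)
      rwa [Real.zero_rpow hp.ne'] at this
    have := (((h1 (3 / 4) (by norm_num)).const_mul (gradConst N ^ 2 * B ^ 2 * M)).mul_const
      (t₁ ^ (1 / 4 : ℝ))).const_mul 8
    have h3 := (((h1 (1 / 4) (by norm_num)).const_mul (gradTimeConst N * A)).mul_const
      (t₁ ^ (1 / 4 : ℝ))).const_mul 4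
    simpa using (this.add h3).const_mul K
  filter_upwards [hη.eventually (gt_mem_nhds hδ),
    hsmall.eventually (gt_mem_nhds (half_pos he'))] with n hn1 hn2
  have hη0 : 0 < t₁ / ((n : ℝ) + 1) := by positivity
  have hnt : ((n + 1 : ℕ) : ℝ) * (t₁ / ((n : ℝ) + 1)) = t₁ := by
    push_cast
    field_simp
  have := h.lintegral_eulerScheme_sub_le hF hM hη0 hε0.le hlam0 hnt
    (fun s hs r hr hsr => hmod s hs r hr (hsr.trans_lt hn1)) hl rfl (n + 1) le_rfl
  rw [hnt] at this
  refine this.trans (ENNReal.ofReal_le_of_le_toReal ?_)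
  calc _ = K *
      (8 * (gradConst N ^ 2 * B ^ 2 * M * (t₁ / ((n : ℝ) + 1)) ^ (3 / 4 : ℝ) * t₁ ^ (1 / 4 : ℝ)) +
      4 * (gradTimeConst N * A * (t₁ / ((n : ℝ) + 1)) ^ (1 / 4 : ℝ) * t₁ ^ (1 / 4 : ℝ))) +
      K * (2 * (gradConst N * ε * t₁ ^ (1 / 2 : ℝ))) := by rw [hK]; ring
    _ ≤ _ := by rw [hεK]; linarith

end

/-! ### Consequences of the convergence of the Euler scheme -/

/-- Exponentials are eigenfunctions of the heat flow: completing the square moves the centre of the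
Gaussian by `2h w` and leaves the factor `e^{|w|² h}`. -/
lemma lintegral_heatKernel_mul_exp {h : ℝ} (hh : 0 < h) (w m x : Space N) :
    ∫⁻ z, ‖heatKernel h (z - m)‖ₑ * ENNReal.ofReal (Real.exp (inner ℝ w (z - x))) =
      ENNReal.ofReal (Real.exp (‖w‖ ^ 2 * h + inner ℝ w (m - x))) := by
  have key : ∀ z, ‖heatKernel h (z - m)‖ₑ * ENNReal.ofReal (Real.exp (inner ℝ w (z - x))) =
      ENNReal.ofReal (Real.exp (‖w‖ ^ 2 * h + inner ℝ w (m - x))) *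
        ‖heatKernel h (z - (m + (2 * h) • w))‖ₑ := by
    intro z
    rw [enorm_heatKernel hh, enorm_heatKernel hh,
      ← ENNReal.ofReal_mul (heatKernel_pos hh _).le, ← ENNReal.ofReal_mul (Real.exp_pos _).le]
    congr 1
    rw [heatKernel_eq, heatKernel_eq, mul_assoc, ← Real.exp_add, mul_left_comm, ← Real.exp_add]
    congr 2
    have e1 : z - (m + (2 * h) • w) = (z - m) - (2 * h) • w := by abel
    have e2 : inner ℝ w (z - x) = inner ℝ w (z - m) + inner ℝ w (m - x) := by
      rw [← inner_add_right]; congr 1; abel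
    rw [e1, e2, norm_sub_sq_real (z - m) ((2 * h) • w), norm_smul, inner_smul_right, real_inner_comm w,
      Real.norm_of_nonneg (by positivity)]
    field_simp
    ring
  simp_rw [key]
  rw [lintegral_const_mul' _ _ ENNReal.ofReal_ne_top,
    lintegral_sub_right_eq_self (fun z => ‖heatKernel h z‖ₑ), lintegral_enorm_heatKernel hh, mul_one]

/-- The heat kernel lies below all exponentials of slope at most `β` simultaneously, by `(‖z‖ -
2τβ)² ≥ 0`. It is thus an admissible starting weight for the dual scheme. -/
lemma heatKernel_le_exp {τ β : ℝ} (hτ : 0 < τ) {w : Space N} (hw : ‖w‖ ≤ β) (z : Space N) :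
    heatKernel τ z ≤ heatPeak N τ * Real.exp (β ^ 2 * τ) * Real.exp (inner ℝ w z) := by
  have hP := heatPeak_pos (N := N) hτ
  rw [heatKernel_eq, mul_assoc, ← Real.exp_add]
  gcongr
  have h1 : -(‖w‖ * ‖z‖) ≤ inner ℝ w z := (abs_le.1 (abs_real_inner_le_norm w z)).1
  have h2 : ‖w‖ * ‖z‖ ≤ β * ‖z‖ := by gcongr
  have h3 : β * ‖z‖ ≤ 1 / (4 * τ) * ‖z‖ ^ 2 + β ^ 2 * τ := by
    have : 1 / (4 * τ) * ‖z‖ ^ 2 + β ^ 2 * τ - β * ‖z‖ = (‖z‖ - 2 * τ * β) ^ 2 / (4 * τ) := by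
      field_simp
      ring
    have h4 : 0 ≤ (‖z‖ - 2 * τ * β) ^ 2 / (4 * τ) := by positivity
    linarith
  linarith

lemma mul_div_mem_Icc {t₁ : ℝ} (ht : 0 < t₁) (n : ℕ) :
    ∀ j < n + 1, ((j : ℝ) * (t₁ / (n + 1))) ∈ Icc 0 t₁ := by
  intro j hj
  refine ⟨by positivity, ?_⟩
  have : (j : ℝ) ≤ n + 1 := by exact_mod_cast hj.le
  calc (j : ℝ) * (t₁ / (n + 1)) ≤ (n + 1) * (t₁ / (n + 1)) := by gcongr
    _ = t₁ := by field_simp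

section
variable {t₁ : ℝ} {B : ℝ≥0} {b : ℝ → Space N → Space N} {ρ : ℝ → Space N → ℝ}

/-- An exponential weight is propagated by the dual of the Euler scheme in all directions at
once. -/
lemma lintegral_mul_eulerScheme_le {f : Space N → ℝ} (hf : Integrable f) {η β : ℝ} (hη : 0 < η)
    (hβ : 0 ≤ β) {n : ℕ} (hb : ∀ j < n, AEStronglyMeasurable (b (j * η)) volume)
    (hB : ∀ j < n, ∀ y, ‖b (j * η) y‖ ≤ B) (x : Space N) {k : ℕ} (hk : k ≤ n) (a : ℝ)
    {ψ : Space N → ℝ≥0∞} (hψm : AEMeasurable ψ volume)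
    (hψ : ∀ w : Space N, ‖w‖ ≤ β → ∀ y, ψ y ≤ ENNReal.ofReal (Real.exp (a + inner ℝ w (y - x)))) :
    ∫⁻ y, ψ y * ‖eulerScheme b f η k y‖ₑ ≤
      ∫⁻ y, ENNReal.ofReal (Real.exp (a + (β ^ 2 + β * B) * (k * η) - β * ‖x - y‖)) * ‖f y‖ₑ := by
  induction k generalizing a ψ with
  | zero =>
    refine lintegral_mono fun y => ?_
    simp only [eulerScheme]
    gcongr
    rcases eq_or_ne y x with rfl | hyx
    · simpa using hψ 0 (by simpa using hβ) y
    · have hn : 0 < ‖y - x‖ := norm_pos_iff.2 (sub_ne_zero.2 hyx)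
      -- The bound is available for every slope of length at most `β`. The best one for this `y`
      -- points from `y` to `x`, and produces `e^{-β‖x - y‖}`, which is not itself an eigenfunction.
      have := hψ (-(β / ‖y - x‖) • (y - x)) (by
        rw [norm_smul, norm_neg, Real.norm_of_nonneg (by positivity), div_mul_cancel₀ _ hn.ne']) y
      refine this.trans (le_of_eq ?_)
      congr 2
      rw [real_inner_smul_left, real_inner_self_eq_norm_sq, norm_sub_rev x y]
      field_simp
      simp
      ring
  | succ k ih =>
    have hbk := hb k hk
    have hv : AEStronglyMeasurable (fun y => η • b (k * η) y) volume := hbk.const_smul η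
    set v : Space N → Space N := fun y => η • b (k * η) y with hvdef
    set u := eulerScheme b f η k with hu
    have hui : Integrable u := integrable_eulerScheme hf hη hb (by omega)
    have hKm : AEMeasurable (fun p : Space N × Space N => ‖heatKernel η (p.1 - p.2 + v p.2)‖ₑ)
        (volume.prod volume) :=
      (aestronglyMeasurable_displaced (continuous_heatKernel η) hv).enorm
    have hψm1 : AEMeasurable (fun p : Space N × Space N => ψ p.1) (volume.prod volume) :=
      hψm.comp_quasiMeasurePreserving Measure.quasiMeasurePreserving_fst
    -- The dual of one step applied to the weight. It satisfies the same family of bounds with `a`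
    -- raised by `(β² + βB) η`: the heat flow contributes `β² η` and the displacement, of length at
    -- most `ηB`, contributes `βB η`.
    set ψ' : Space N → ℝ≥0∞ := fun y => ∫⁻ z, ψ z * ‖heatKernel η (z - y + v y)‖ₑ with hψ'
    have hψ'm : AEMeasurable ψ' volume := (hψm1.mul hKm).prod_swap.lintegral_prod_right'
    have hψ'b : ∀ w : Space N, ‖w‖ ≤ β → ∀ y, ψ' y ≤
        ENNReal.ofReal (Real.exp ((a + (β ^ 2 + β * B) * η) + inner ℝ w (y - x))) := by
      intro w hw y
      calc ψ' y ≤ ∫⁻ z, ENNReal.ofReal (Real.exp a) * (‖heatKernel η (z - (y - v y))‖ₑ *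
            ENNReal.ofReal (Real.exp (inner ℝ w (z - x)))) := by
            refine lintegral_mono fun z => ?_
            simp only
            rw [sub_add]
            calc _ ≤ ENNReal.ofReal (Real.exp (a + inner ℝ w (z - x))) *
                  ‖heatKernel η (z - (y - v y))‖ₑ := by gcongr; exact hψ w hw z
              _ = _ := by
                rw [Real.exp_add, ENNReal.ofReal_mul (Real.exp_pos _).le]
                ring
        _ = ENNReal.ofReal (Real.exp (a + (‖w‖ ^ 2 * η + inner ℝ w (y - v y - x)))) := by
            rw [lintegral_const_mul' _ _ ENNReal.ofReal_ne_top, lintegral_heatKernel_mul_exp hη,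
              ← ENNReal.ofReal_mul (Real.exp_pos _).le, ← Real.exp_add]
        _ ≤ _ := by
            refine ENNReal.ofReal_le_ofReal (Real.exp_le_exp.2 ?_)
            have e1 : inner ℝ w (y - v y - x) = inner ℝ w (y - x) - inner ℝ w (v y) := by
              rw [← inner_sub_right]; congr 1; abel
            have e2 : -(‖w‖ * ‖v y‖) ≤ inner ℝ w (v y) :=
              (abs_le.1 (abs_real_inner_le_norm w (v y))).1
            have e3 : ‖w‖ * ‖v y‖ ≤ β * (η * B) := by
              have : ‖v y‖ ≤ η * B := by
                rw [hvdef, norm_smul, Real.norm_of_nonneg hη.le]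
                gcongr
                exact hB k hk y
              gcongr
            have e4 : ‖w‖ ^ 2 * η ≤ β ^ 2 * η := by gcongr
            rw [e1]
            linarith
    calc ∫⁻ z, ψ z * ‖eulerScheme b f η (k + 1) z‖ₑ
        ≤ ∫⁻ z, ∫⁻ y, ψ z * ‖heatKernel η (z - y + v y)‖ₑ * ‖u y‖ₑ := by
          refine lintegral_mono fun z => ?_
          simp_rw [mul_assoc, ← enorm_mul]
          have hm : AEMeasurable (fun y => ‖heatKernel η (z - y + v y) * u y‖ₑ) volume :=
            (integrable_driftHeat_integrand hη hv hui z).1.enorm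
          rw [lintegral_const_mul'' _ hm]
          gcongr
          exact enorm_integral_le_lintegral_enorm _
      _ = ∫⁻ y, ∫⁻ z, ψ z * ‖heatKernel η (z - y + v y)‖ₑ * ‖u y‖ₑ :=
          lintegral_lintegral_swap ((hψm1.mul hKm).mul hui.1.comp_snd.enorm)
      _ = ∫⁻ y, ψ' y * ‖u y‖ₑ := by
          refine lintegral_congr fun y => ?_
          rw [lintegral_mul_const' _ _ enorm_ne_top]
      _ ≤ _ := ih (by omega) _ hψ'm hψ'b
      _ = _ := by
          refine lintegral_congr fun y => ?_
          congr 4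
          push_cast
          ring

namespace IsDriftSolution

/-- Every step of the scheme is a contraction in `L¹` irrespective of the size of the drift, and the
bound passes to the limit. -/
lemma lintegral_le_of_pos (h : IsDriftSolution t₁ B b ρ) (ht : 0 < t₁) :
    ∫⁻ x, ‖ρ t₁ x‖ₑ ≤ ∫⁻ x, ‖ρ 0 x‖ₑ := by
  have h0 := h.integrable 0 ⟨le_rfl, ht.le⟩
  have h1 := h.integrable t₁ ⟨ht.le, le_rfl⟩
  have hlim := (h.tendsto_eulerScheme ht).const_add (∫⁻ x, ‖ρ 0 x‖ₑ)
  rw [add_zero] at hlim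
  refine ge_of_tendsto' hlim fun n => ?_
  have hη : 0 < t₁ / ((n : ℝ) + 1) := by positivity
  have hb : ∀ j < n + 1, AEStronglyMeasurable (b (j * (t₁ / (n + 1)))) volume :=
    fun j hj => h.measurable_drift _ (mul_div_mem_Icc ht n j hj)
  have hu := integrable_eulerScheme h0 hη hb le_rfl
  calc ∫⁻ x, ‖ρ t₁ x‖ₑ = ∫⁻ x, ‖eulerScheme b (ρ 0) (t₁ / (n + 1)) (n + 1) x +
        -(eulerScheme b (ρ 0) (t₁ / (n + 1)) (n + 1) x - ρ t₁ x)‖ₑ := by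
        refine lintegral_congr fun x => ?_
        congr 1
        ring
    _ ≤ _ := lintegral_enorm_add_le hu.1
    _ ≤ _ := by
        simp_rw [enorm_neg]
        exact add_le_add (lintegral_eulerScheme_le h0 hη hb le_rfl) le_rfl

lemma integral_eq_of_pos (h : IsDriftSolution t₁ B b ρ) (ht : 0 < t₁) :
    ∫ x, ρ t₁ x = ∫ x, ρ 0 x := by
  have h0 := h.integrable 0 ⟨le_rfl, ht.le⟩
  have h1 := h.integrable t₁ ⟨ht.le, le_rfl⟩
  have hlim := h.tendsto_eulerScheme ht
  have hle : ∀ n : ℕ, ‖(∫ x, ρ 0 x) - ∫ x, ρ t₁ x‖ₑ ≤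
      ∫⁻ x, ‖eulerScheme b (ρ 0) (t₁ / (n + 1)) (n + 1) x - ρ t₁ x‖ₑ := by
    intro n
    have hη : 0 < t₁ / ((n : ℝ) + 1) := by positivity
    have hb : ∀ j < n + 1, AEStronglyMeasurable (b (j * (t₁ / (n + 1)))) volume :=
      fun j hj => h.measurable_drift _ (mul_div_mem_Icc ht n j hj)
    rw [← integral_eulerScheme h0 hη hb le_rfl,
      ← integral_sub (integrable_eulerScheme h0 hη hb le_rfl) h1]
    exact enorm_integral_le_lintegral_enorm _
  have h2 : ‖(∫ x, ρ 0 x) - ∫ x, ρ t₁ x‖ₑ ≤ 0 := ge_of_tendsto' hlim hle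
  have h3 : (∫ x, ρ 0 x) - ∫ x, ρ t₁ x = 0 := by simpa using h2
  exact (sub_eq_zero.1 h3).symm

lemma lintegral_le (h : IsDriftSolution t₁ B b ρ) {t : ℝ} (ht : t ∈ Icc 0 t₁) :
    ∫⁻ x, ‖ρ t x‖ₑ ≤ ∫⁻ x, ‖ρ 0 x‖ₑ := by
  rcases ht.1.eq_or_lt with rfl | h0
  · exact le_rfl
  · exact (h.mono ht.2).lintegral_le_of_pos h0

lemma integral_eq (h : IsDriftSolution t₁ B b ρ) {t : ℝ} (ht : t ∈ Icc 0 t₁) :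
    ∫ x, ρ t x = ∫ x, ρ 0 x := by
  rcases ht.1.eq_or_lt with rfl | h0
  · rfl
  · exact (h.mono ht.2).integral_eq_of_pos h0

/-- A nonnegative initial datum keeps its `L¹` norm. -/
lemma lintegral_eq (h : IsDriftSolution t₁ B b ρ) (h0 : ∀ᵐ x, 0 ≤ ρ 0 x) {t : ℝ}
    (ht : t ∈ Icc 0 t₁) : ∫⁻ x, ‖ρ t x‖ₑ = ∫⁻ x, ‖ρ 0 x‖ₑ := by
  refine le_antisymm (h.lintegral_le ht) ?_
  have hi := h.integrable 0 ⟨le_rfl, ht.1.trans ht.2⟩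
  -- Positivity at later times is not needed: `‖ρ₀‖₁ = ∫ ρ₀ = ∫ ρ_t ≤ ‖ρ_t‖₁`.
  calc ∫⁻ x, ‖ρ 0 x‖ₑ = ENNReal.ofReal (∫ x, ρ 0 x) := by
        rw [ofReal_integral_eq_lintegral_ofReal hi h0]
        refine lintegral_congr_ae ?_
        filter_upwards [h0] with x hx
        exact Real.enorm_of_nonneg hx
    _ = ‖∫ x, ρ t x‖ₑ := by
        rw [h.integral_eq ht, Real.enorm_of_nonneg (integral_nonneg_of_ae h0)]
    _ ≤ _ := enorm_integral_le_lintegral_enorm _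

/-- A Gaussian average of a solution is dominated by a convolution of its initial datum with an
exponential. -/
lemma enorm_heatSemigroup_le (h : IsDriftSolution t₁ B b ρ) (ht : 0 < t₁) {τ β : ℝ} (hτ : 0 < τ)
    (hβ : 0 ≤ β) (x : Space N) :
    ‖heatSemigroup τ (ρ t₁) x‖ₑ ≤ ∫⁻ y, ENNReal.ofReal (heatPeak N τ *
      Real.exp (β ^ 2 * τ + (β ^ 2 + β * B) * t₁ - β * ‖x - y‖)) * ‖ρ 0 y‖ₑ := by
  have h0 := h.integrable 0 ⟨le_rfl, ht.le⟩
  have h1 := h.integrable t₁ ⟨ht.le, le_rfl⟩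
  have hP := heatPeak_pos (N := N) hτ
  set R := ∫⁻ y, ENNReal.ofReal (heatPeak N τ *
      Real.exp (β ^ 2 * τ + (β ^ 2 + β * B) * t₁ - β * ‖x - y‖)) * ‖ρ 0 y‖ₑ with hR
  have hlim : Tendsto (fun n : ℕ => R + ENNReal.ofReal (heatPeak N τ) *
      ∫⁻ x, ‖eulerScheme b (ρ 0) (t₁ / (n + 1)) (n + 1) x - ρ t₁ x‖ₑ) atTop (𝓝 R) := by
    have := (ENNReal.Tendsto.const_mul (a := ENNReal.ofReal (heatPeak N τ))
      (h.tendsto_eulerScheme ht) (Or.inr ENNReal.ofReal_ne_top)).const_add R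
    simpa using this
  refine ge_of_tendsto' hlim fun n => ?_
  have hη : 0 < t₁ / ((n : ℝ) + 1) := by positivity
  have hmem := mul_div_mem_Icc ht n
  have hb : ∀ j < n + 1, AEStronglyMeasurable (b (j * (t₁ / (n + 1)))) volume :=
    fun j hj => h.measurable_drift _ (hmem j hj)
  have hnt : ((n + 1 : ℕ) : ℝ) * (t₁ / ((n : ℝ) + 1)) = t₁ := by
    push_cast
    field_simp
  set u := eulerScheme b (ρ 0) (t₁ / (n + 1)) (n + 1) with hu
  have hui : Integrable u := integrable_eulerScheme h0 hη hb le_rfl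
  -- The scheme replaces `ρ t₁`; the Gaussian average turns the `L¹` error into a pointwise one, at
  -- the cost of the factor `heatPeak N τ`.
  have hsplit : heatSemigroup τ (ρ t₁) x =
      heatSemigroup τ u x - heatSemigroup τ (u - ρ t₁) x := by
    have := driftHeat_sub hτ (aestronglyMeasurable_zero : AEStronglyMeasurable
      (0 : Space N → Space N) volume) hui h1 x
    simp_rw [driftHeat_zero] at this
    rw [this]
    ring
  rw [hsplit]
  refine enorm_sub_le.trans (add_le_add ?_ ?_)
  · calc ‖heatSemigroup τ u x‖ₑ ≤ ∫⁻ y, ‖heatKernel τ (x - y)‖ₑ * ‖u y‖ₑ := by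
          refine (enorm_integral_le_lintegral_enorm _).trans (le_of_eq ?_)
          simp_rw [enorm_mul]
      -- The starting weight is `heatKernel τ (x - ·)`; its prefactor enters the exponent as a
      -- logarithm so as to be of the form required by the dual estimate.
      _ ≤ ∫⁻ y, ENNReal.ofReal (Real.exp ((Real.log (heatPeak N τ) + β ^ 2 * τ) +
            (β ^ 2 + β * B) * (((n + 1 : ℕ) : ℝ) * (t₁ / (n + 1))) - β * ‖x - y‖)) *
              ‖ρ 0 y‖ₑ := by
          refine lintegral_mul_eulerScheme_le h0 hη hβ hb
            (fun j hj => h.norm_drift_le _ (hmem j hj)) x le_rfl _ ?_ ?_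
          · have := continuous_heatKernel (N := N) τ
            exact (by fun_prop : Continuous fun y : Space N =>
              ‖heatKernel τ (x - y)‖ₑ).measurable.aemeasurable
          · intro w hw y
            rw [enorm_heatKernel hτ, Real.exp_add, Real.exp_add, Real.exp_log hP]
            refine ENNReal.ofReal_le_ofReal ?_
            have := heatKernel_le_exp hτ hw (y - x)
            rwa [← heatKernel_neg, neg_sub] at this
      _ = R := by
          refine lintegral_congr fun y => ?_
          rw [hnt, add_assoc, add_sub_assoc, Real.exp_add, Real.exp_log hP]
  · refine (enorm_integral_le_lintegral_enorm _).trans ?_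
    rw [← lintegral_const_mul' _ _ ENNReal.ofReal_ne_top]
    refine lintegral_mono fun y => ?_
    rw [enorm_mul, enorm_heatKernel hτ]
    gcongr
    · exact heatKernel_le hτ _
    · rfl

end IsDriftSolution
end

/-! ### `L^p` bounds -/

/-- Young's inequality for an integrable positive kernel. -/
lemma eLpNorm_lconvolution_le {E : Type*} [NormedAddCommGroup E] {p : ℝ≥0∞} (hp : 1 ≤ p)
    {κ : Space N → ℝ} (hκ : Measurable κ) (hκ0 : ∀ z, 0 < κ z) {f : Space N → E}
    (hf : AEStronglyMeasurable f volume) :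
    eLpNorm (fun x => ∫⁻ y, ENNReal.ofReal (κ (x - y)) * ‖f y‖ₑ) p volume ≤
      (∫⁻ z, ENNReal.ofReal (κ z)) * eLpNorm f p volume := by
  have h1 : ∀ x, ∫⁻ y, ENNReal.ofReal (κ (x - y)) * ‖f y‖ₑ =
      ∫⁻ z, ENNReal.ofReal (κ z) * ‖f (x - z)‖ₑ := by
    intro x
    have := lintegral_sub_left_eq_self (μ := volume)
      (fun z => ENNReal.ofReal (κ z) * ‖f (x - z)‖ₑ) x
    rw [← this]
    simp
  simp_rw [h1]
  have hfm : AEMeasurable (fun q : Space N × Space N => ‖f (q.2 - q.1)‖ₑ)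
      (volume.prod volume) := by
    have h2 : Measure.QuasiMeasurePreserving (fun q : Space N × Space N => q.2 - q.1)
        (volume.prod volume) volume :=
      (quasiMeasurePreserving_sub volume volume).comp
        Measure.measurePreserving_swap.quasiMeasurePreserving
    exact hf.enorm.comp_quasiMeasurePreserving h2
  refine eLpNorm_lintegral_le hp
    (f := fun z x => ENNReal.ofReal (κ z) * ‖f (x - z)‖ₑ) ?_ hκ.ennreal_ofReal.aemeasurable
    (ae_of_all _ fun z => by simpa using hκ0 z) (ae_of_all _ fun z => ENNReal.ofReal_ne_top)
    (ae_of_all _ fun z => ?_)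
  · exact (hκ.ennreal_ofReal.comp measurable_fst).aemeasurable.mul hfm
  · have h3 : eLpNorm (fun x => f (x - z)) p volume = eLpNorm f p volume :=
      eLpNorm_comp_measurePreserving hf (measurePreserving_sub_right volume z)
    have h4 : (fun x => ENNReal.ofReal (κ z) * ‖f (x - z)‖ₑ) =
        fun x => ‖κ z • ‖f (x - z)‖‖ₑ := by
      ext x
      rw [enorm_smul, enorm_norm, Real.enorm_of_nonneg (hκ0 z).le]
    rw [h4]
    have h5 := eLpNorm_enorm (fun x => κ z • ‖f (x - z)‖) (p := p) (μ := volume)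
    rw [h5]
    have h6 := eLpNorm_const_smul (κ z) (fun x => ‖f (x - z)‖) p volume
    calc _ = ‖κ z‖ₑ * eLpNorm (fun x => ‖f (x - z)‖) p volume := h6
      _ ≤ _ := by rw [eLpNorm_norm, h3, Real.enorm_of_nonneg (hκ0 z).le]

lemma measurable_heatKernel (t : ℝ) : Measurable (heatKernel (N := N) t) :=
  (continuous_heatKernel t).measurable

lemma eLpNorm_heatSemigroup_le {p : ℝ≥0∞} (hp : 1 ≤ p) {t : ℝ} (ht : 0 < t) {f : Space N → ℝ}
    (hf : AEStronglyMeasurable f volume) :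
    eLpNorm (heatSemigroup t f) p volume ≤ eLpNorm f p volume := by
  have h := eLpNorm_lconvolution_le hp (measurable_heatKernel t) (heatKernel_pos ht) hf
  simp_rw [← enorm_heatKernel ht] at h
  rw [lintegral_enorm_heatKernel ht, one_mul] at h
  refine (eLpNorm_mono_enorm fun x => ?_).trans h
  rw [enorm_eq_self]
  refine (enorm_integral_le_lintegral_enorm _).trans (le_of_eq ?_)
  simp_rw [enorm_mul]

lemma eLpNorm_heatDivergence_le {p : ℝ≥0∞} (hp : 1 ≤ p) {t : ℝ} (ht : 0 < t)
    {F : Space N → Space N} (hF : AEStronglyMeasurable F volume) :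
    eLpNorm (heatDivergence t F) p volume ≤
      ENNReal.ofReal (gradConst N * t ^ (-(1 / 2) : ℝ)) * eLpNorm F p volume := by
  have hc := gradConst_pos (N := N)
  have ht2 : 0 < 2 * t := by positivity
  have h := eLpNorm_lconvolution_le hp
    ((measurable_heatKernel (N := N) (2 * t)).const_mul (gradConst N * t ^ (-(1 / 2) : ℝ)))
    (fun z => mul_pos (by positivity) (heatKernel_pos ht2 z)) hF
  have e : ∫⁻ z : Space N, ENNReal.ofReal (gradConst N * t ^ (-(1 / 2) : ℝ) *
      heatKernel (2 * t) z) = ENNReal.ofReal (gradConst N * t ^ (-(1 / 2) : ℝ)) := by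
    simp_rw [ENNReal.ofReal_mul (by positivity : 0 ≤ gradConst N * t ^ (-(1 / 2) : ℝ)),
      ← enorm_heatKernel ht2]
    rw [lintegral_const_mul' _ _ ENNReal.ofReal_ne_top, lintegral_enorm_heatKernel ht2, mul_one]
  rw [e] at h
  refine (eLpNorm_mono_enorm fun x => ?_).trans h
  rw [enorm_eq_self]
  refine (enorm_integral_le_lintegral_enorm _).trans (lintegral_mono fun y => ?_)
  refine (enorm_inner_le _ _).trans ?_
  gcongr
  rw [← ofReal_norm]
  exact ENNReal.ofReal_le_ofReal (norm_gradient_heatKernel_le ht _)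

lemma IsFlux.eLpNorm_fluxIntegral_le {a b : ℝ} {A : ℝ≥0} {F : ℝ → Space N → Space N}
    (h : IsFlux a b A F) {p : ℝ≥0∞} (hp : 1 ≤ p) (hab : a ≤ b) {R : ℝ≥0∞}
    (hR : ∀ s ∈ Icc a b, eLpNorm (F s) p volume ≤ R) :
    eLpNorm (fluxIntegral F b a b) p volume ≤
      ENNReal.ofReal (2 * gradConst N * (b - a) ^ (1 / 2 : ℝ)) * R := by
  have hc := gradConst_pos (N := N)
  have hw : ∫⁻ s in Ioo a b, ENNReal.ofReal (gradConst N * (b - s) ^ (-(1 / 2) : ℝ)) =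
      ENNReal.ofReal (2 * gradConst N * (b - a) ^ (1 / 2 : ℝ)) := by
    simp_rw [ENNReal.ofReal_mul hc.le]
    rw [lintegral_const_mul' _ _ ENNReal.ofReal_ne_top, lintegral_sub_rpow (by norm_num) hab le_rfl,
      ← ENNReal.ofReal_mul hc.le, sub_self]
    norm_num
    congr 1
    ring
  rw [← hw]
  refine le_trans (eLpNorm_mono_enorm (g := fun x => ∫⁻ s in Ioo a b,
    ‖heatDivergence (b - s) (F s) x‖ₑ) fun x => ?_) ?_
  · rw [enorm_eq_self]
    exact enorm_integral_le_lintegral_enorm _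
  · refine eLpNorm_lintegral_le hp (f := fun s x => ‖heatDivergence (b - s) (F s) x‖ₑ)
      (h.aestronglyMeasurable le_rfl).enorm (by fun_prop) ?_
      (ae_of_all _ fun s => ENNReal.ofReal_ne_top) ?_
    · filter_upwards [ae_restrict_mem measurableSet_Ioo] with s hs
      have : 0 < b - s := by linarith [hs.2]
      have : 0 < gradConst N * (b - s) ^ (-(1 / 2) : ℝ) := by positivity
      simpa using this
    · filter_upwards [ae_restrict_mem measurableSet_Ioo] with s hs
      have hs' := Ioo_subset_Icc_self hs
      refine (eLpNorm_enorm _).le.trans ?_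
      refine (eLpNorm_heatDivergence_le hp (by linarith [hs.2]) (h.integrable s hs').1).trans ?_
      gcongr
      exact hR s hs'

lemma integrable_exp_neg_norm : Integrable fun z : Space N => Real.exp (-‖z‖) := by
  have h1 := integrable_one_add_norm (E := Space N) (μ := volume) (r := (N : ℝ) + 1) (by simp)
  refine (h1.const_mul ((N + 1).factorial * Real.exp 1)).mono'
    (by fun_prop : Continuous fun z : Space N => Real.exp (-‖z‖)).aestronglyMeasurable
    (ae_of_all _ fun z => ?_)
  rw [Real.norm_of_nonneg (Real.exp_pos _).le, Real.rpow_neg (by positivity), ← div_eq_mul_inv,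
    le_div_iff₀ (by positivity)]
  have h2 := Real.pow_div_factorial_le_exp (1 + ‖z‖) (by positivity) (N + 1)
  rw [div_le_iff₀ (by positivity)] at h2
  have h3 : (1 + ‖z‖) ^ ((N : ℝ) + 1) = (1 + ‖z‖) ^ (N + 1) := by
    rw [← Real.rpow_natCast]
    push_cast
    rfl
  rw [h3]
  calc Real.exp (-‖z‖) * (1 + ‖z‖) ^ (N + 1)
      ≤ Real.exp (-‖z‖) * (Real.exp (1 + ‖z‖) * (N + 1).factorial) := by gcongr
    _ = (Real.exp (-‖z‖) * Real.exp (1 + ‖z‖)) * (N + 1).factorial := by ring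
    _ = _ := by rw [← Real.exp_add]; simp; ring

/-- The integral of `exp (-|z|)`. -/
def expMass (N : ℕ) : ℝ := ∫ z : Space N, Real.exp (-‖z‖)

lemma expMass_nonneg : 0 ≤ expMass N := integral_nonneg fun _ => (Real.exp_pos _).le

lemma lintegral_exp_neg_mul_norm {β : ℝ} (hβ : 0 < β) :
    ∫⁻ z : Space N, ENNReal.ofReal (Real.exp (-(β * ‖z‖))) =
      ENNReal.ofReal ((β ^ N)⁻¹ * expMass N) := by
  have h1 := Measure.integral_comp_smul (volume : Measure (Space N))
    (fun z => Real.exp (-‖z‖)) β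
  have h2 := (integrable_exp_neg_norm (N := N)).comp_smul hβ.ne'
  simp only [norm_smul, Real.norm_of_nonneg hβ.le] at h1 h2
  rw [← ofReal_integral_eq_lintegral_ofReal h2 (ae_of_all _ fun z => (Real.exp_pos _).le), h1,
    finrank_euclideanSpace, Fintype.card_fin, abs_of_nonneg (by positivity)]
  rfl

/-- Absorption of `θS` on the left, which is legitimate only for finite `S`. -/
lemma le_mul_of_le_add_mul {S Y : ℝ≥0∞} {θ : ℝ} (hS : S ≠ ⊤) (hθ0 : 0 ≤ θ) (hθ : θ < 1)
    (h : S ≤ Y + ENNReal.ofReal θ * S) : S ≤ Y * ENNReal.ofReal (1 / (1 - θ)) := by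
  have h1 : 0 < 1 - θ := by linarith
  rcases eq_or_ne Y ⊤ with rfl | hY
  · rw [ENNReal.top_mul (by simpa using h1)]
    exact le_top
  lift S to ℝ≥0 using hS
  lift Y to ℝ≥0 using hY
  have h2 : (S : ℝ) ≤ Y + θ * S := by
    have := ENNReal.toReal_mono (by finiteness) h
    rw [ENNReal.toReal_add (by finiteness) (by finiteness), ENNReal.toReal_mul,
      ENNReal.toReal_ofReal hθ0] at this
    simpa using this
  rw [← ENNReal.ofReal_coe_nnreal (p := S), ← ENNReal.ofReal_coe_nnreal (p := Y),
    ← ENNReal.ofReal_mul (by positivity)]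
  refine ENNReal.ofReal_le_ofReal ?_
  rw [mul_one_div, le_div_iff₀ h1]
  linarith

section
variable {t₁ : ℝ} {B : ℝ≥0} {b : ℝ → Space N → Space N} {ρ : ℝ → Space N → ℝ}

namespace IsDriftSolution

lemma eLpNorm_flux_le (h : IsDriftSolution t₁ B b ρ) (p : ℝ≥0∞) {s : ℝ} (hs : s ∈ Icc 0 t₁) :
    eLpNorm (fun y => ρ s y • b s y) p volume ≤ B * eLpNorm (ρ s) p volume := by
  have := eLpNorm_le_nnreal_smul_eLpNorm_of_ae_le_mul (μ := volume) (c := B)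
    (f := fun y => ρ s y • b s y) (g := ρ s) (ae_of_all _ fun y => ?_) p
  · simpa [ENNReal.smul_def] using this
  · rw [nnnorm_smul, mul_comm]
    gcongr
    exact h.norm_drift_le s hs y

/-- The `L^p` norm after the time `t - r`, in terms of the heat flow and of a bound `S`. -/
lemma eLpNorm_le_add (h : IsDriftSolution t₁ B b ρ) {p : ℝ≥0∞} (hp : 1 ≤ p) {r t : ℝ}
    (hr : 0 ≤ r) (hrt : r < t) (ht : t ≤ t₁) {S : ℝ≥0∞}
    (hS : ∀ s ∈ Icc r t, eLpNorm (ρ s) p volume ≤ S) :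
    eLpNorm (ρ t) p volume ≤ eLpNorm (heatSemigroup (t - r) (ρ r)) p volume +
      ENNReal.ofReal (2 * gradConst N * B * (t - r) ^ (1 / 2 : ℝ)) * S := by
  obtain ⟨A, hF⟩ := h.exists_isFlux
  have hF' := hF.mono hr ht
  have hc := gradConst_pos (N := N)
  have hi := h.integrable r ⟨hr, hrt.le.trans ht⟩
  rw [eLpNorm_congr_ae (h.restart hr hrt ht)]
  refine (eLpNorm_add_le (integrable_heatSemigroup (sub_pos.2 hrt) hi).1
    (hF'.integrable_fluxIntegral hrt.le le_rfl).1 hp).trans ?_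
  gcongr
  refine (hF'.eLpNorm_fluxIntegral_le hp hrt.le (R := B * S) fun s hs => ?_).trans (le_of_eq ?_)
  · refine (h.eLpNorm_flux_le p ⟨hr.trans hs.1, hs.2.trans ht⟩).trans ?_
    gcongr
    exact hS s hs
  · rw [← mul_assoc]
    congr 1
    rw [← ENNReal.ofReal_coe_nnreal (p := B), ← ENNReal.ofReal_mul (by positivity)]
    congr 1
    ring

/-- Smoothing the solution at time `r ≤ t` at a scale `τ ≤ t`. -/
lemma eLpNorm_heatSemigroup_le' (h : IsDriftSolution t₁ B b ρ) {p : ℝ≥0∞} (hp : 1 ≤ p)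
    {τ r : ℝ} (hτ : 0 < τ) (hτt : τ ≤ t₁) (hr : r ∈ Icc 0 t₁) :
    eLpNorm (heatSemigroup τ (ρ r)) p volume ≤
      ENNReal.ofReal ((expMass N + 1) * Real.exp 2 * (√t₁ / √τ) ^ N * Real.exp (B * √t₁)) *
        eLpNorm (ρ 0) p volume := by
  have ht : 0 < t₁ := hτ.trans_le hτt
  have hm := expMass_nonneg (N := N)
  have hst : 0 < √t₁ := Real.sqrt_pos.2 ht
  have hsτ : 0 < √τ := Real.sqrt_pos.2 hτ
  have hi := h.integrable 0 ⟨le_rfl, ht.le⟩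
  have hquot : 1 ≤ √t₁ / √τ := (one_le_div hsτ).2 (Real.sqrt_le_sqrt hτt)
  rcases hr.1.eq_or_lt with rfl | hr0
  · refine (eLpNorm_heatSemigroup_le hp hτ hi.1).trans (le_mul_of_one_le_left' ?_)
    rw [ENNReal.one_le_ofReal]
    have h1 : (1 : ℝ) ≤ expMass N + 1 := by linarith
    have h2 : 1 ≤ Real.exp 2 := Real.one_le_exp (by norm_num)
    have h3 : 1 ≤ Real.exp (B * √t₁) := Real.one_le_exp (by positivity)
    have h4 : 1 ≤ (√t₁ / √τ) ^ N := one_le_pow₀ hquot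
    calc (1 : ℝ) = 1 * 1 * 1 * 1 := by norm_num
      _ ≤ _ := by gcongr
  -- With this slope `β² t₁ = 1` and `β B t₁ = B √t₁`. The mass of `e^{-β|z|}` is proportional to
  -- `√t₁ ^ N`, to be set against the peak `τ^{-N/2}` of the Gaussian.
  set β := (√t₁)⁻¹ with hβ
  have hβ0 : 0 < β := by positivity
  have hP := heatPeak_pos (N := N) hτ
  set κ : Space N → ℝ := fun z => heatPeak N τ *
    Real.exp (β ^ 2 * τ + (β ^ 2 + β * B) * r - β * ‖z‖) with hκ
  have hY := eLpNorm_lconvolution_le hp (κ := κ)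
    (Continuous.measurable (by fun_prop)) (fun z => by positivity) hi.1
  refine (eLpNorm_mono_enorm fun x => ?_).trans (hY.trans ?_)
  · rw [enorm_eq_self]
    exact (h.mono hr.2).enorm_heatSemigroup_le hr0 hτ hβ0.le x
  · gcongr
    have e1 : ∀ z, ENNReal.ofReal (κ z) = ENNReal.ofReal (heatPeak N τ *
        Real.exp (β ^ 2 * τ + (β ^ 2 + β * B) * r)) * ENNReal.ofReal (Real.exp (-(β * ‖z‖))) := by
      intro z
      rw [← ENNReal.ofReal_mul (by positivity), mul_assoc, ← Real.exp_add, ← sub_eq_add_neg]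
    simp_rw [e1]
    rw [lintegral_const_mul' _ _ ENNReal.ofReal_ne_top, lintegral_exp_neg_mul_norm hβ0,
      ← ENNReal.ofReal_mul (by positivity)]
    refine ENNReal.ofReal_le_ofReal ?_
    have hb2 : β ^ 2 * t₁ = 1 := by
      rw [hβ, inv_pow, Real.sq_sqrt ht.le, inv_mul_cancel₀ ht.ne']
    have hb1 : β * t₁ = √t₁ := by
      rw [hβ, inv_mul_eq_div, div_eq_iff hst.ne', Real.mul_self_sqrt ht.le]
    have e2 : β ^ 2 * τ + (β ^ 2 + β * B) * r ≤ 2 + B * √t₁ := by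
      have f1 : β ^ 2 * τ ≤ β ^ 2 * t₁ := by gcongr
      have f2 : (β ^ 2 + β * B) * r ≤ (β ^ 2 + β * B) * t₁ := by
        gcongr
        exact hr.2
      have f3 : (β ^ 2 + β * B) * t₁ = 1 + B * √t₁ := by rw [← hb1, ← hb2]; ring
      linarith
    have e3 : heatPeak N τ ≤ (√τ ^ N)⁻¹ := by
      have hpi : (1 : ℝ) ≤ 4 * Real.pi := by linarith [Real.pi_gt_three]
      have h3 : √τ ^ N = τ ^ ((N : ℝ) / 2) := by
        rw [Real.sqrt_eq_rpow, ← Real.rpow_natCast, ← Real.rpow_mul hτ.le]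
        congr 1
        ring
      rw [h3, heatPeak, one_div]
      gcongr
      exact le_mul_of_one_le_left hτ.le hpi
    have e4 : (β ^ N)⁻¹ = √t₁ ^ N := by rw [hβ, inv_pow, inv_inv]
    calc heatPeak N τ * Real.exp (β ^ 2 * τ + (β ^ 2 + β * B) * r) * ((β ^ N)⁻¹ * expMass N)
        ≤ (√τ ^ N)⁻¹ * Real.exp (2 + B * √t₁) * (√t₁ ^ N * (expMass N + 1)) := by
          rw [e4]
          gcongr
          linarith
      _ = _ := by
          rw [Real.exp_add, div_pow]
          ring

/-- The growth constant in the `L^p` bound. -/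
def _root_.growthConst (N : ℕ) : ℝ :=
  4 * gradConst N + (1 + 4 * gradConst N * N) +
    4 * gradConst N * Real.log (2 * ((expMass N + 1) * Real.exp 2))

lemma _root_.one_le_two_mul_expMass : 1 ≤ 2 * ((expMass N + 1) * Real.exp 2) := by
  have hm := expMass_nonneg (N := N)
  have h2 : 1 ≤ Real.exp 2 := Real.one_le_exp (by norm_num)
  nlinarith

lemma _root_.growthConst_nonneg : 0 ≤ growthConst N := by
  have hc := gradConst_pos (N := N)
  have := Real.log_nonneg (one_le_two_mul_expMass (N := N))
  unfold growthConst
  positivity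

/-- Put `K = B √t₁`. Over a time `u` the Duhamel term costs at most `2 * gradConst N * B * √u` times
the supremum `S` of the norm. If `K` is small this is absorbed over the whole interval. Otherwise
the equation is restarted at `s - q²`, with `q²` so short that half of `S` is absorbed; the state at
the restart appears only smoothed at scale `q²`, where the exponential-weight estimate gives a
constant times `(√t₁ / q)^N e^K`. A single restart, instead of an iteration over short intervals,
keeps the exponent linear in `K`. -/
lemma eLpNorm_le_exp (h : IsDriftSolution t₁ B b ρ) {p : ℝ≥0∞} (hp : 1 ≤ p) {R : ℝ≥0}
    (hR : ∀ s ∈ Icc 0 t₁, eLpNorm (ρ s) p volume ≤ R) (ht : 0 ≤ t₁) :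
    eLpNorm (ρ t₁) p volume ≤
      eLpNorm (ρ 0) p volume * ENNReal.ofReal (Real.exp (growthConst N * B * √t₁)) := by
  have hc := gradConst_pos (N := N)
  have hlog := Real.log_nonneg (one_le_two_mul_expMass (N := N))
  set X := eLpNorm (ρ 0) p volume with hX
  set S : ℝ≥0∞ := ⨆ s ∈ Icc 0 t₁, eLpNorm (ρ s) p volume with hSdef
  have hS : ∀ s ∈ Icc 0 t₁, eLpNorm (ρ s) p volume ≤ S := fun s hs =>
    le_iSup₂ (f := fun s (_ : s ∈ Icc 0 t₁) => eLpNorm (ρ s) p volume) s hs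
  -- The a priori bound `R` serves only to make `S` finite, as absorption requires; it does not
  -- enter the conclusion.
  have hSt : S ≠ ⊤ := ne_top_of_le_ne_top ENNReal.coe_ne_top (iSup₂_le hR)
  have hi := h.integrable 0 ⟨le_rfl, ht⟩
  have hmem : t₁ ∈ Icc 0 t₁ := ⟨ht, le_rfl⟩
  set K := B * √t₁ with hK
  have hK0 : 0 ≤ K := by positivity
  have hshort : ∀ s ∈ Icc 0 t₁, ∀ u, s ≤ u → eLpNorm (ρ s) p volume ≤
      X + ENNReal.ofReal (2 * gradConst N * B * √u) * S := by
    intro s hs u hsu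
    rcases hs.1.eq_or_lt with rfl | hs0
    · exact le_self_add
    have := h.eLpNorm_le_add hp le_rfl hs0 hs.2 (S := S)
      fun r hr => hS r ⟨hr.1, hr.2.trans hs.2⟩
    rw [sub_zero, ← Real.sqrt_eq_rpow] at this
    refine this.trans ?_
    gcongr
    exact eLpNorm_heatSemigroup_le hp hs0 hi.1
  refine (hS t₁ hmem).trans ?_
  rcases le_or_gt (2 * gradConst N * K) (1 / 2) with hθ | hθ
  · have h1 : S ≤ X + ENNReal.ofReal (2 * gradConst N * K) * S := by
      refine iSup₂_le fun s hs => (hshort s hs t₁ hs.2).trans (le_of_eq ?_)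
      rw [hK, mul_assoc (2 * gradConst N)]
    refine (le_mul_of_le_add_mul hSt (by positivity) (by linarith) h1).trans ?_
    gcongr
    set θ := 2 * gradConst N * K with hθdef
    have hθ0 : 0 ≤ θ := by positivity
    -- For `θ ≤ 1/2` one has `1 / (1 - θ) ≤ e^{2θ}`, and `2θ = 4 * gradConst N * K` is the first
    -- summand of `growthConst` times `K`.
    have h2 : Real.exp (2 * θ) ≤ Real.exp (growthConst N * B * √t₁) := by
      refine Real.exp_le_exp.2 ?_
      rw [mul_assoc (growthConst N), ← hK, hθdef, ← mul_assoc]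
      gcongr
      unfold growthConst
      have : 0 ≤ 4 * gradConst N * N := by positivity
      have : 0 ≤ 4 * gradConst N * Real.log (2 * ((expMass N + 1) * Real.exp 2)) := by positivity
      linarith
    refine le_trans ?_ h2
    rw [div_le_iff₀ (by linarith)]
    have h3 := Real.add_one_le_exp (2 * θ)
    nlinarith
  · have hB0 : (0 : ℝ) < B := by
      by_contra hB
      have : (B : ℝ) = 0 := le_antisymm (not_lt.1 hB) B.2
      rw [hK, this] at hθ
      norm_num at hθ
    have hst : 0 < √t₁ := by
      by_contra hst
      have : √t₁ = 0 := le_antisymm (not_lt.1 hst) (Real.sqrt_nonneg _)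
      rw [hK, this] at hθ
      norm_num at hθ
    -- The length `q²` for which the Duhamel term costs exactly `1/2`.
    set q := 1 / (4 * gradConst N * B) with hq
    have hq0 : 0 < q := by positivity
    have hqs : √(q ^ 2) = q := Real.sqrt_sq hq0.le
    have hqt : q < √t₁ := by
      rw [hq, div_lt_iff₀ (by positivity)]
      rw [hK] at hθ
      linarith
    have hqt' : q ^ 2 < t₁ := by
      rw [← Real.sq_sqrt ht]
      gcongr
    have hhalf : 2 * gradConst N * B * q = 1 / 2 := by
      rw [hq]
      field_simp
      norm_num
    set L := (expMass N + 1) * Real.exp 2 * (√t₁ / q) ^ N * Real.exp K with hL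
    have hm := expMass_nonneg (N := N)
    have hL1 : 1 ≤ L := by
      have h1 : (1 : ℝ) ≤ expMass N + 1 := by linarith
      have h2 : 1 ≤ Real.exp 2 := Real.one_le_exp (by norm_num)
      have h3 : 1 ≤ Real.exp K := Real.one_le_exp hK0
      have h4 : 1 ≤ (√t₁ / q) ^ N := one_le_pow₀ ((one_le_div hq0).2 hqt.le)
      calc (1 : ℝ) = 1 * 1 * 1 * 1 := by norm_num
        _ ≤ (expMass N + 1) * Real.exp 2 * (√t₁ / q) ^ N * Real.exp K := by gcongr
    have h1 : S ≤ ENNReal.ofReal L * X + ENNReal.ofReal (1 / 2) * S := by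
      refine iSup₂_le fun s hs => ?_
      rcases le_or_gt s (q ^ 2) with hsq | hsq
      · refine (hshort s hs (q ^ 2) hsq).trans ?_
        rw [hqs, hhalf]
        gcongr
        exact le_mul_of_one_le_left' (ENNReal.one_le_ofReal.2 hL1)
      · have h2 := h.eLpNorm_le_add hp (by linarith : 0 ≤ s - q ^ 2)
          (by have : 0 < q ^ 2 := by positivity
              linarith) hs.2 (S := S)
          fun r hr => hS r ⟨by linarith [hr.1], hr.2.trans hs.2⟩
        rw [sub_sub_cancel, ← Real.sqrt_eq_rpow, hqs, hhalf] at h2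
        refine h2.trans ?_
        gcongr
        have h3 := h.eLpNorm_heatSemigroup_le' hp (by positivity : 0 < q ^ 2) hqt'.le
          (r := s - q ^ 2) ⟨by linarith, by linarith [hs.2, sq_nonneg q]⟩
        rwa [hqs] at h3
    refine (le_mul_of_le_add_mul hSt (by norm_num) (by norm_num) h1).trans ?_
    rw [mul_comm (ENNReal.ofReal L), mul_assoc, ← ENNReal.ofReal_mul (by positivity)]
    gcongr
    have hratio : √t₁ / q = 4 * gradConst N * K := by
      rw [hq, hK]
      field_simp
    -- In this regime `K` is bounded below, so a fixed constant `X₀ ≥ 1` is at most `X₀ ^ (4 *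
    -- gradConst N * K)`. That hides the constant in `e^{CK}` with no prefactor, and explains the
    -- logarithm in `growthConst`.
    have h5 : 1 ≤ 4 * gradConst N * K := by linarith
    have h6 : (√t₁ / q) ^ N ≤ Real.exp (4 * gradConst N * N * K) := by
      rw [hratio]
      calc (4 * gradConst N * K) ^ N ≤ Real.exp (4 * gradConst N * K) ^ N := by
            gcongr
            linarith [Real.add_one_le_exp (4 * gradConst N * K)]
        _ = _ := by
            rw [← Real.exp_nat_mul]
            congr 1
            ring
    have h7 : 2 * ((expMass N + 1) * Real.exp 2) ≤
        Real.exp (4 * gradConst N * Real.log (2 * ((expMass N + 1) * Real.exp 2)) * K) := by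
      have hpos : 0 < 2 * ((expMass N + 1) * Real.exp 2) := by positivity
      calc 2 * ((expMass N + 1) * Real.exp 2)
          = Real.exp (Real.log (2 * ((expMass N + 1) * Real.exp 2))) := (Real.exp_log hpos).symm
        _ ≤ _ := by
            refine Real.exp_le_exp.2 ?_
            calc _ ≤ (4 * gradConst N * K) * Real.log (2 * ((expMass N + 1) * Real.exp 2)) :=
                  le_mul_of_one_le_left hlog h5
              _ = _ := by ring
    calc L * (1 / (1 - 1 / 2)) = 2 * ((expMass N + 1) * Real.exp 2) * (√t₁ / q) ^ N *
          Real.exp K := by rw [hL]; ring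
      _ ≤ Real.exp (4 * gradConst N * Real.log (2 * ((expMass N + 1) * Real.exp 2)) * K) *
          Real.exp (4 * gradConst N * N * K) * Real.exp K := by gcongr
      _ ≤ _ := by
          rw [← Real.exp_add, ← Real.exp_add]
          refine Real.exp_le_exp.2 ?_
          rw [mul_assoc (growthConst N), ← hK]
          unfold growthConst
          have : 0 ≤ 4 * gradConst N * K := by positivity
          linarith

end IsDriftSolution
end

/-! ### Mild solutions as solutions with a bounded drift -/

section
variable {V : Space N → Space N} {f g : Space N → ℝ}

lemma ae_enorm_sub_left_le (x : Space N) : ∀ᵐ y, ‖V (x - y)‖ₑ ≤ eLpNorm V ⊤ volume := by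
  have h := (Measure.measurePreserving_sub_left (volume : Measure (Space N)) x).quasiMeasurePreserving.ae
    (ae_le_eLpNormEssSup (f := V))
  simpa [eLpNorm_exponent_top] using h

lemma aestronglyMeasurable_comp_sub_left (hV : AEStronglyMeasurable V volume) (x : Space N) :
    AEStronglyMeasurable (fun y => V (x - y)) volume :=
  hV.comp_quasiMeasurePreserving
    (Measure.measurePreserving_sub_left (volume : Measure (Space N)) x).quasiMeasurePreserving

lemma aestronglyMeasurable_convField (hV : AEStronglyMeasurable V volume)
    (hf : AEStronglyMeasurable f volume) : AEStronglyMeasurable (convField V f) volume := by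
  have h : AEStronglyMeasurable (fun p : Space N × Space N => f p.2 • V (p.1 - p.2))
      (volume.prod volume) :=
    hf.comp_snd.smul (hV.comp_quasiMeasurePreserving (quasiMeasurePreserving_sub volume volume))
  exact h.integral_prod_right'

lemma integrable_convField_integrand (hV : MemLp V ⊤ volume) (hf : Integrable f) (x : Space N) :
    Integrable fun y => f y • V (x - y) := by
  refine hf.smul_bdd (eLpNorm V ⊤ volume).toReal
    (aestronglyMeasurable_comp_sub_left hV.1 x) ?_
  filter_upwards [ae_enorm_sub_left_le (V := V) x] with y hy
  rw [← toReal_enorm]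
  exact ENNReal.toReal_mono hV.2.ne hy

lemma enorm_convField_le (hV : MemLp V ⊤ volume) (f : Space N → ℝ) (x : Space N) :
    ‖convField V f x‖ₑ ≤ eLpNorm V ⊤ volume * eLpNorm f 1 volume := by
  refine (enorm_integral_le_lintegral_enorm _).trans ?_
  calc ∫⁻ y, ‖f y • V (x - y)‖ₑ ≤ ∫⁻ y, eLpNorm V ⊤ volume * ‖f y‖ₑ := by
        refine lintegral_mono_ae ?_
        filter_upwards [ae_enorm_sub_left_le (V := V) x] with y hy
        rw [enorm_smul, mul_comm]
        gcongr
    _ ≤ _ := by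
        rw [lintegral_const_mul' _ _ hV.2.ne, eLpNorm_one_eq_lintegral_enorm]

lemma convField_sub (hV : MemLp V ⊤ volume) (hf : Integrable f) (hg : Integrable g)
    (x : Space N) : convField V (f - g) x = convField V f x - convField V g x := by
  unfold convField
  rw [← integral_sub (integrable_convField_integrand hV hf x)
    (integrable_convField_integrand hV hg x)]
  simp [sub_smul]

/-- The flux is quadratic: its difference is `(f - g) (V * f) + g (V * (f - g))`. This carries
continuity in `L¹` from the solution to its flux. -/
lemma lintegral_flux_sub_le (hV : MemLp V ⊤ volume) (hf : Integrable f) (hg : Integrable g) :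
    ∫⁻ y, ‖f y • convField V f y - g y • convField V g y‖ₑ ≤ eLpNorm V ⊤ volume *
      (eLpNorm f 1 volume + eLpNorm g 1 volume) * eLpNorm (f - g) 1 volume := by
  calc ∫⁻ y, ‖f y • convField V f y - g y • convField V g y‖ₑ
      ≤ ∫⁻ y, (eLpNorm V ⊤ volume * eLpNorm f 1 volume * ‖(f - g) y‖ₑ +
          eLpNorm V ⊤ volume * eLpNorm (f - g) 1 volume * ‖g y‖ₑ) := by
        refine lintegral_mono fun y => ?_
        have e : f y • convField V f y - g y • convField V g y =
            (f - g) y • convField V f y + g y • convField V (f - g) y := by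
          rw [convField_sub hV hf hg]
          simp only [Pi.sub_apply]
          module
        rw [e]
        refine (enorm_add_le _ _).trans ?_
        rw [enorm_smul, enorm_smul, mul_comm ‖(f - g) y‖ₑ, mul_comm ‖g y‖ₑ]
        gcongr
        · exact enorm_convField_le hV f y
        · exact enorm_convField_le hV (f - g) y
    _ = _ := by
        have hf1 := hf.1.enorm
        have hfg : AEMeasurable (fun y => ‖(f - g) y‖ₑ) volume := (hf.1.sub hg.1).enorm
        have hVt := hV.2.ne
        rw [lintegral_add_left' (hfg.const_mul _), lintegral_const_mul'' _ hfg,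
          lintegral_const_mul'' _ hg.1.enorm, ← eLpNorm_one_eq_lintegral_enorm,
          ← eLpNorm_one_eq_lintegral_enorm]
        ring
end

lemma Icc_subset_timeInterval {T : EReal} {t : ℝ} (ht : t ∈ timeInterval T) :
    Icc 0 t ⊆ timeInterval T := fun _ hs =>
  ⟨hs.1, (EReal.coe_le_coe_iff.2 hs.2).trans_lt ht.2⟩

section
variable {p : ℝ≥0∞} {V : Space N → Space N} {T : EReal} {ρ₀ : Space N → ℝ}
  {ρ : ℝ → Space N → ℝ} {t₁ : ℝ}

lemma exists_bound_of_tendsto {S : Set ℝ} (hS : IsCompact S) {φ : ℝ → ℝ≥0∞}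
    (h : ∀ s₀ ∈ S, ∃ c : ℝ≥0, ∀ᶠ s in 𝓝[S] s₀, φ s ≤ c) : ∃ M : ℝ≥0, ∀ s ∈ S, φ s ≤ M := by
  refine hS.induction_on (p := fun A => ∃ M : ℝ≥0, ∀ s ∈ A, φ s ≤ M) ⟨0, by simp⟩ ?_ ?_ ?_
  · exact fun A B hAB ⟨M, hM⟩ => ⟨M, fun s hs => hM s (hAB hs)⟩
  · rintro A B ⟨M, hM⟩ ⟨M', hM'⟩
    refine ⟨max M M', fun s hs => ?_⟩
    rcases hs with hs | hs
    · exact (hM s hs).trans (by simp)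
    · exact (hM' s hs).trans (by simp)
  · intro s₀ hs₀
    obtain ⟨c, hc⟩ := h s₀ hs₀
    exact ⟨_, hc, c, fun s hs => hs⟩

lemma IsMildSolution.integrable (h : IsMildSolution p V T ρ₀ ρ) {s : ℝ}
    (hs : s ∈ timeInterval T) : Integrable (ρ s) :=
  memLp_one_iff_integrable.1 (h.memLp_one s hs)

lemma IsMildSolution.exists_bound (h : IsMildSolution p V T ρ₀ ρ) (ht : t₁ ∈ timeInterval T) :
    ∃ M : ℝ≥0, ∀ s ∈ Icc 0 t₁, eLpNorm (ρ s) 1 volume ≤ M := by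
  have hsub := Icc_subset_timeInterval ht
  refine exists_bound_of_tendsto isCompact_Icc fun s₀ hs₀ => ?_
  have h1 := h.memLp_one s₀ (hsub hs₀)
  refine ⟨1 + (eLpNorm (ρ s₀) 1 volume).toNNReal, ?_⟩
  have h2 := ((h.continuous_one s₀ (hsub hs₀)).mono_left (nhdsWithin_mono _ hsub)).eventually
    (gt_mem_nhds (zero_lt_one' ℝ≥0∞))
  filter_upwards [h2, self_mem_nhdsWithin] with s hs hsI
  calc eLpNorm (ρ s) 1 volume = eLpNorm (ρ s - ρ s₀ + ρ s₀) 1 volume := by rw [sub_add_cancel]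
    _ ≤ eLpNorm (ρ s - ρ s₀) 1 volume + eLpNorm (ρ s₀) 1 volume :=
        eLpNorm_add_le ((h.memLp_one s (hsub hsI)).1.sub h1.1) h1.1 le_rfl
    _ ≤ _ := by
        rw [ENNReal.coe_add, ENNReal.coe_toNNReal h1.2.ne]
        gcongr
        exact_mod_cast hs.le

/-- The a priori bound `M` is provisional: it makes the drift bounded, which gives the `L¹`
contraction, after which `M` can be replaced by `‖ρ₀‖₁`. -/
lemma IsMildSolution.isDriftSolution (h : IsMildSolution p V T ρ₀ ρ) (hV : MemLp V ⊤ volume)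
    (ht : t₁ ∈ timeInterval T) {M : ℝ≥0} (hM : ∀ s ∈ Icc 0 t₁, eLpNorm (ρ s) 1 volume ≤ M) :
    IsDriftSolution t₁ ((eLpNorm V ⊤ volume).toNNReal * M) (fun s => convField V (ρ s)) ρ where
  integrable s hs := h.integrable (Icc_subset_timeInterval ht hs)
  bounded := ⟨M, fun s hs => by simpa only [eLpNorm_one_eq_lintegral_enorm] using hM s hs⟩
  measurable_drift s hs := aestronglyMeasurable_convField hV.1
    (h.integrable (Icc_subset_timeInterval ht hs)).1
  norm_drift_le s hs y := by
    have h1 : ‖convField V (ρ s) y‖ₑ ≤ ((eLpNorm V ⊤ volume).toNNReal * M : ℝ≥0) := by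
      rw [ENNReal.coe_mul, ENNReal.coe_toNNReal hV.2.ne]
      refine (enorm_convField_le hV (ρ s) y).trans ?_
      gcongr
      exact hM s hs
    rw [← toReal_enorm]
    exact ENNReal.toReal_mono ENNReal.coe_ne_top h1
  tendsto_flux s₀ hs₀ := by
    have hsub := Icc_subset_timeInterval ht
    have h0 : Tendsto (fun s => eLpNorm V ⊤ volume * (M + M) * eLpNorm (ρ s - ρ s₀) 1 volume)
        (𝓝[Icc 0 t₁] s₀) (𝓝 0) := by
      have h1 := (h.continuous_one s₀ (hsub hs₀)).mono_left (nhdsWithin_mono _ hsub)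
      have h2 := ENNReal.Tendsto.const_mul (a := eLpNorm V ⊤ volume * (M + M)) h1
        (Or.inr (ENNReal.mul_ne_top hV.2.ne (by simp)))
      rwa [mul_zero] at h2
    refine tendsto_of_tendsto_of_tendsto_of_le_of_le' tendsto_const_nhds h0
      (Eventually.of_forall fun _ => zero_le) ?_
    filter_upwards [self_mem_nhdsWithin] with s hs
    refine (lintegral_flux_sub_le hV (h.integrable (hsub hs)) (h.integrable (hsub hs₀))).trans ?_
    gcongr
    · exact hM s hs
    · exact hM s₀ hs₀
  duhamel t htI := by
    have hmem := Icc_subset_timeInterval ht ⟨htI.1.le, htI.2⟩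
    filter_upwards [h.duhamel t hmem htI.1] with x hx
    rw [hx, fluxIntegral_eq _ _ htI.1.le, heatSemigroup_congr h.initial]

lemma IsMildSolution.eLpNorm_one_le (h : IsMildSolution p V T ρ₀ ρ) (hV : MemLp V ⊤ volume)
    (ht : t₁ ∈ timeInterval T) : eLpNorm (ρ t₁) 1 volume ≤ eLpNorm ρ₀ 1 volume := by
  obtain ⟨M, hM⟩ := h.exists_bound ht
  have h1 := (h.isDriftSolution hV ht hM).lintegral_le ⟨ht.1, le_rfl⟩
  rw [← eLpNorm_congr_ae h.initial]
  simpa only [eLpNorm_one_eq_lintegral_enorm] using h1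

/-- A mild solution has a drift bounded by `‖∇W‖_∞ ‖ρ₀‖₁`. -/
lemma IsMildSolution.isDriftSolution' (h : IsMildSolution p V T ρ₀ ρ) (hV : MemLp V ⊤ volume)
    (hρ : MemLp ρ₀ 1 volume) (ht : t₁ ∈ timeInterval T) :
    IsDriftSolution t₁ ((eLpNorm V ⊤ volume).toNNReal * (eLpNorm ρ₀ 1 volume).toNNReal)
      (fun s => convField V (ρ s)) ρ := by
  refine h.isDriftSolution hV ht fun s hs => ?_
  rw [ENNReal.coe_toNNReal hρ.2.ne]
  exact h.eLpNorm_one_le hV (Icc_subset_timeInterval ht hs)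

/-- Conservation of mass and the `L^p` bound. -/
lemma IsMildSolution.eLpNorm_bounds (h : IsMildSolution p V T ρ₀ ρ) (hp : 1 ≤ p)
    (hV : MemLp V ⊤ volume) (h0 : ∀ᵐ x, 0 ≤ ρ₀ x) (hρ : MemLp ρ₀ 1 volume)
    (ht : t₁ ∈ timeInterval T) :
    eLpNorm (ρ t₁) 1 volume = eLpNorm ρ₀ 1 volume ∧
      eLpNorm (ρ t₁) p volume ≤ eLpNorm ρ₀ p volume *
        ENNReal.ofReal (Real.exp (growthConst N * (eLpNorm V ⊤ volume).toReal *
          (eLpNorm ρ₀ 1 volume).toReal * √t₁)) := by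
  have hd := h.isDriftSolution' hV hρ ht
  have h0' : ∀ᵐ x, 0 ≤ ρ 0 x := by
    filter_upwards [h0, h.initial] with x hx hx'
    rwa [hx']
  constructor
  · have h1 := hd.lintegral_eq h0' ⟨ht.1, le_rfl⟩
    rw [← eLpNorm_congr_ae h.initial]
    simpa only [eLpNorm_one_eq_lintegral_enorm] using h1
  · obtain ⟨R, hR⟩ := h.locallyBounded t₁ ht
    have h1 := hd.eLpNorm_le_exp hp hR ht.1
    rw [eLpNorm_congr_ae h.initial] at h1
    simpa only [NNReal.coe_mul, ENNReal.coe_toNNReal_eq_toReal, mul_assoc] using h1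
end

/-! ### Test functions -/

/-- Smooth functions with compact support. -/
structure IsTest (φ : Space N → ℝ) : Prop where
  contDiff : ContDiff ℝ ∞ φ
  hasCompactSupport : HasCompactSupport φ

lemma contDiff_partialDeriv {φ : Space N → ℝ} (h : ContDiff ℝ ∞ φ) (i : Fin N) :
    ContDiff ℝ ∞ (partialDeriv i φ) :=
  (h.fderiv_right (m := ∞) (by norm_cast)).clm_apply contDiff_const

lemma contDiff_iterate_partialDeriv {φ : Space N → ℝ} (h : ContDiff ℝ ∞ φ) (i : Fin N) (n : ℕ) :
    ContDiff ℝ ∞ ((partialDeriv i)^[n] φ) := by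
  induction n with
  | zero => exact h
  | succ n ih =>
    rw [Function.iterate_succ_apply']
    exact contDiff_partialDeriv ih i

lemma partialDeriv_comm {φ : Space N → ℝ} (h : ContDiff ℝ ∞ φ) (i j : Fin N) :
    partialDeriv i (partialDeriv j φ) = partialDeriv j (partialDeriv i φ) := by
  have h1 : Differentiable ℝ (fderiv ℝ φ) :=
    (h.fderiv_right (m := ∞) (by norm_cast)).differentiable (by simp)
  have h2 : ∀ (x v w : Space N),
      fderiv ℝ (fun y => fderiv ℝ φ y v) x w = fderiv ℝ (fderiv ℝ φ) x w v := by
    intro x v w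
    rw [fderiv_clm_apply (h1 x) (differentiableAt_const v)]
    simp
  funext x
  unfold partialDeriv
  rw [h2, h2]
  refine (h.contDiffAt.isSymmSndFDerivAt ?_) _ _
  simp only [minSmoothness_of_isRCLikeNormedField]
  exact WithTop.coe_le_coe.2 le_top

lemma partialDeriv_iterate_comm {φ : Space N → ℝ} (h : ContDiff ℝ ∞ φ) (i j : Fin N) (n : ℕ) :
    partialDeriv i ((partialDeriv j)^[n] φ) = (partialDeriv j)^[n] (partialDeriv i φ) := by
  induction n with
  | zero => rfl
  | succ n ih =>
    rw [Function.iterate_succ_apply', Function.iterate_succ_apply',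
      partialDeriv_comm (contDiff_iterate_partialDeriv h j n), ih]

lemma contDiff_foldr_partialDeriv (γ : Fin N → ℕ) {φ : Space N → ℝ} (h : ContDiff ℝ ∞ φ)
    (l : List (Fin N)) :
    ContDiff ℝ ∞ (l.foldr (fun i g => (partialDeriv i)^[γ i] g) φ) := by
  induction l with
  | nil => exact h
  | cons j l ih => exact contDiff_iterate_partialDeriv ih j _

/-- The additional derivative commutes past those in the other coordinates by smoothness; the
absence of repetitions in the list ensures that it is counted once. -/
lemma foldr_partialDeriv_add_single (γ : Fin N → ℕ) (i : Fin N) {φ : Space N → ℝ}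
    (h : ContDiff ℝ ∞ φ) (l : List (Fin N)) (hl : l.Nodup) :
    l.foldr (fun j g => (partialDeriv j)^[(γ + Pi.single i 1 : Fin N → ℕ) j] g) φ =
      if i ∈ l then partialDeriv i (l.foldr (fun j g => (partialDeriv j)^[γ j] g) φ)
      else l.foldr (fun j g => (partialDeriv j)^[γ j] g) φ := by
  induction l with
  | nil => simp
  | cons j l ih =>
    have hc := contDiff_foldr_partialDeriv γ h l
    rw [List.foldr_cons, ih hl.of_cons, List.foldr_cons]
    by_cases hji : j = i
    · subst hji
      have hj : j ∉ l := (List.nodup_cons.1 hl).1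
      simp [hj, Function.iterate_succ_apply']
    · have hij : i ≠ j := Ne.symm hji
      simp only [Pi.add_apply, Pi.single_apply, hji, if_false, add_zero, List.mem_cons, hij,
        false_or]
      split_ifs
      · rw [partialDeriv_iterate_comm hc]
      · rfl

lemma multiDeriv_add_single (γ : Fin N → ℕ) (i : Fin N) {φ : Space N → ℝ}
    (h : ContDiff ℝ ∞ φ) :
    multiDeriv (γ + Pi.single i 1) φ = partialDeriv i (multiDeriv γ φ) := by
  unfold multiDeriv
  rw [foldr_partialDeriv_add_single γ i h _ (List.nodup_finRange N), if_pos (List.mem_finRange i)]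

lemma multiDeriv_zero (φ : Space N → ℝ) : multiDeriv 0 φ = φ := by
  unfold multiDeriv
  induction List.finRange N with
  | nil => rfl
  | cons j l ih => simp

lemma multiDeriv_single (i : Fin N) {φ : Space N → ℝ} (h : ContDiff ℝ ∞ φ) :
    multiDeriv (Pi.single i 1) φ = partialDeriv i φ := by
  rw [← zero_add (Pi.single i 1), multiDeriv_add_single 0 i h, multiDeriv_zero]

lemma IsTest.partialDeriv {φ : Space N → ℝ} (h : IsTest φ) (i : Fin N) :
    IsTest (partialDeriv i φ) :=
  ⟨contDiff_partialDeriv h.contDiff i, h.hasCompactSupport.fderiv_apply ℝ _⟩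

lemma IsTest.multiDeriv {φ : Space N → ℝ} (h : IsTest φ) (γ : Fin N → ℕ) :
    IsTest (multiDeriv γ φ) := by
  unfold _root_.multiDeriv
  induction List.finRange N with
  | nil => exact h
  | cons j l ih =>
    rw [List.foldr_cons]
    induction γ j with
    | zero => exact ih
    | succ n ih' =>
      rw [Function.iterate_succ_apply']
      exact ih'.partialDeriv j

lemma IsTest.comp_add_right {φ : Space N → ℝ} (h : IsTest φ) (z : Space N) :
    IsTest fun y => φ (y + z) :=
  ⟨h.contDiff.comp (contDiff_id.add contDiff_const),
    h.hasCompactSupport.comp_homeomorph (Homeomorph.addRight z)⟩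

lemma partialDeriv_comp_add_right (i : Fin N) (z : Space N) (φ : Space N → ℝ) :
    partialDeriv i (fun y => φ (y + z)) = fun y => partialDeriv i φ (y + z) := by
  funext y
  unfold partialDeriv
  rw [fderiv_comp_add_right z]

lemma multiDeriv_comp_add_right (γ : Fin N → ℕ) (z : Space N) (φ : Space N → ℝ) :
    multiDeriv γ (fun y => φ (y + z)) = fun y => multiDeriv γ φ (y + z) := by
  unfold multiDeriv
  induction List.finRange N with
  | nil => rfl
  | cons j l ih =>
    rw [List.foldr_cons, ih, List.foldr_cons]
    have h : Function.Semiconj (fun (f : Space N → ℝ) y => f (y + z)) (partialDeriv j)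
      (partialDeriv j) := fun f => (partialDeriv_comp_add_right j z f).symm
    exact ((h.iterate_right (γ j)) _).symm

lemma IsTest.continuous {φ : Space N → ℝ} (h : IsTest φ) : Continuous φ := h.contDiff.continuous

lemma IsTest.memLp {φ : Space N → ℝ} (h : IsTest φ) (p : ℝ≥0∞) : MemLp φ p volume :=
  h.continuous.memLp_of_hasCompactSupport h.hasCompactSupport

lemma IsTest.integrable_mul {φ f : Space N → ℝ} (h : IsTest φ)
    (hf : LocallyIntegrable f volume) : Integrable fun x => f x * φ x :=
  hf.integrable_smul_right_of_hasCompactSupport h.continuous h.hasCompactSupport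

/-! ### Weak derivatives -/

section
variable {γ : Fin N → ℕ} {f f' g g' : Space N → ℝ}

lemma HasWeakDeriv.integral_eq (h : HasWeakDeriv γ f g) {φ : Space N → ℝ} (hφ : IsTest φ) :
    ∫ x, f x * multiDeriv γ φ x = (-1 : ℝ) ^ (∑ i, γ i) * ∫ x, g x * φ x :=
  h.2.2 φ hφ.1 hφ.2

lemma HasWeakDeriv.of_isTest (hf : LocallyIntegrable f volume) (hg : LocallyIntegrable g volume)
    (h : ∀ φ, IsTest φ →
      ∫ x, f x * multiDeriv γ φ x = (-1 : ℝ) ^ (∑ i, γ i) * ∫ x, g x * φ x) :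
    HasWeakDeriv γ f g :=
  ⟨hf, hg, fun φ h1 h2 => h φ ⟨h1, h2⟩⟩

lemma HasWeakDeriv.ae_eq (h : HasWeakDeriv γ f g) (h' : HasWeakDeriv γ f g') :
    g =ᵐ[volume] g' := by
  have h1 := ae_eq_zero_of_integral_contDiff_smul_eq_zero (h.2.1.sub h'.2.1) fun φ h1 h2 => ?_
  · filter_upwards [h1] with x hx
    exact sub_eq_zero.1 hx
  · have hφ : IsTest φ := ⟨h1, h2⟩
    have e := (h.integral_eq hφ).symm.trans (h'.integral_eq hφ)
    have e' : ∫ x, g x * φ x = ∫ x, g' x * φ x := mul_left_cancel₀ (by simp) e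
    calc ∫ x, φ x • (g - g') x = ∫ x, (g x * φ x - g' x * φ x) := by
          refine integral_congr_ae (ae_of_all _ fun x => ?_)
          simp only [Pi.sub_apply, smul_eq_mul]
          ring
      _ = 0 := by
          rw [integral_sub (hφ.integrable_mul h.2.1) (hφ.integrable_mul h'.2.1), e', sub_self]

lemma HasWeakDeriv.congr (h : HasWeakDeriv γ f g) (hf : f =ᵐ[volume] f')
    (hg : g =ᵐ[volume] g') : HasWeakDeriv γ f' g' := by
  refine .of_isTest (h.1.congr hf) (h.2.1.congr hg) fun φ hφ => ?_
  have e1 : ∫ x, f' x * multiDeriv γ φ x = ∫ x, f x * multiDeriv γ φ x :=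
    integral_congr_ae (by filter_upwards [hf] with x hx; rw [hx])
  have e2 : ∫ x, g' x * φ x = ∫ x, g x * φ x :=
    integral_congr_ae (by filter_upwards [hg] with x hx; rw [hx])
  rw [e1, e2, h.integral_eq hφ]

lemma HasWeakDeriv.sub (h : HasWeakDeriv γ f g) (h' : HasWeakDeriv γ f' g') :
    HasWeakDeriv γ (f - f') (g - g') := by
  refine .of_isTest (h.1.sub h'.1) (h.2.1.sub h'.2.1) fun φ hφ => ?_
  have hm := hφ.multiDeriv γ
  simp only [Pi.sub_apply, sub_mul]
  rw [integral_sub (hm.integrable_mul h.1) (hm.integrable_mul h'.1),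
    integral_sub (hφ.integrable_mul h.2.1) (hφ.integrable_mul h'.2.1), h.integral_eq hφ,
    h'.integral_eq hφ, mul_sub]

lemma hasWeakDeriv_zero (hf : LocallyIntegrable f volume) : HasWeakDeriv 0 f f :=
  .of_isTest hf hf fun φ _ => by simp [multiDeriv_zero]

lemma sum_add_single (γ : Fin N → ℕ) (i : Fin N) :
    ∑ j, (γ + Pi.single i 1 : Fin N → ℕ) j = ∑ j, γ j + 1 := by
  simp [Finset.sum_add_distrib]

/-- If `∂_i f` and `∂^{γ + e_i} f` exist, the latter is `∂^γ ∂_i f`. -/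
lemma HasWeakDeriv.of_add_single {i : Fin N} (hf : HasWeakDeriv (Pi.single i 1) f f')
    (h : HasWeakDeriv (γ + Pi.single i 1) f g) : HasWeakDeriv γ f' g := by
  refine .of_isTest hf.2.1 h.2.1 fun φ hφ => ?_
  have h1 := hf.integral_eq (hφ.multiDeriv γ)
  rw [multiDeriv_single i (hφ.multiDeriv γ).1, ← multiDeriv_add_single γ i hφ.1,
    h.integral_eq hφ, sum_add_single] at h1
  simp only [Finset.sum_pi_single', Finset.mem_univ, if_true, pow_succ] at h1
  linarith

lemma hasWeakDeriv_weakDeriv (h : HasWeakDeriv γ f g) : HasWeakDeriv γ f (weakDeriv γ f) := by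
  have h' : ∃ g, HasWeakDeriv γ f g := ⟨g, h⟩
  unfold weakDeriv
  rw [dif_pos h']
  exact h'.choose_spec

lemma HasWeakDeriv.weakDeriv_ae_eq (h : HasWeakDeriv γ f g) : weakDeriv γ f =ᵐ[volume] g :=
  (hasWeakDeriv_weakDeriv h).ae_eq h

/-- A function in `L²` is estimated by testing it. -/
lemma eLpNorm_two_le_of_forall_isTest (hg : MemLp g 2 volume) {D : ℝ} (hD : 0 ≤ D)
    (h : ∀ φ, IsTest φ → |∫ x, g x * φ x| ≤ D * (eLpNorm φ 2 volume).toReal) :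
    eLpNorm g 2 volume ≤ ENNReal.ofReal D := by
  set G := (eLpNorm g 2 volume).toReal with hG
  have hG0 : 0 ≤ G := ENNReal.toReal_nonneg
  have hholder : ∀ {u v : Space N → ℝ}, MemLp u 2 volume → MemLp v 2 volume →
      |∫ x, u x * v x| ≤ (eLpNorm u 2 volume).toReal * (eLpNorm v 2 volume).toReal := by
    intro u v hu hv
    have h1 := eLpNorm_smul_le_mul_eLpNorm (p := 2) (q := 2) (r := 1) hv.1 hu.1
    rw [eLpNorm_one_eq_lintegral_enorm] at h1
    have h2 := (enorm_integral_le_lintegral_enorm fun x => u x * v x).trans h1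
    rw [← Real.norm_eq_abs, ← toReal_enorm, ← ENNReal.toReal_mul]
    exact ENNReal.toReal_mono (ENNReal.mul_ne_top hu.2.ne hv.2.ne) h2
  have hsq : ∫ x, g x * g x = G ^ 2 := by
    have h1 := hg.eLpNorm_eq_integral_rpow_norm (by norm_num) (by norm_num)
    have h2 : 0 ≤ ∫ x, ‖g x‖ ^ (2 : ℝ) := integral_nonneg fun x => by positivity
    rw [hG, h1, ENNReal.toReal_ofReal (by positivity), ← Real.rpow_natCast, ← Real.rpow_mul]
    · norm_num
      refine integral_congr_ae (ae_of_all _ fun x => ?_)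
      simp only
      ring
    · simpa using h2
  -- Test with a smooth function `ε`-close to `g` itself in `L²`; as `ε → 0` this becomes `G² ≤ D
  -- G`.
  have key : ∀ ε > 0, G ^ 2 ≤ D * (G + ε) + G * ε := by
    intro ε hε
    obtain ⟨φ, h1, h2, h3⟩ := hg.exist_eLpNorm_sub_le (by norm_num) (by norm_num) hε
    have hφ : IsTest φ := ⟨h2, h1⟩
    have hφ2 := hφ.memLp 2
    have h4 : (eLpNorm (g - φ) 2 volume).toReal ≤ ε := ENNReal.toReal_le_of_le_ofReal hε.le h3
    have h5 : (eLpNorm φ 2 volume).toReal ≤ G + ε := by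
      have h6 : eLpNorm φ 2 volume ≤ eLpNorm g 2 volume + eLpNorm (g - φ) 2 volume := by
        have := eLpNorm_sub_le (p := 2) hg.1 (hg.1.sub hφ2.1) (by norm_num)
        rwa [sub_sub_cancel] at this
      calc (eLpNorm φ 2 volume).toReal
          ≤ (eLpNorm g 2 volume + eLpNorm (g - φ) 2 volume).toReal :=
            ENNReal.toReal_mono (ENNReal.add_ne_top.2 ⟨hg.2.ne, (hg.sub hφ2).2.ne⟩) h6
        _ ≤ _ := by
            rw [ENNReal.toReal_add hg.2.ne (hg.sub hφ2).2.ne]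
            linarith
    have h7 : ∫ x, g x * g x = (∫ x, g x * φ x) + ∫ x, g x * (g - φ) x := by
      refine Eq.trans ?_ (integral_add (hg.integrable_mul hφ2) (hg.integrable_mul (hg.sub hφ2)))
      refine integral_congr_ae (ae_of_all _ fun x => ?_)
      simp only [Pi.sub_apply]
      ring
    calc G ^ 2 = (∫ x, g x * φ x) + ∫ x, g x * (g - φ) x := by rw [← hsq, h7]
      _ ≤ D * (eLpNorm φ 2 volume).toReal + G * (eLpNorm (g - φ) 2 volume).toReal :=
          add_le_add ((le_abs_self _).trans (h φ hφ))
            ((le_abs_self _).trans (hholder hg (hg.sub hφ2)))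
      _ ≤ D * (G + ε) + G * ε := by gcongr
  have hle : G ^ 2 ≤ D * G := by
    refine le_of_forall_pos_le_add fun ε hε => ?_
    have h1 := key (ε / (D + G + 1)) (by positivity)
    have h2 : (D + G) * (ε / (D + G + 1)) ≤ ε := by
      rw [mul_div_assoc', div_le_iff₀ (by positivity)]
      nlinarith
    linarith
  have : G ≤ D := by
    by_contra hcon
    nlinarith
  rw [← ENNReal.ofReal_toReal hg.2.ne]
  exact ENNReal.ofReal_le_ofReal this

end

/-! ### Mollification and the product rule -/

section
variable {i : Fin N} {f f' b b' η : Space N → ℝ}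

/-- The convolution `b * η`. -/
def mollify (η b : Space N → ℝ) (x : Space N) : ℝ := ∫ t, b t * η (x - t)

lemma mollify_eq_convolution (η b : Space N → ℝ) :
    mollify η b = convolution b η (ContinuousLinearMap.lsmul ℝ ℝ).flip volume := by
  funext x
  refine integral_congr_ae (ae_of_all _ fun t => ?_)
  simp [mul_comm]

lemma contDiff_mollify (hη : IsTest η) (hb : LocallyIntegrable b volume) :
    ContDiff ℝ ∞ (mollify η b) := by
  rw [mollify_eq_convolution]
  exact hη.2.contDiff_convolution_right _ hb hη.1

lemma partialDeriv_mollify (hη : IsTest η) (hb : LocallyIntegrable b volume) (i : Fin N) :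
    partialDeriv i (mollify η b) = mollify (partialDeriv i η) b := by
  funext x
  rw [mollify_eq_convolution, mollify_eq_convolution]
  have h1 : ContDiff ℝ 1 η := hη.1.of_le (by norm_cast)
  unfold partialDeriv
  rw [(hη.2.hasFDerivAt_convolution_right _ hb h1 x).fderiv,
    convolution_precompR_apply _ hb (hη.2.fderiv ℝ) (h1.continuous_fderiv one_ne_zero)]

lemma IsTest.comp_sub_left (hη : IsTest η) (x : Space N) : IsTest fun t => η (x - t) :=
  ⟨hη.1.comp (contDiff_const.sub contDiff_id),
    hη.2.comp_homeomorph (Homeomorph.subLeft x)⟩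

lemma partialDeriv_comp_sub_left (hη : IsTest η) (x : Space N) (i : Fin N) (t : Space N) :
    partialDeriv i (fun t => η (x - t)) t = -partialDeriv i η (x - t) := by
  have h1 : HasFDerivAt η (fderiv ℝ η (x - t)) (x - t) :=
    (hη.1.differentiable (by simp) _).hasFDerivAt
  have h2 : HasFDerivAt (fun t : Space N => x - t) (-ContinuousLinearMap.id ℝ (Space N)) t :=
    (hasFDerivAt_id t).const_sub x
  have h3 := (h1.comp t h2).fderiv
  unfold partialDeriv
  rw [show (fun t => η (x - t)) = η ∘ fun t => x - t from rfl, h3]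
  simp

lemma HasWeakDeriv.partialDeriv_mollify (hη : IsTest η)
    (hb : HasWeakDeriv (Pi.single i 1) b b') :
    partialDeriv i (mollify η b) = mollify η b' := by
  rw [_root_.partialDeriv_mollify hη hb.1]
  funext x
  have hx := hη.comp_sub_left x
  have h := hb.integral_eq hx
  rw [multiDeriv_single i hx.1] at h
  simp only [partialDeriv_comp_sub_left hη, mul_neg, integral_neg, Finset.sum_pi_single',
    Finset.mem_univ, if_true, pow_one, neg_mul, one_mul, neg_inj] at h
  exact h

lemma norm_mollify_le (hη : IsTest η) (hη0 : ∀ x, 0 ≤ η x) (hη1 : ∫ x, η x = 1) {M : ℝ}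
    (hM : ∀ᵐ x, ‖b x‖ ≤ M) (x : Space N) : ‖mollify η b x‖ ≤ M := by
  have hx : Integrable fun t => η (x - t) :=
    (hη.comp_sub_left x).continuous.integrable_of_hasCompactSupport (hη.comp_sub_left x).2
  calc ‖mollify η b x‖ ≤ ∫ t, M * η (x - t) := by
        refine norm_integral_le_of_norm_le (hx.const_mul M) ?_
        filter_upwards [hM] with t ht
        rw [norm_mul, Real.norm_of_nonneg (hη0 _)]
        exact mul_le_mul_of_nonneg_right ht (hη0 _)
    _ = M := by
        rw [integral_const_mul, integral_sub_left_eq_self (fun t => η t), hη1, mul_one]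

/-- A smooth approximation of the identity. -/
lemma exists_approximate_identity (N : ℕ) : ∃ η : ℕ → Space N → ℝ, (∀ n, IsTest (η n)) ∧
    (∀ n x, 0 ≤ η n x) ∧ (∀ n, ∫ x, η n x = 1) ∧
    ∀ b : Space N → ℝ, LocallyIntegrable b volume →
      ∀ᵐ x, Tendsto (fun n => mollify (η n) b x) atTop (𝓝 (b x)) := by
  -- Keeping the ratio of outer to inner radius fixed is what convergence at almost every point
  -- requires for a merely locally integrable function.
  let φ : ℕ → ContDiffBump (0 : Space N) := fun n =>
    ⟨1 / ((n : ℝ) + 1), 2 * (1 / ((n : ℝ) + 1)), by positivity,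
      by have : 0 < 1 / ((n : ℝ) + 1) := by positivity
         linarith⟩
  have h0 : Tendsto (fun n => (φ n).rOut) atTop (𝓝 0) := by
    have := (tendsto_one_div_add_atTop_nhds_zero_nat (𝕜 := ℝ)).const_mul 2
    rwa [mul_zero] at this
  refine ⟨fun n => (φ n).normed volume, fun n => ⟨(φ n).contDiff_normed,
    (φ n).hasCompactSupport_normed⟩, fun n x => (φ n).nonneg_normed x,
    fun n => (φ n).integral_normed, fun b hb => ?_⟩
  have h1 := ContDiffBump.ae_convolution_tendsto_right_of_locallyIntegrable (K := 2) h0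
    (Eventually.of_forall fun n => le_rfl) hb
  filter_upwards [h1] with x hx
  refine hx.congr fun n => ?_
  rw [mollify_eq_convolution, convolution_flip]

lemma LocallyIntegrable.mul_bdd (hf : LocallyIntegrable f volume)
    (hb : AEStronglyMeasurable b volume) {M : ℝ} (hM : ∀ᵐ x, ‖b x‖ ≤ M) :
    LocallyIntegrable (fun x => f x * b x) volume := by
  refine (hf.smul M).mono (hf.aestronglyMeasurable.mul hb) ?_
  filter_upwards [hM] with x hx
  rw [norm_mul, Pi.smul_apply, norm_smul, mul_comm]
  exact mul_le_mul_of_nonneg_right (hx.trans (le_abs_self M)) (norm_nonneg _)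

lemma tendsto_integral_mul_mollify {η : ℕ → Space N → ℝ} (hη : ∀ n, IsTest (η n))
    (hη0 : ∀ n x, 0 ≤ η n x) (hη1 : ∀ n, ∫ x, η n x = 1)
    (hlim : ∀ᵐ x, Tendsto (fun n => mollify (η n) b x) atTop (𝓝 (b x))) {M : ℝ}
    (hM : ∀ᵐ x, ‖b x‖ ≤ M) (hb : LocallyIntegrable b volume) {g : Space N → ℝ}
    (hg : Integrable g) :
    Tendsto (fun n => ∫ x, g x * mollify (η n) b x) atTop (𝓝 (∫ x, g x * b x)) := by
  refine tendsto_integral_of_dominated_convergence (fun x => ‖g x‖ * M)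
    (fun n => hg.1.mul (contDiff_mollify (hη n) hb).continuous.aestronglyMeasurable)
    (hg.norm.mul_const M) (fun n => ae_of_all _ fun x => ?_) ?_
  · rw [norm_mul]
    gcongr
    exact norm_mollify_le (hη n) (hη0 n) (hη1 n) hM x
  · filter_upwards [hlim] with x hx
    exact hx.const_mul _

/-- The product rule for a function with bounded first weak derivative. -/
lemma HasWeakDeriv.mul_bdd (hf : HasWeakDeriv (Pi.single i 1) f f')
    (hb : HasWeakDeriv (Pi.single i 1) b b') {M M' : ℝ} (hM : ∀ᵐ x, ‖b x‖ ≤ M)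
    (hM' : ∀ᵐ x, ‖b' x‖ ≤ M') :
    HasWeakDeriv (Pi.single i 1) (fun x => f x * b x) (fun x => f' x * b x + f x * b' x) := by
  obtain ⟨η, hη, hη0, hη1, hlim⟩ := exists_approximate_identity N
  have hbm := hb.1.aestronglyMeasurable
  have hbm' := hb.2.1.aestronglyMeasurable
  have l1 := LocallyIntegrable.mul_bdd hf.2.1 hbm hM
  have l2 := LocallyIntegrable.mul_bdd hf.1 hbm' hM'
  refine .of_isTest (LocallyIntegrable.mul_bdd hf.1 hbm hM) (l1.add l2) fun φ hφ => ?_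
  have hd := hφ.partialDeriv i
  rw [multiDeriv_single i hφ.1]
  have i1 : Integrable fun x => f x * partialDeriv i φ x := hd.integrable_mul hf.1
  have i2 : Integrable fun x => f' x * φ x := hφ.integrable_mul hf.2.1
  have i3 : Integrable fun x => f x * φ x := hφ.integrable_mul hf.1
  have t1 := tendsto_integral_mul_mollify hη hη0 hη1 (hlim b hb.1) hM hb.1 i1
  have t2 := tendsto_integral_mul_mollify hη hη0 hη1 (hlim b hb.1) hM hb.1 i2
  have t3 := tendsto_integral_mul_mollify hη hη0 hη1 (hlim b' hb.2.1) hM' hb.2.1 i3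
  -- The mollified `b` times `φ` is an admissible test function for `f`, and its classical product
  -- rule gives the identity. The sup bounds on `b` and `b'` then dominate the passage to the limit.
  have key : ∀ n, ∫ x, f x * partialDeriv i φ x * mollify (η n) b x =
      -((∫ x, f' x * φ x * mollify (η n) b x) + ∫ x, f x * φ x * mollify (η n) b' x) := by
    intro n
    have hc := contDiff_mollify (hη n) hb.1
    have hc' := contDiff_mollify (hη n) hb.2.1
    have hψ : IsTest fun x => mollify (η n) b x * φ x :=
      ⟨hc.mul hφ.1, hφ.2.mul_left⟩
    have hψd : IsTest fun x => mollify (η n) b x * partialDeriv i φ x :=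
      ⟨hc.mul hd.1, hd.2.mul_left⟩
    have hψ' : IsTest fun x => mollify (η n) b' x * φ x :=
      ⟨hc'.mul hφ.1, hφ.2.mul_left⟩
    have h := hf.integral_eq hψ
    have hp : ∀ x, partialDeriv i (fun x => mollify (η n) b x * φ x) x =
        mollify (η n) b x * partialDeriv i φ x + mollify (η n) b' x * φ x := by
      intro x
      have e := congrFun (hb.partialDeriv_mollify (hη n)) x
      unfold partialDeriv at e ⊢
      rw [fderiv_fun_mul (hc.differentiable (by simp) x) (hφ.1.differentiable (by simp) x)]
      simp [e, mul_comm]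
    rw [multiDeriv_single i hψ.1] at h
    simp only [hp, mul_add, Finset.sum_pi_single', Finset.mem_univ, if_true, pow_one] at h
    rw [integral_add (hψd.integrable_mul hf.1) (hψ'.integrable_mul hf.1)] at h
    have e1 : ∫ x, f x * partialDeriv i φ x * mollify (η n) b x =
        ∫ x, f x * (mollify (η n) b x * partialDeriv i φ x) := by
      congr 1; funext x; ring
    have e2 : ∫ x, f' x * φ x * mollify (η n) b x = ∫ x, f' x * (mollify (η n) b x * φ x) := by
      congr 1; funext x; ring
    have e3 : ∫ x, f x * φ x * mollify (η n) b' x = ∫ x, f x * (mollify (η n) b' x * φ x) := by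
      congr 1; funext x; ring
    rw [e1, e2, e3]
    linarith
  have hfin := tendsto_nhds_unique (t1.congr key) ((t2.add t3).neg)
  have e1 : ∫ x, f x * b x * partialDeriv i φ x = ∫ x, f x * partialDeriv i φ x * b x := by
    congr 1; funext x; ring
  have e2 : ∫ x, (f' x * b x + f x * b' x) * φ x =
      (∫ x, f' x * φ x * b x) + ∫ x, f x * φ x * b' x := by
    have j1 : Integrable fun x => f' x * φ x * b x :=
      (hφ.integrable_mul l1).congr (ae_of_all _ fun x => by simp only; ring)
    have j2 : Integrable fun x => f x * φ x * b' x :=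
      (hφ.integrable_mul l2).congr (ae_of_all _ fun x => by simp only; ring)
    rw [← integral_add j1 j2]
    congr 1; funext x; ring
  rw [e1, e2, hfin]
  simp

end

/-! ### Testing convolutions -/

lemma lintegral_enorm_mul_le {α : Type*} [MeasurableSpace α] {μ : Measure α} {u v : α → ℝ}
    (hu : AEStronglyMeasurable u μ) (hv : AEStronglyMeasurable v μ) :
    ∫⁻ x, ‖u x‖ₑ * ‖v x‖ₑ ∂μ ≤ eLpNorm u 2 μ * eLpNorm v 2 μ := by
  have h1 := eLpNorm_smul_le_mul_eLpNorm (p := 2) (q := 2) (r := 1) hv hu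
  rw [eLpNorm_one_eq_lintegral_enorm] at h1
  simpa only [Pi.smul_apply', enorm_smul] using h1

lemma eLpNorm_comp_add_right {f : Space N → ℝ} (hf : AEStronglyMeasurable f volume)
    (z : Space N) (p : ℝ≥0∞) :
    eLpNorm (fun x => f (x + z)) p volume = eLpNorm f p volume :=
  eLpNorm_comp_measurePreserving hf (measurePreserving_add_right volume z)

section
variable {K f ψ : Space N → ℝ}

/-- Testing `K * f` against `ψ` amounts to averaging, with weight `K`, the tests of `f` against the
translates of `ψ`. As derivatives commute with translations, tested bounds on derivatives of `f`
pass to `K * f` with the factor `‖K‖₁`. -/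
lemma integral_conv_mul (hK : Integrable K) (hf : AEStronglyMeasurable f volume)
    (hψ : Continuous ψ) {c : ℝ≥0∞} (hc : c ≠ ⊤)
    (h : ∀ z, ∫⁻ x, ‖f x‖ₑ * ‖ψ (x + z)‖ₑ ≤ c) :
    ∫ x, (∫ y, K (x - y) * f y) * ψ x = ∫ z, K z * ∫ y, f y * ψ (y + z) := by
  have hshift : ∀ z, ∫⁻ x, ‖f (x - z)‖ₑ * ‖ψ x‖ₑ = ∫⁻ x, ‖f x‖ₑ * ‖ψ (x + z)‖ₑ := by
    intro z
    rw [← lintegral_sub_right_eq_self (fun x => ‖f x‖ₑ * ‖ψ (x + z)‖ₑ) z]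
    simp
  have hint : Integrable (Function.uncurry fun x z => K z * f (x - z) * ψ x)
      (volume.prod volume) := by
    refine integrable_uncurry_of_lintegral ?_ ?_
    · exact (hK.1.comp_snd.mul (hf.comp_quasiMeasurePreserving
        (quasiMeasurePreserving_sub volume volume))).mul hψ.aestronglyMeasurable.comp_fst
    · calc ∫⁻ z, ∫⁻ x, ‖K z * f (x - z) * ψ x‖ₑ ≤ ∫⁻ z, ‖K z‖ₑ * c := by
            refine lintegral_mono fun z => ?_
            simp only [enorm_mul, mul_assoc]
            rw [lintegral_const_mul' _ _ enorm_ne_top, hshift]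
            gcongr
            exact h z
        _ < ⊤ := by
            rw [lintegral_mul_const' _ _ hc]
            exact ENNReal.mul_lt_top hK.2 hc.lt_top
  calc ∫ x, (∫ y, K (x - y) * f y) * ψ x = ∫ x, ∫ z, K z * f (x - z) * ψ x := by
        congr 1
        funext x
        rw [integral_mul_const, ← integral_sub_left_eq_self (fun z => K z * f (x - z)) volume x]
        simp
    _ = ∫ z, ∫ x, K z * f (x - z) * ψ x := integral_integral_swap hint
    _ = _ := by
        congr 1
        funext z
        simp only [mul_assoc]
        rw [integral_const_mul,
          ← integral_sub_right_eq_self (fun y => f y * ψ (y + z)) z]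
        simp

lemma lintegral_mul_test_le_of_integrable (hf : Integrable f) (hψ : IsTest ψ) :
    ∃ c : ℝ≥0∞, c ≠ ⊤ ∧ ∀ z, ∫⁻ x, ‖f x‖ₑ * ‖ψ (x + z)‖ₑ ≤ c := by
  obtain ⟨M, hM⟩ := hψ.2.exists_bound_of_continuous hψ.continuous
  refine ⟨(∫⁻ x, ‖f x‖ₑ) * ENNReal.ofReal M,
    ENNReal.mul_ne_top hf.2.ne ENNReal.ofReal_ne_top, fun z => ?_⟩
  rw [← lintegral_mul_const' _ _ ENNReal.ofReal_ne_top]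
  refine lintegral_mono fun x => ?_
  gcongr
  rw [← ofReal_norm]
  exact ENNReal.ofReal_le_ofReal (hM _)

lemma lintegral_mul_test_le_of_memLp (hf : MemLp f 2 volume) (hψ : IsTest ψ) :
    ∃ c : ℝ≥0∞, c ≠ ⊤ ∧ ∀ z, ∫⁻ x, ‖f x‖ₑ * ‖ψ (x + z)‖ₑ ≤ c := by
  refine ⟨eLpNorm f 2 volume * eLpNorm ψ 2 volume,
    ENNReal.mul_ne_top hf.2.ne (hψ.memLp 2).2.ne, fun z => ?_⟩
  rw [← eLpNorm_comp_add_right (hψ.memLp 2).1 z]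
  exact lintegral_enorm_mul_le hf.1 ((hψ.comp_add_right z).memLp 2).1

lemma enorm_integral_conv_multiDeriv_le (hK : Integrable K) (hf : Integrable f)
    {γ : Fin N → ℕ} {D : ℝ≥0∞}
    (hD : ∀ φ, IsTest φ → ‖∫ y, f y * multiDeriv γ φ y‖ₑ ≤ D * eLpNorm φ 2 volume)
    {φ : Space N → ℝ} (hφ : IsTest φ) :
    ‖∫ x, (∫ y, K (x - y) * f y) * multiDeriv γ φ x‖ₑ ≤
      (∫⁻ z, ‖K z‖ₑ) * (D * eLpNorm φ 2 volume) := by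
  obtain ⟨c, hc, h⟩ := lintegral_mul_test_le_of_integrable hf (hφ.multiDeriv γ)
  rw [integral_conv_mul hK hf.1 (hφ.multiDeriv γ).continuous hc h,
    ← lintegral_mul_const'' _ hK.1.enorm]
  refine (enorm_integral_le_lintegral_enorm _).trans (lintegral_mono fun z => ?_)
  rw [enorm_mul]
  gcongr
  have h1 := hD _ (hφ.comp_add_right z)
  rwa [multiDeriv_comp_add_right, eLpNorm_comp_add_right (hφ.memLp 2).1] at h1

end

/-! ### Derivatives of the drift -/

section
variable {V : Space N → Space N} {f g : Space N → ℝ}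

lemma eLpNorm_two_le_rpow (hV : eLpNormEssSup V volume ≠ ⊤) :
    eLpNorm V 2 volume ≤ (eLpNorm V ⊤ volume * eLpNorm V 1 volume) ^ (1 / 2 : ℝ) := by
  rw [eLpNorm_eq_lintegral_rpow_enorm_toReal (by norm_num) (by norm_num),
    eLpNorm_one_eq_lintegral_enorm]
  norm_num
  gcongr
  have h := ae_le_eLpNormEssSup (f := V) (μ := volume)
  rw [← lintegral_const_mul' _ _ hV]
  refine lintegral_mono_ae ?_
  filter_upwards [h] with x hx
  rw [pow_two]
  gcongr

lemma memLp_two_of_memLp (h1 : MemLp V 1 volume) (h2 : MemLp V ⊤ volume) : MemLp V 2 volume :=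
  ⟨h1.1, (eLpNorm_two_le_rpow h2.2.ne).trans_lt
    (ENNReal.rpow_lt_top_of_nonneg (by norm_num) (ENNReal.mul_ne_top h2.2.ne h1.2.ne))⟩

lemma eLpNorm_comp_sub_left (hV : AEStronglyMeasurable V volume) (x : Space N) (p : ℝ≥0∞) :
    eLpNorm (fun y => V (x - y)) p volume = eLpNorm V p volume :=
  eLpNorm_comp_measurePreserving hV (Measure.measurePreserving_sub_left volume x)

/-- Cauchy–Schwarz. Derivatives of the drift are bounded in the sup norm by `L²` norms of
derivatives of `ρ` of the same order, without any Sobolev embedding. -/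
lemma enorm_convField_le_two (hV : AEStronglyMeasurable V volume)
    (hf : AEStronglyMeasurable f volume) (x : Space N) :
    ‖convField V f x‖ₑ ≤ eLpNorm V 2 volume * eLpNorm f 2 volume := by
  have h1 := eLpNorm_smul_le_mul_eLpNorm (p := 2) (q := 2) (r := 1)
    (aestronglyMeasurable_comp_sub_left hV x) hf
  rw [eLpNorm_one_eq_lintegral_enorm, eLpNorm_comp_sub_left hV, mul_comm] at h1
  exact (enorm_integral_le_lintegral_enorm _).trans h1

lemma convField_apply (hV : MemLp V 2 volume) (hf : MemLp f 2 volume) (x : Space N) (i : Fin N) :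
    convField V f x i = ∫ y, V (x - y) i * f y := by
  have h1 : Integrable fun y => f y • V (x - y) := by
    refine ⟨hf.1.smul (aestronglyMeasurable_comp_sub_left hV.1 x), ?_⟩
    have h1 := eLpNorm_smul_le_mul_eLpNorm (p := 2) (q := 2) (r := 1)
      (aestronglyMeasurable_comp_sub_left hV.1 x) hf.1
    rw [eLpNorm_one_eq_lintegral_enorm, eLpNorm_comp_sub_left hV.1] at h1
    exact h1.trans_lt (ENNReal.mul_lt_top hf.2 hV.2)
  have h2 := (EuclideanSpace.proj (𝕜 := ℝ) i).integral_comp_comm h1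
  unfold convField
  rw [show (∫ y, f y • V (x - y)) i = EuclideanSpace.proj (𝕜 := ℝ) i (∫ y, f y • V (x - y))
    from rfl, ← h2]
  refine integral_congr_ae (ae_of_all _ fun y => ?_)
  simp [mul_comm]

lemma enorm_apply_le (v : Space N) (i : Fin N) : ‖v i‖ₑ ≤ ‖v‖ₑ := by
  rw [← ofReal_norm, ← ofReal_norm]
  exact ENNReal.ofReal_le_ofReal (PiLp.norm_apply_le v i)

lemma aestronglyMeasurable_apply (hV : AEStronglyMeasurable V volume) (i : Fin N) :
    AEStronglyMeasurable (fun x => V x i) volume :=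
  (EuclideanSpace.proj (𝕜 := ℝ) i).continuous.comp_aestronglyMeasurable hV

lemma integrable_apply (hV : Integrable V) (i : Fin N) : Integrable fun x => V x i :=
  (EuclideanSpace.proj (𝕜 := ℝ) i).integrable_comp hV

lemma locallyIntegrable_convField (hV : MemLp V 2 volume) (hf : MemLp f 2 volume) (i : Fin N) :
    LocallyIntegrable (fun x => convField V f x i) volume := by
  have h1 : MemLp (fun x => convField V f x i) ⊤ volume := by
    refine memLp_top_of_bound
      (aestronglyMeasurable_apply (aestronglyMeasurable_convField hV.1 hf.1) i)
      (eLpNorm V 2 volume * eLpNorm f 2 volume).toReal (ae_of_all _ fun x => ?_)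
    rw [← toReal_enorm]
    exact ENNReal.toReal_mono (ENNReal.mul_ne_top hV.2.ne hf.2.ne)
      ((enorm_apply_le _ i).trans (enorm_convField_le_two hV.1 hf.1 x))
  exact h1.locallyIntegrable (by norm_num)

/-- `∂^γ (V * f) = V * ∂^γ f`. -/
lemma HasWeakDeriv.convField {γ : Fin N → ℕ} (h : HasWeakDeriv γ f g) (hV1 : MemLp V 1 volume)
    (hV : MemLp V 2 volume) (hf : MemLp f 2 volume) (hg : MemLp g 2 volume) (i : Fin N) :
    HasWeakDeriv γ (fun x => convField V f x i) (fun x => convField V g x i) := by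
  refine .of_isTest (locallyIntegrable_convField hV hf i) (locallyIntegrable_convField hV hg i)
    fun φ hφ => ?_
  have hm := hφ.multiDeriv γ
  have hVi := integrable_apply (memLp_one_iff_integrable.1 hV1) i
  obtain ⟨c, hc, hfc⟩ := lintegral_mul_test_le_of_memLp hf hm
  obtain ⟨c', hc', hgc⟩ := lintegral_mul_test_le_of_memLp hg hφ
  simp only [convField_apply hV hf, convField_apply hV hg]
  rw [integral_conv_mul hVi hf.1 hm.continuous hc hfc,
    integral_conv_mul hVi hg.1 hφ.continuous hc' hgc, ← integral_const_mul]
  refine integral_congr_ae (ae_of_all _ fun z => ?_)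
  have h1 := h.integral_eq (hφ.comp_add_right z)
  rw [multiDeriv_comp_add_right] at h1
  simp only
  rw [h1]
  ring

end

/-! ### Derivatives of products -/

lemma exists_eq_add_single {γ : Fin N → ℕ} {k : ℕ} (h : ∑ i, γ i = k + 1) :
    ∃ (δ : Fin N → ℕ) (i : Fin N), γ = δ + Pi.single i 1 ∧ ∑ i, δ i = k := by
  obtain ⟨i, hi⟩ : ∃ i, γ i ≠ 0 := by
    by_contra! hcon
    simp [hcon] at h
  have e : γ - Pi.single i 1 + Pi.single i 1 = γ := by
    refine tsub_add_cancel_of_le fun j => ?_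
    rcases eq_or_ne j i with rfl | hj
    · simpa using Nat.one_le_iff_ne_zero.2 hi
    · simp [hj]
  refine ⟨γ - Pi.single i 1, i, e.symm, ?_⟩
  have h1 := sum_add_single (γ - Pi.single i 1) i
  rw [e] at h1
  omega

/-- The Leibniz rule, in a form tested against smooth functions: `f` has weak derivatives in `L²`
and `b` has bounded weak derivatives. -/
lemma enorm_integral_mul_multiDeriv_le {D : ℝ≥0} (k : ℕ) :
    ∀ {f b : Space N → ℝ} {A M : ℕ → ℝ≥0},
    (∀ γ : Fin N → ℕ, ∑ i, γ i ≤ k →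
      ∃ g, HasWeakDeriv γ f g ∧ MemLp g 2 volume ∧ eLpNorm g 2 volume ≤ A (∑ i, γ i)) →
    (∀ γ : Fin N → ℕ, ∑ i, γ i ≤ k →
      ∃ g, HasWeakDeriv γ b g ∧ ∀ᵐ x, ‖g x‖ₑ ≤ M (∑ i, γ i)) →
    (∀ i j, i + j = k → A i * M j ≤ D) →
    ∀ γ : Fin N → ℕ, ∑ i, γ i = k → ∀ φ, IsTest φ →
      ‖∫ x, f x * b x * multiDeriv γ φ x‖ₑ ≤ 2 ^ k * D * eLpNorm φ 2 volume := by
  have hnorm : ∀ {b : Space N → ℝ} {M : ℝ≥0}, (∀ᵐ x, ‖b x‖ₑ ≤ M) → ∀ᵐ x, ‖b x‖ ≤ (M : ℝ) := by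
    intro b M h
    filter_upwards [h] with x hx
    rw [← toReal_enorm]
    exact ENNReal.toReal_mono ENNReal.coe_ne_top hx
  induction k with
  | zero =>
    intro f b A M hf hb hD γ hγ φ hφ
    obtain rfl : γ = 0 := funext fun i => by simpa using (Finset.sum_eq_zero_iff.1 hγ) i
    obtain ⟨g, hg, hg2, hgA⟩ := hf 0 (by simp)
    obtain ⟨d, hd, hdM⟩ := hb 0 (by simp)
    have e1 := (hasWeakDeriv_zero hg.1).ae_eq hg
    have e2 := (hasWeakDeriv_zero hd.1).ae_eq hd
    rw [multiDeriv_zero, pow_zero, one_mul]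
    refine (enorm_integral_le_lintegral_enorm _).trans ?_
    calc ∫⁻ x, ‖f x * b x * φ x‖ₑ ≤ ∫⁻ x, M 0 * (‖g x‖ₑ * ‖φ x‖ₑ) := by
          refine lintegral_mono_ae ?_
          filter_upwards [e1, e2, hdM] with x h1 h2 h3
          rw [h1, h2, enorm_mul, enorm_mul, mul_comm ‖g x‖ₑ, mul_assoc]
          gcongr
          simpa using h3
      _ ≤ M 0 * (eLpNorm g 2 volume * eLpNorm φ 2 volume) := by
          rw [lintegral_const_mul' _ _ ENNReal.coe_ne_top]
          gcongr
          exact lintegral_enorm_mul_le hg2.1 (hφ.memLp 2).1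
      _ ≤ M 0 * (A 0 * eLpNorm φ 2 volume) := by
          gcongr
          simpa using hgA
      _ ≤ _ := by
          rw [← mul_assoc, mul_comm (M 0 : ℝ≥0∞)]
          gcongr
          exact_mod_cast hD 0 0 rfl
  | succ k ih =>
    intro f b A M hf hb hD γ hγ φ hφ
    obtain ⟨δ, i, rfl, hδ⟩ := exists_eq_add_single hγ
    have hs : ∑ j, (Pi.single i 1 : Fin N → ℕ) j = 1 := by simp
    obtain ⟨f', hf', -, -⟩ := hf (Pi.single i 1) (by omega)
    obtain ⟨b', hb', hbM'⟩ := hb (Pi.single i 1) (by omega)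
    have hb0 : ∀ᵐ x, ‖b x‖ₑ ≤ M 0 := by
      obtain ⟨d, hd, hdM⟩ := hb 0 (by simp)
      filter_upwards [(hasWeakDeriv_zero hd.1).ae_eq hd, hdM] with x h1 h2
      rw [h1]
      simpa using h2
    -- One derivative is moved off the test function and falls on either factor; the two resulting
    -- terms of order `k` account for the doubling in `2 ^ k`.
    have hprod := (hf'.mul_bdd hb' (hnorm hb0) (hnorm hbM')).integral_eq (hφ.multiDeriv δ)
    rw [multiDeriv_single i (hφ.multiDeriv δ).1, ← multiDeriv_add_single δ i hφ.1, hs, pow_one,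
      neg_one_mul] at hprod
    rw [hprod, enorm_neg]
    have l1 := LocallyIntegrable.mul_bdd hf'.2.1 hb'.1.aestronglyMeasurable (hnorm hb0)
    have l2 := LocallyIntegrable.mul_bdd hf'.1 hb'.2.1.aestronglyMeasurable (hnorm hbM')
    simp only [add_mul]
    rw [integral_add ((hφ.multiDeriv δ).integrable_mul l1) ((hφ.multiDeriv δ).integrable_mul l2)]
    -- The derivatives of `f'` are those of `f` one order higher, so its sequence of bounds is
    -- shifted by one while the total order is kept.
    have h1 := ih (f := f') (b := b) (A := fun n => A (n + 1)) (M := M)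
      (fun α hα => by
        obtain ⟨g, hg, hg'⟩ := hf (α + Pi.single i 1) (by rw [sum_add_single]; omega)
        rw [sum_add_single] at hg'
        exact ⟨g, hf'.of_add_single hg, hg'⟩)
      (fun α hα => hb α (by omega)) (fun p q hpq => hD _ _ (by omega)) δ hδ φ hφ
    have h2 := ih (f := f) (b := b') (A := A) (M := fun n => M (n + 1))
      (fun α hα => hf α (by omega))
      (fun α hα => by
        obtain ⟨g, hg, hg'⟩ := hb (α + Pi.single i 1) (by rw [sum_add_single]; omega)
        rw [sum_add_single] at hg'
        exact ⟨g, hb'.of_add_single hg, hg'⟩)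
      (fun p q hpq => hD _ _ (by omega)) δ hδ φ hφ
    refine (enorm_add_le _ _).trans ((add_le_add h1 h2).trans_eq ?_)
    rw [pow_succ]
    ring

/-! ### Testing Duhamel's formula -/

lemma enorm_integral_heatSemigroup_le {t : ℝ} (ht : 0 < t) {f : Space N → ℝ} (hf : Integrable f)
    {γ : Fin N → ℕ} {D : ℝ≥0∞}
    (hD : ∀ φ, IsTest φ → ‖∫ y, f y * multiDeriv γ φ y‖ₑ ≤ D * eLpNorm φ 2 volume)
    {φ : Space N → ℝ} (hφ : IsTest φ) :
    ‖∫ x, heatSemigroup t f x * multiDeriv γ φ x‖ₑ ≤ D * eLpNorm φ 2 volume := by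
  have h := enorm_integral_conv_multiDeriv_le (integrable_heatKernel ht) hf hD hφ
  rwa [lintegral_enorm_heatKernel ht, one_mul] at h

/-- The operator is a sum of `N` scalar convolutions with the components of `∇G`, which explains the
factor `N`. -/
lemma enorm_integral_heatDivergence_le {t : ℝ} (ht : 0 < t) {F : Space N → Space N}
    (hF : Integrable F) {γ : Fin N → ℕ} {D : ℝ≥0∞}
    (hD : ∀ i, ∀ φ, IsTest φ → ‖∫ y, F y i * multiDeriv γ φ y‖ₑ ≤ D * eLpNorm φ 2 volume)
    {φ : Space N → ℝ} (hφ : IsTest φ) :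
    ‖∫ x, heatDivergence t F x * multiDeriv γ φ x‖ₑ ≤
      N * ENNReal.ofReal (gradConst N * t ^ (-(1 / 2) : ℝ)) * (D * eLpNorm φ 2 volume) := by
  have hm := hφ.multiDeriv γ
  obtain ⟨C, hC⟩ := hm.2.exists_bound_of_continuous hm.continuous
  have hFi : ∀ i, Integrable fun y => EuclideanSpace.single i (F y i) := by
    intro i
    refine hF.norm.mono' (Continuous.comp_aestronglyMeasurable (g := fun v : Space N =>
      EuclideanSpace.single i (v i)) ?_ hF.1) (ae_of_all _ fun y => ?_)
    · have e : (fun v : Space N => EuclideanSpace.single i (v i)) =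
          fun v => v i • EuclideanSpace.single i (1 : ℝ) := by
        funext v
        ext j
        simp [PiLp.single_apply]
      rw [e]
      fun_prop
    · rw [PiLp.norm_single]
      exact PiLp.norm_apply_le (F y) i
  have hinner : ∀ (i : Fin N) (v w : Space N),
      inner ℝ v (EuclideanSpace.single i (w i)) = v i * w i := by
    intro i v w
    simp [EuclideanSpace.inner_single_right, mul_comm]
  have hcomp : ∀ i x, heatDivergence t (fun y => EuclideanSpace.single i (F y i)) x =
      ∫ y, gradient (heatKernel t) (x - y) i * F y i := by
    intro i x
    unfold heatDivergence
    simp only [hinner]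
  have hsum : ∀ x, heatDivergence t F x =
      ∑ i, heatDivergence t (fun y => EuclideanSpace.single i (F y i)) x := by
    intro x
    unfold heatDivergence
    rw [← integral_finsetSum _ fun i _ => integrable_heatDivergence_integrand ht (hFi i) x]
    refine integral_congr_ae (ae_of_all _ fun y => ?_)
    simp only [hinner, PiLp.inner_apply]
    simp [mul_comm]
  simp only [hsum, Finset.sum_mul]
  rw [integral_finsetSum _ fun i _ => (integrable_heatDivergence ht (hFi i)).mul_bdd
    hm.continuous.aestronglyMeasurable (ae_of_all _ hC)]
  refine (enorm_sum_le _ _).trans ?_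
  calc ∑ i, ‖∫ x, heatDivergence t (fun y => EuclideanSpace.single i (F y i)) x *
        multiDeriv γ φ x‖ₑ
      ≤ ∑ _i : Fin N, ENNReal.ofReal (gradConst N * t ^ (-(1 / 2) : ℝ)) *
          (D * eLpNorm φ 2 volume) := by
        refine Finset.sum_le_sum fun i _ => ?_
        simp only [hcomp]
        refine (enorm_integral_conv_multiDeriv_le
          (integrable_apply (integrable_gradient_heatKernel ht) i) (integrable_apply hF i)
          (hD i) hφ).trans ?_
        gcongr
        exact (lintegral_mono fun z => enorm_apply_le _ i).trans
          (lintegral_enorm_gradient_heatKernel_le ht)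
    _ = _ := by
        rw [Finset.sum_const, Finset.card_univ, Fintype.card_fin, nsmul_eq_mul, mul_assoc]

/-- Substituting `σ = t - s` leaves part of the integral for `Γ(1/2)`. Measured against `e^{lt}`,
the singular kernel has mass at most `√(π/l)`, as small as desired for large `l`. -/
lemma lintegral_sub_rpow_mul_exp_le {l t : ℝ} (hl : 0 < l) :
    ∫⁻ s in Ioo 0 t, ENNReal.ofReal ((t - s) ^ (-(1 / 2) : ℝ) * Real.exp (l * s)) ≤
      ENNReal.ofReal (Real.exp (l * t) * √(Real.pi / l)) := by
  have hg := Real.integral_rpow_mul_exp_neg_mul_Ioi (a := 1 / 2) (by norm_num) hl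
  have hgi : IntegrableOn (fun σ : ℝ => σ ^ ((1 / 2 : ℝ) - 1) * Real.exp (-(l * σ))) (Ioi 0) := by
    -- If the function were not integrable, its integral would be zero by convention, against the
    -- positive value in `hg`.
    by_contra hcon
    rw [integral_undef hcon, Real.Gamma_one_half_eq] at hg
    have : 0 < (1 / l) ^ (1 / 2 : ℝ) * √Real.pi := by
      have := Real.pi_pos
      positivity
    linarith
  have hval : ∫⁻ σ in Ioi 0, ENNReal.ofReal (σ ^ ((1 / 2 : ℝ) - 1) * Real.exp (-(l * σ))) =
      ENNReal.ofReal √(Real.pi / l) := by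
    rw [← ofReal_integral_eq_lintegral_ofReal hgi, hg, Real.Gamma_one_half_eq,
      ← Real.sqrt_eq_rpow, ← Real.sqrt_mul (by positivity)]
    · congr 2
      ring
    · filter_upwards [ae_restrict_mem measurableSet_Ioi] with σ hσ
      have : (0 : ℝ) < σ := hσ
      positivity
  rw [ENNReal.ofReal_mul (Real.exp_pos _).le, ← hval,
    ← lintegral_const_mul' _ _ ENNReal.ofReal_ne_top, ← lintegral_indicator measurableSet_Ioo,
    ← lintegral_indicator measurableSet_Ioi, ← lintegral_sub_left_eq_self _ t]
  refine lintegral_mono fun s => ?_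
  by_cases hs : t - s ∈ Ioo 0 t
  · have hs' : s ∈ Ioi (0 : ℝ) := by
      have := hs.2
      simp only [mem_Ioi]
      linarith
    rw [indicator_of_mem hs, indicator_of_mem hs', ← ENNReal.ofReal_mul (Real.exp_pos _).le]
    refine ENNReal.ofReal_le_ofReal (le_of_eq ?_)
    rw [sub_sub_cancel, mul_left_comm, ← Real.exp_add]
    norm_num
    left
    ring
  · rw [indicator_of_notMem hs]
    exact zero_le

section
variable {t₁ : ℝ} {B : ℝ≥0} {b : ℝ → Space N → Space N} {ρ : ℝ → Space N → ℝ}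

/-- Duhamel's formula, tested against a derivative of a smooth function. -/
lemma IsDriftSolution.enorm_integral_multiDeriv_le (h : IsDriftSolution t₁ B b ρ) {t : ℝ}
    (ht : t ∈ Ioc 0 t₁) {γ : Fin N → ℕ} {Y : ℝ≥0∞} {D : ℝ → ℝ≥0∞}
    (hY : ∀ φ, IsTest φ → ‖∫ y, ρ 0 y * multiDeriv γ φ y‖ₑ ≤ Y * eLpNorm φ 2 volume)
    (hD : ∀ s ∈ Ioo 0 t, ∀ i, ∀ φ, IsTest φ →
      ‖∫ y, (ρ s y • b s y) i * multiDeriv γ φ y‖ₑ ≤ D s * eLpNorm φ 2 volume)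
    {φ : Space N → ℝ} (hφ : IsTest φ) :
    ‖∫ x, ρ t x * multiDeriv γ φ x‖ₑ ≤ (Y + ∫⁻ s in Ioo 0 t,
      N * ENNReal.ofReal (gradConst N * (t - s) ^ (-(1 / 2) : ℝ)) * D s) *
        eLpNorm φ 2 volume := by
  obtain ⟨A, hF⟩ := h.exists_isFlux
  have hF' := hF.mono le_rfl ht.2
  have hi0 := h.integrable 0 ⟨le_rfl, ht.1.le.trans ht.2⟩
  have hm := hφ.multiDeriv γ
  obtain ⟨C, hC⟩ := hm.2.exists_bound_of_continuous hm.continuous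
  have hbdd : ∀ {f : Space N → ℝ}, Integrable f → Integrable fun x => f x * multiDeriv γ φ x :=
    fun hf => hf.mul_bdd hm.continuous.aestronglyMeasurable (ae_of_all _ hC)
  have e1 : ∫ x, ρ t x * multiDeriv γ φ x =
      (∫ x, heatSemigroup t (ρ 0) x * multiDeriv γ φ x) +
        ∫ x, fluxIntegral (fun s y => ρ s y • b s y) t 0 t x * multiDeriv γ φ x := by
    rw [← integral_add (hbdd (integrable_heatSemigroup ht.1 hi0))
      (hbdd (hF'.integrable_fluxIntegral ht.1.le le_rfl))]
    refine integral_congr_ae ?_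
    filter_upwards [h.duhamel t ht] with x hx
    rw [hx, add_mul]
  have hu : Integrable (Function.uncurry fun (x : Space N) s =>
      heatDivergence (t - s) (fun y => ρ s y • b s y) x * multiDeriv γ φ x)
      (volume.prod (volume.restrict (Ioo 0 t))) :=
    (hF'.integrable_uncurry ht.1.le le_rfl).mul_bdd
      hm.continuous.aestronglyMeasurable.comp_fst (ae_of_all _ fun p => hC p.1)
  have e2 : ∫ x, fluxIntegral (fun s y => ρ s y • b s y) t 0 t x * multiDeriv γ φ x =
      ∫ s in Ioo 0 t, ∫ x,
        heatDivergence (t - s) (fun y => ρ s y • b s y) x * multiDeriv γ φ x := by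
    rw [← integral_integral_swap hu]
    refine integral_congr_ae (ae_of_all _ fun x => ?_)
    exact (integral_mul_const _ _).symm
  rw [e1, e2, add_mul]
  refine (enorm_add_le _ _).trans (add_le_add
    (enorm_integral_heatSemigroup_le ht.1 hi0 hY hφ) ?_)
  rw [← lintegral_mul_const' _ _ (hφ.memLp 2).2.ne]
  refine (enorm_integral_le_lintegral_enorm _).trans ?_
  refine setLIntegral_mono_ae' measurableSet_Ioo (ae_of_all _ fun s hs => ?_)
  rw [mul_assoc]
  exact enorm_integral_heatDivergence_le (sub_pos.2 hs.2)
    (hF'.integrable s (Ioo_subset_Icc_self hs)) (hD s hs) hφ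

end

/-! ### Propagation of Sobolev norms -/

lemma mem_multiIndices {m : ℕ} {γ : Fin N → ℕ} : γ ∈ multiIndices N m ↔ ∑ i, γ i ≤ m := by
  simp [multiIndices]

section
variable {m : ℕ} {γ : Fin N → ℕ} {f g : Space N → ℝ}

lemma MemH.hasWeakDeriv (h : MemH m f) (hγ : ∑ i, γ i ≤ m) :
    HasWeakDeriv γ f (weakDeriv γ f) := by
  obtain ⟨g, hg, -⟩ := h γ (mem_multiIndices.2 hγ)
  exact hasWeakDeriv_weakDeriv hg

lemma MemH.memLp_weakDeriv (h : MemH m f) (hγ : ∑ i, γ i ≤ m) :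
    MemLp (weakDeriv γ f) 2 volume := by
  obtain ⟨g, hg, hg2⟩ := h γ (mem_multiIndices.2 hγ)
  exact hg2.ae_eq hg.weakDeriv_ae_eq.symm

lemma MemH.weakDeriv_zero_ae_eq (h : MemH m f) : weakDeriv 0 f =ᵐ[volume] f :=
  (hasWeakDeriv_zero (h.hasWeakDeriv (γ := 0) (by simp)).1).weakDeriv_ae_eq

lemma MemH.memLp (h : MemH m f) : MemLp f 2 volume :=
  (h.memLp_weakDeriv (γ := 0) (by simp)).ae_eq h.weakDeriv_zero_ae_eq

lemma MemH.mono {k : ℕ} (h : MemH m f) (hk : k ≤ m) : MemH k f := fun γ hγ =>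
  h γ (mem_multiIndices.2 ((mem_multiIndices.1 hγ).trans hk))

lemma MemH.weakDeriv_congr (h : MemH m f) (hfg : f =ᵐ[volume] g) (hγ : ∑ i, γ i ≤ m) :
    weakDeriv γ f =ᵐ[volume] weakDeriv γ g :=
  (((h.hasWeakDeriv hγ).congr hfg (ae_eq_refl _)).weakDeriv_ae_eq).symm

lemma eLpNorm_weakDeriv_le_normH (h : MemH m f) (hγ : ∑ i, γ i ≤ m) :
    eLpNorm (weakDeriv γ f) 2 volume ≤ ENNReal.ofReal (normH m f) := by
  rw [← ENNReal.ofReal_toReal (h.memLp_weakDeriv hγ).2.ne]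
  refine ENNReal.ofReal_le_ofReal (Real.le_sqrt_of_sq_le ?_)
  exact Finset.single_le_sum (f := fun γ => (eLpNorm (weakDeriv γ f) 2 volume).toReal ^ 2)
    (fun γ _ => by positivity) (mem_multiIndices.2 hγ)

lemma HasWeakDeriv.enorm_integral_le (h : HasWeakDeriv γ f g) (hg : MemLp g 2 volume)
    {φ : Space N → ℝ} (hφ : IsTest φ) :
    ‖∫ x, f x * multiDeriv γ φ x‖ₑ ≤ eLpNorm g 2 volume * eLpNorm φ 2 volume := by
  rw [h.integral_eq hφ, enorm_mul, enorm_pow, enorm_neg, enorm_one, one_pow, one_mul]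
  refine (enorm_integral_le_lintegral_enorm _).trans ?_
  simp only [enorm_mul]
  exact lintegral_enorm_mul_le hg.1 (hφ.memLp 2).1

lemma HasWeakDeriv.eLpNorm_two_le (h : HasWeakDeriv γ f g) (hg : MemLp g 2 volume) {D : ℝ}
    (hD : 0 ≤ D) (hf : ∀ φ, IsTest φ →
      ‖∫ x, f x * multiDeriv γ φ x‖ₑ ≤ ENNReal.ofReal D * eLpNorm φ 2 volume) :
    eLpNorm g 2 volume ≤ ENNReal.ofReal D := by
  refine eLpNorm_two_le_of_forall_isTest hg hD fun φ hφ => ?_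
  have h1 := hf φ hφ
  rw [h.integral_eq hφ, enorm_mul, enorm_pow, enorm_neg, enorm_one, one_pow, one_mul] at h1
  have h2 := ENNReal.toReal_mono
    (ENNReal.mul_ne_top ENNReal.ofReal_ne_top (hφ.memLp 2).2.ne) h1
  rwa [toReal_enorm, Real.norm_eq_abs, ENNReal.toReal_mul, ENNReal.toReal_ofReal hD] at h2

end

section
variable {V : Space N → Space N} {c A : ℝ≥0} {k : ℕ}

/-- In each Leibniz term the orders `p + q = k` with `k ≥ 1` cannot both be `k`: one factor is
bounded by `A`, the other by `Z`. Thus the quadratic flux is linear in its derivatives of top order.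
-/
lemma enorm_integral_flux_multiDeriv_le (hV1 : MemLp V 1 volume) (hV : MemLp V 2 volume)
    (hc : eLpNorm V 2 volume ≤ c) (hk : 1 ≤ k) {f : Space N → ℝ} (hf : MemH k f) {Z : ℝ≥0}
    (hAZ : A ≤ Z)
    (hA : ∀ γ : Fin N → ℕ, ∑ i, γ i < k → eLpNorm (weakDeriv γ f) 2 volume ≤ A)
    (hZ : ∀ γ : Fin N → ℕ, ∑ i, γ i = k → eLpNorm (weakDeriv γ f) 2 volume ≤ Z) (i : Fin N)
    {γ : Fin N → ℕ} (hγ : ∑ i, γ i = k) {φ : Space N → ℝ} (hφ : IsTest φ) :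
    ‖∫ y, (f y • convField V f y) i * multiDeriv γ φ y‖ₑ ≤
      2 ^ k * (c * A * Z : ℝ≥0) * eLpNorm φ 2 volume := by
  have hL : ∀ γ : Fin N → ℕ, ∑ i, γ i ≤ k → eLpNorm (weakDeriv γ f) 2 volume ≤
      ((if ∑ i, γ i < k then A else Z : ℝ≥0) : ℝ≥0∞) := by
    intro γ hγ
    split_ifs with h
    · exact hA γ h
    · exact hZ γ (by omega)
  refine enorm_integral_mul_multiDeriv_le (f := f) (b := fun y => convField V f y i) k
    (A := fun j => if j < k then A else Z) (M := fun j => c * if j < k then A else Z)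
    (fun γ hγ => ⟨_, hf.hasWeakDeriv hγ, hf.memLp_weakDeriv hγ, hL γ hγ⟩)
    (fun γ hγ => ⟨_, (hf.hasWeakDeriv hγ).convField hV1 hV hf.memLp (hf.memLp_weakDeriv hγ) i,
      ae_of_all _ fun x => ?_⟩) (fun p q hpq => ?_) γ hγ φ hφ
  · refine (enorm_apply_le _ i).trans
      ((enorm_convField_le_two hV.1 (hf.memLp_weakDeriv hγ).1 x).trans ?_)
    rw [ENNReal.coe_mul]
    exact mul_le_mul' hc (hL γ hγ)
  · have h1 : ∀ j, (if j < k then A else Z) ≤ Z := fun j => by split_ifs <;> simp [hAZ]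
    rcases lt_or_ge p k with hp | hp
    · rw [if_pos hp]
      calc A * (c * if q < k then A else Z) ≤ A * (c * Z) := by gcongr; exact h1 q
        _ = c * A * Z := by ring
    · rw [if_pos (by omega : q < k)]
      calc (if p < k then A else Z) * (c * A) ≤ Z * (c * A) := by gcongr; exact h1 p
        _ = c * A * Z := by ring

variable {t₁ : ℝ} {B : ℝ≥0} {ρ : ℝ → Space N → ℝ}

/-- A self-improving bound in the norm `sup_s e^{-ls} ‖·‖₂`: Duhamel's formula turns a bound `S`
into `Y + (A + S)/2`, as the rate `l` is so large that the singular kernel has weight at most one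
half. The summand `A` accompanies `S` because the top-order bound `Z` in the flux estimate must
dominate `A`. -/
lemma IsDriftSolution.eLpNorm_weakDeriv_step
    (h : IsDriftSolution t₁ B (fun s => convField V (ρ s)) ρ)
    (hV1 : MemLp V 1 volume) (hV : MemLp V 2 volume) (hc : eLpNorm V 2 volume ≤ c) (hk : 1 ≤ k)
    (hreg : ∀ s ∈ Icc 0 t₁, MemH k (ρ s))
    (hA : ∀ s ∈ Icc 0 t₁, ∀ γ : Fin N → ℕ, ∑ i, γ i < k →
      eLpNorm (weakDeriv γ (ρ s)) 2 volume ≤ A)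
    {Y S : ℝ≥0} (hY : ∀ γ : Fin N → ℕ, ∑ i, γ i = k → eLpNorm (weakDeriv γ (ρ 0)) 2 volume ≤ Y)
    {l : ℝ} (hl : 0 < l)
    (hKl : N * gradConst N * 2 ^ k * c * A * √(Real.pi / l) ≤ 1 / 2)
    (hS : ∀ s ∈ Icc 0 t₁, ∀ γ : Fin N → ℕ, ∑ i, γ i = k →
      eLpNorm (weakDeriv γ (ρ s)) 2 volume ≤ ENNReal.ofReal (S * Real.exp (l * s))) :
    ∀ s ∈ Icc 0 t₁, ∀ γ : Fin N → ℕ, ∑ i, γ i = k →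
      eLpNorm (weakDeriv γ (ρ s)) 2 volume ≤
        ENNReal.ofReal ((Y + A / 2 + S / 2) * Real.exp (l * s)) := by
  intro s hs γ hγ
  have hg := gradConst_pos (N := N)
  rcases hs.1.eq_or_lt with rfl | hs0
  · refine (hY γ hγ).trans ?_
    rw [← ENNReal.ofReal_coe_nnreal, mul_zero, Real.exp_zero, mul_one]
    refine ENNReal.ofReal_le_ofReal ?_
    have := A.coe_nonneg
    have := S.coe_nonneg
    linarith
  have hexp : 1 ≤ Real.exp (l * s) := Real.one_le_exp (by positivity)
  set K := N * gradConst N * 2 ^ k * c * A with hK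
  have hK0 : 0 ≤ K := by positivity
  have hZ : ∀ r, ENNReal.ofReal (S * Real.exp (l * r)) ≤
      ((A + S * (Real.exp (l * r)).toNNReal : ℝ≥0) : ℝ≥0∞) := by
    intro r
    rw [ENNReal.ofReal, ENNReal.coe_le_coe, Real.toNNReal_mul S.coe_nonneg, Real.toNNReal_coe]
    exact le_add_of_nonneg_left zero_le
  have hint : ∫⁻ r in Ioo 0 s, N * ENNReal.ofReal (gradConst N * (s - r) ^ (-(1 / 2) : ℝ)) *
      (2 ^ k * (c * A * (A + S * (Real.exp (l * r)).toNNReal) : ℝ≥0)) ≤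
      ENNReal.ofReal ((A + S) / 2 * Real.exp (l * s)) := by
    calc _ ≤ ∫⁻ r in Ioo 0 s, ENNReal.ofReal (K * (A + S)) *
          ENNReal.ofReal ((s - r) ^ (-(1 / 2) : ℝ) * Real.exp (l * r)) := by
          refine setLIntegral_mono_ae' measurableSet_Ioo (ae_of_all _ fun r hr => ?_)
          have hr1 : 1 ≤ Real.exp (l * r) := Real.one_le_exp (mul_nonneg hl.le hr.1.le)
          have hsr : 0 < s - r := sub_pos.2 hr.2
          rw [← ENNReal.ofReal_mul (by positivity), ← ENNReal.ofReal_natCast,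
            ← ENNReal.ofReal_coe_nnreal, ← ENNReal.ofReal_mul (by positivity),
            show (2 : ℝ≥0∞) ^ k = ENNReal.ofReal (2 ^ k) by
              rw [ENNReal.ofReal_pow (by norm_num)]; norm_num,
            ← ENNReal.ofReal_mul (by positivity), ← ENNReal.ofReal_mul (by positivity)]
          refine ENNReal.ofReal_le_ofReal ?_
          push_cast
          rw [Real.coe_toNNReal _ (Real.exp_pos _).le]
          have h1 : A + S * Real.exp (l * r) ≤ (A + S) * Real.exp (l * r) := by
            nlinarith [A.coe_nonneg, S.coe_nonneg]
          calc N * (gradConst N * (s - r) ^ (-(1 / 2) : ℝ)) *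
                (2 ^ k * (c * A * (A + S * Real.exp (l * r))))
              ≤ N * (gradConst N * (s - r) ^ (-(1 / 2) : ℝ)) *
                (2 ^ k * (c * A * ((A + S) * Real.exp (l * r)))) := by gcongr
            _ = _ := by rw [hK]; ring
      _ ≤ ENNReal.ofReal (K * (A + S)) *
          ENNReal.ofReal (Real.exp (l * s) * √(Real.pi / l)) := by
          rw [lintegral_const_mul' _ _ ENNReal.ofReal_ne_top]
          gcongr
          exact lintegral_sub_rpow_mul_exp_le hl
      _ ≤ _ := by
          rw [← ENNReal.ofReal_mul (by positivity)]
          refine ENNReal.ofReal_le_ofReal ?_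
          calc K * (A + S) * (Real.exp (l * s) * √(Real.pi / l)) =
                K * √(Real.pi / l) * ((A + S) * Real.exp (l * s)) := by ring
            _ ≤ 1 / 2 * ((A + S) * Real.exp (l * s)) := by gcongr
            _ = _ := by ring
  refine ((hreg s hs).hasWeakDeriv hγ.le).eLpNorm_two_le ((hreg s hs).memLp_weakDeriv hγ.le)
    (by positivity) fun φ hφ => ?_
  have h0 : (0 : ℝ) ∈ Icc 0 t₁ := ⟨le_rfl, hs.1.trans hs.2⟩
  refine (h.enorm_integral_multiDeriv_le ⟨hs0, hs.2⟩ (Y := Y) (γ := γ)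
    (D := fun r => 2 ^ k * (c * A * (A + S * (Real.exp (l * r)).toNNReal) : ℝ≥0))
    (fun ψ hψ => ?_) (fun r hr i ψ hψ => ?_) hφ).trans ?_
  · refine (((hreg 0 h0).hasWeakDeriv hγ.le).enorm_integral_le
      ((hreg 0 h0).memLp_weakDeriv hγ.le) hψ).trans ?_
    gcongr
    exact hY γ hγ
  · have hr' : r ∈ Icc 0 t₁ := ⟨hr.1.le, hr.2.le.trans hs.2⟩
    exact enorm_integral_flux_multiDeriv_le hV1 hV hc hk (hreg r hr') le_self_add (hA r hr')
      (fun δ hδ => (hS r hr' δ hδ).trans (hZ r)) i hγ hψ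
  · gcongr
    refine (add_le_add_right hint _).trans ?_
    rw [← ENNReal.ofReal_coe_nnreal, ← ENNReal.ofReal_add Y.coe_nonneg (by positivity)]
    refine ENNReal.ofReal_le_ofReal ?_
    have := Y.coe_nonneg
    nlinarith

/-- The rate in the exponential bound for derivatives of order `k`. -/
def sobolevRate (N k : ℕ) (c A : ℝ≥0) : ℝ :=
  4 * Real.pi * (N * gradConst N * 2 ^ k * c * A + 1) ^ 2

lemma sobolevRate_pos (N k : ℕ) (c A : ℝ≥0) : 0 < sobolevRate N k c A := by
  have := gradConst_pos (N := N)
  have := Real.pi_pos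
  unfold sobolevRate
  positivity

lemma mul_sqrt_sobolevRate_le (N k : ℕ) (c A : ℝ≥0) :
    N * gradConst N * 2 ^ k * c * A * √(Real.pi / sobolevRate N k c A) ≤ 1 / 2 := by
  have hg := gradConst_pos (N := N)
  have hpi := Real.pi_pos
  set K := N * gradConst N * 2 ^ k * c * A with hK
  have hK0 : 0 ≤ K := by positivity
  have e : Real.pi / sobolevRate N k c A = (1 / (2 * (K + 1))) ^ 2 := by
    unfold sobolevRate
    rw [← hK]
    field_simp
    norm_num
  rw [e, Real.sqrt_sq (by positivity), mul_one_div, div_le_div_iff₀ (by positivity) (by norm_num)]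
  linarith

/-- The derivatives of order `k` are controlled by the lower ones. -/
lemma IsDriftSolution.eLpNorm_weakDeriv_le
    (h : IsDriftSolution t₁ B (fun s => convField V (ρ s)) ρ)
    (hV1 : MemLp V 1 volume) (hV : MemLp V 2 volume) (hc : eLpNorm V 2 volume ≤ c) (hk : 1 ≤ k)
    (hreg : ∀ s ∈ Icc 0 t₁, MemH k (ρ s))
    (hA : ∀ s ∈ Icc 0 t₁, ∀ γ : Fin N → ℕ, ∑ i, γ i < k →
      eLpNorm (weakDeriv γ (ρ s)) 2 volume ≤ A)
    {Y R : ℝ≥0} (hY : ∀ γ : Fin N → ℕ, ∑ i, γ i = k → eLpNorm (weakDeriv γ (ρ 0)) 2 volume ≤ Y)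
    (hR : ∀ s ∈ Icc 0 t₁, ∀ γ : Fin N → ℕ, ∑ i, γ i = k →
      eLpNorm (weakDeriv γ (ρ s)) 2 volume ≤ R) {s : ℝ} (hs : s ∈ Icc 0 t₁) {γ : Fin N → ℕ}
    (hγ : ∑ i, γ i = k) :
    eLpNorm (weakDeriv γ (ρ s)) 2 volume ≤
      ENNReal.ofReal ((2 * Y + A) * Real.exp (sobolevRate N k c A * s)) := by
  set l := sobolevRate N k c A with hl
  have hl0 : 0 < l := sobolevRate_pos N k c A
  -- `2Y + A` is the fixed point of `S ↦ Y + A/2 + S/2`. Iterating from the a priori bound `R`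
  -- halves the distance to it each time, and `R` disappears in the limit.
  have key : ∀ n : ℕ, ∀ s ∈ Icc 0 t₁, ∀ γ : Fin N → ℕ, ∑ i, γ i = k →
      eLpNorm (weakDeriv γ (ρ s)) 2 volume ≤
        ENNReal.ofReal ((2 * Y + A + R / 2 ^ n : ℝ≥0) * Real.exp (l * s)) := by
    intro n
    induction n with
    | zero =>
      intro s hs γ hγ
      refine (hR s hs γ hγ).trans ?_
      rw [← ENNReal.ofReal_coe_nnreal]
      refine ENNReal.ofReal_le_ofReal ?_
      have hexp : 1 ≤ Real.exp (l * s) := Real.one_le_exp (mul_nonneg hl0.le hs.1)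
      push_cast
      rw [pow_zero, div_one]
      have h1 : (R : ℝ) ≤ 2 * Y + A + R := by
        have := Y.coe_nonneg
        have := A.coe_nonneg
        linarith
      exact h1.trans (le_mul_of_one_le_right (by positivity) hexp)
    | succ n ih =>
      intro s hs γ hγ
      refine (h.eLpNorm_weakDeriv_step hV1 hV hc hk hreg hA hY hl0
        (mul_sqrt_sobolevRate_le N k c A) ih s hs γ hγ).trans_eq ?_
      congr 2
      push_cast
      rw [pow_succ]
      ring
  have hlim : Tendsto (fun n : ℕ => ENNReal.ofReal
      ((2 * Y + A + R / 2 ^ n : ℝ≥0) * Real.exp (l * s))) atTop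
      (𝓝 (ENNReal.ofReal ((2 * Y + A) * Real.exp (l * s)))) := by
    refine ENNReal.tendsto_ofReal (Tendsto.mul_const _ ?_)
    push_cast
    have h1 : Tendsto (fun n : ℕ => (R : ℝ) * (1 / 2) ^ n) atTop (𝓝 0) := by
      simpa using (tendsto_pow_atTop_nhds_zero_of_lt_one (r := (1 / 2 : ℝ)) (by norm_num)
        (by norm_num)).const_mul (R : ℝ)
    have h2 := h1.const_add (2 * (Y : ℝ) + A)
    rw [add_zero] at h2
    refine h2.congr fun n => ?_
    rw [one_div, inv_pow, div_eq_mul_inv]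
  exact ge_of_tendsto' hlim fun n => key n s hs γ hγ

end

/-! ### Sobolev bounds for mild solutions -/

section
variable {m : ℕ} {f g : Space N → ℝ}

lemma MemH.sub (hf : MemH m f) (hg : MemH m g) : MemH m (f - g) := fun γ hγ => by
  obtain ⟨d, hd, hd2⟩ := hf γ hγ
  obtain ⟨e, he, he2⟩ := hg γ hγ
  exact ⟨d - e, hd.sub he, hd2.sub he2⟩

lemma eLpNorm_weakDeriv_le_add (hf : MemH m f) (hg : MemH m g) {γ : Fin N → ℕ}
    (hγ : ∑ i, γ i ≤ m) :
    eLpNorm (weakDeriv γ f) 2 volume ≤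
      ENNReal.ofReal (normH m (f - g)) + eLpNorm (weakDeriv γ g) 2 volume := by
  have h1 := ((hf.hasWeakDeriv hγ).sub (hg.hasWeakDeriv hγ)).weakDeriv_ae_eq
  have h2 := eLpNorm_weakDeriv_le_normH (hf.sub hg) hγ
  rw [eLpNorm_congr_ae h1] at h2
  have hfm := (hf.memLp_weakDeriv hγ).1
  have hgm := (hg.memLp_weakDeriv hγ).1
  calc eLpNorm (weakDeriv γ f) 2 volume
      = eLpNorm (weakDeriv γ f - weakDeriv γ g + weakDeriv γ g) 2 volume := by rw [sub_add_cancel]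
    _ ≤ _ := (eLpNorm_add_le (hfm.sub hgm) hgm (by norm_num)).trans (by gcongr)

lemma normH_le {M : ℝ≥0}
    (h : ∀ γ : Fin N → ℕ, ∑ i, γ i ≤ m → eLpNorm (weakDeriv γ f) 2 volume ≤ M) :
    normH m f ≤ √((multiIndices N m).card * (M : ℝ) ^ 2) := by
  refine Real.sqrt_le_sqrt ?_
  rw [← nsmul_eq_mul]
  refine Finset.sum_le_card_nsmul _ _ _ fun γ hγ => ?_
  gcongr
  exact ENNReal.toReal_mono ENNReal.coe_ne_top (h γ (mem_multiIndices.1 hγ))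

lemma ae_eq_zero_of_normH_eq_zero (hf : MemH m f) (h : normH m f = 0) : f =ᵐ[volume] 0 := by
  have h1 := eLpNorm_weakDeriv_le_normH hf (γ := 0) (by simp)
  rw [h, ENNReal.ofReal_zero, eLpNorm_congr_ae hf.weakDeriv_zero_ae_eq] at h1
  exact (eLpNorm_eq_zero_iff hf.memLp.1 (by norm_num)).1 (le_antisymm h1 zero_le)

lemma normH_eq_zero_of_ae_eq_zero (h : f =ᵐ[volume] 0) : normH m f = 0 := by
  have h0 : ∀ γ : Fin N → ℕ, HasWeakDeriv γ (0 : Space N → ℝ) 0 := fun γ =>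
    .of_isTest locallyIntegrable_zero locallyIntegrable_zero fun φ _ => by simp
  refine le_antisymm ?_ (Real.sqrt_nonneg _)
  refine (normH_le (M := 0) fun γ hγ => ?_).trans (by simp)
  rw [eLpNorm_congr_ae ((h0 γ).congr h.symm (ae_eq_refl _)).weakDeriv_ae_eq, eLpNorm_zero]
  exact zero_le

end

lemma ContinuousInH.exists_bound {m : ℕ} {T : EReal} {ρ : ℝ → Space N → ℝ}
    (h : ContinuousInH m T ρ) {t : ℝ} (ht : t ∈ timeInterval T) :
    ∃ R : ℝ≥0, ∀ s ∈ Icc 0 t, ∀ γ : Fin N → ℕ, ∑ i, γ i ≤ m →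
      eLpNorm (weakDeriv γ (ρ s)) 2 volume ≤ R := by
  have hsub := Icc_subset_timeInterval ht
  obtain ⟨R, hR⟩ := exists_bound_of_tendsto (isCompact_Icc (a := 0) (b := t))
    (φ := fun s => ⨆ γ ∈ multiIndices N m, eLpNorm (weakDeriv γ (ρ s)) 2 volume)
    fun s₀ hs₀ => by
      have h0 := h.1 s₀ (hsub hs₀)
      refine ⟨1 + (normH m (ρ s₀)).toNNReal, ?_⟩
      filter_upwards [((h.2 s₀ (hsub hs₀)).mono_left (nhdsWithin_mono _ hsub)).eventually
        (gt_mem_nhds zero_lt_one), self_mem_nhdsWithin] with s hs hsI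
      refine iSup₂_le fun γ hγ => ?_
      have hγ' := mem_multiIndices.1 hγ
      refine (eLpNorm_weakDeriv_le_add (h.1 s (hsub hsI)) h0 hγ').trans ?_
      rw [ENNReal.coe_add]
      refine add_le_add ?_ (eLpNorm_weakDeriv_le_normH h0 hγ')
      rw [ENNReal.coe_one, ← ENNReal.ofReal_one]
      exact ENNReal.ofReal_le_ofReal hs.le
  exact ⟨R, fun s hs γ hγ => (le_iSup₂ (f := fun γ (_ : γ ∈ multiIndices N m) =>
    eLpNorm (weakDeriv γ (ρ s)) 2 volume) γ (mem_multiIndices.2 hγ)).trans (hR s hs)⟩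

/-- The derivatives of mild solutions are bounded in terms of the initial datum, of `‖∇W‖₁`, of
`‖∇W‖_∞` and of the length of the time interval. -/
lemma exists_bound_weakDeriv {m : ℕ} {ρ₀ : Space N → ℝ} (hH : MemH m ρ₀)
    (h1 : MemLp ρ₀ 1 volume) (a b τ : ℝ) (k : ℕ) (hk : k ≤ m) :
    ∃ M : ℝ≥0, ∀ V : Space N → Space N, MemLp V 1 volume → MemLp V ⊤ volume →
      (eLpNorm V 1 volume).toReal = a → (eLpNorm V ⊤ volume).toReal = b →
      ∀ (p : ℝ≥0∞) (T : EReal) (ρ : ℝ → Space N → ℝ), IsMildSolution p V T ρ₀ ρ →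
      ContinuousInH m T ρ → ∀ t ∈ timeInterval T, t ≤ τ → ∀ γ : Fin N → ℕ, ∑ i, γ i ≤ k →
        eLpNorm (weakDeriv γ (ρ t)) 2 volume ≤ M := by
  induction k with
  | zero =>
    -- Order zero is the case `p = 2` of `IsDriftSolution.eLpNorm_le_exp`. The finiteness it asks
    -- for comes from continuity in `H^m`, so the class of the mild solution plays no role.
    have hM : eLpNorm ρ₀ 2 volume * ENNReal.ofReal (Real.exp (growthConst N *
        (b * (eLpNorm ρ₀ 1 volume).toReal) * √τ)) ≠ ⊤ :=
      ENNReal.mul_ne_top hH.memLp.2.ne ENNReal.ofReal_ne_top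
    refine ⟨(eLpNorm ρ₀ 2 volume * ENNReal.ofReal (Real.exp (growthConst N *
        (b * (eLpNorm ρ₀ 1 volume).toReal) * √τ))).toNNReal,
      fun V hV1 hV ha hb p T ρ h hc t ht htτ γ hγ => ?_⟩
    rw [ENNReal.coe_toNNReal hM]
    obtain rfl : γ = 0 := funext fun i => by
      simpa using (Finset.sum_eq_zero_iff.1 (Nat.le_zero.1 hγ)) i
    obtain ⟨R, hR⟩ := hc.exists_bound ht
    have hsub := Icc_subset_timeInterval ht
    have h2 := (h.isDriftSolution' hV h1 ht).eLpNorm_le_exp (p := 2) (by norm_num) (R := R)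
      (fun s hs => by
        rw [← eLpNorm_congr_ae (hc.1 s (hsub hs)).weakDeriv_zero_ae_eq]
        exact hR s hs 0 (by simp)) ht.1
    rw [eLpNorm_congr_ae (hc.1 t ht).weakDeriv_zero_ae_eq]
    rw [eLpNorm_congr_ae h.initial, NNReal.coe_mul, ENNReal.coe_toNNReal_eq_toReal,
      ENNReal.coe_toNNReal_eq_toReal, hb] at h2
    refine h2.trans ?_
    have hb0 : 0 ≤ b := hb ▸ ENNReal.toReal_nonneg
    have hg := growthConst_nonneg (N := N)
    gcongr
  | succ k ih =>
    obtain ⟨M, hM⟩ := ih (by omega)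
    -- Interpolation bound for `‖∇W‖₂`, expressed through the two prescribed norms only, so that the
    -- constant is the same for all such `W`.
    set c : ℝ≥0 := ((ENNReal.ofReal b * ENNReal.ofReal a) ^ (1 / 2 : ℝ)).toNNReal with hcdef
    have hct : (ENNReal.ofReal b * ENNReal.ofReal a) ^ (1 / 2 : ℝ) ≠ ⊤ :=
      ENNReal.rpow_ne_top_of_nonneg (by norm_num)
        (ENNReal.mul_ne_top ENNReal.ofReal_ne_top ENNReal.ofReal_ne_top)
    set Y : ℝ≥0 := (normH m ρ₀).toNNReal with hYdef
    set l := sobolevRate N (k + 1) c M with hl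
    have hl0 : 0 < l := sobolevRate_pos _ _ _ _
    refine ⟨M + ((2 * Y + M) * Real.exp (l * τ)).toNNReal,
      fun V hV1 hV ha hb p T ρ h hc t ht htτ γ hγ => ?_⟩
    rcases hγ.lt_or_eq with hγ | hγ
    · exact (hM V hV1 hV ha hb p T ρ h hc t ht htτ γ (by omega)).trans (by simp)
    have hsub := Icc_subset_timeInterval ht
    obtain ⟨R, hR⟩ := hc.exists_bound ht
    have h0 : (0 : ℝ) ∈ Icc 0 t := ⟨le_rfl, ht.1⟩
    have hVc : eLpNorm V 2 volume ≤ c := by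
      rw [hcdef, ENNReal.coe_toNNReal hct, ← ha, ← hb, ENNReal.ofReal_toReal hV1.2.ne,
        ENNReal.ofReal_toReal hV.2.ne]
      exact eLpNorm_two_le_rpow hV.2.ne
    have h2 := (h.isDriftSolution' hV h1 ht).eLpNorm_weakDeriv_le hV1
      (memLp_two_of_memLp hV1 hV) hVc (k := k + 1) (by omega)
      (fun s hs => (hc.1 s (hsub hs)).mono hk) (A := M) (Y := Y) (R := R)
      (fun s hs δ hδ => hM V hV1 hV ha hb p T ρ h hc s (hsub hs) (hs.2.trans htτ) δ (by omega))
      (fun δ hδ => by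
        rw [eLpNorm_congr_ae ((hc.1 0 (hsub h0)).weakDeriv_congr h.initial (by omega))]
        exact eLpNorm_weakDeriv_le_normH hH (by omega))
      (fun s hs δ hδ => hR s hs δ (by omega)) (s := t) ⟨ht.1, le_rfl⟩ hγ
    refine h2.trans ?_
    rw [ENNReal.coe_add]
    refine le_add_left ?_
    rw [ENNReal.ofReal]
    gcongr

/-- The Sobolev norm of a mild solution is bounded by that of its initial datum. -/
lemma exists_normH_le {m : ℕ} {ρ₀ : Space N → ℝ} (hH : MemH m ρ₀) (h1 : MemLp ρ₀ 1 volume) :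
    ∃ C : ℝ → ℝ → ℝ → ℝ, (∀ a b τ : ℝ, ∃ B : ℝ, ∀ t ∈ Icc 0 τ, |C a b t| ≤ B) ∧
      ∀ V : Space N → Space N, MemLp V 1 volume → MemLp V ⊤ volume →
      ∀ (p : ℝ≥0∞) (T : EReal) (ρ : ℝ → Space N → ℝ), IsMildSolution p V T ρ₀ ρ →
      ContinuousInH m T ρ → ∀ t ∈ timeInterval T,
        normH m (ρ t) ≤
          C (eLpNorm V 1 volume).toReal (eLpNorm V ⊤ volume).toReal t * normH m ρ₀ := by
  choose M hM using fun (a b : ℝ) (n : ℕ) => exists_bound_weakDeriv hH h1 a b n m le_rfl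
  -- The bound for `[0, ⌈t⌉]` is used at time `t`, so only finitely many values occur on a bounded
  -- interval. Dividing by `normH m ρ₀` is allowed since the function may depend on the datum.
  refine ⟨fun a b t => √((multiIndices N m).card * (M a b ⌈t⌉₊ : ℝ) ^ 2) / normH m ρ₀,
    fun a b τ => ?_, fun V hV1 hV p T ρ h hc t ht => ?_⟩
  · refine ⟨∑ n ∈ Finset.range (⌈τ⌉₊ + 1),
      |√((multiIndices N m).card * (M a b n : ℝ) ^ 2) / normH m ρ₀|, fun t ht => ?_⟩
    exact Finset.single_le_sum
      (f := fun n => |√((multiIndices N m).card * (M a b n : ℝ) ^ 2) / normH m ρ₀|)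
      (fun n _ => abs_nonneg _)
      (Finset.mem_range.2 (Nat.lt_succ_of_le (Nat.ceil_le_ceil ht.2)))
  -- If the norm of the datum vanishes, the quotient carries no information; but then `ρ₀ = 0`
  -- almost everywhere and the `L¹` contraction makes the solution vanish too.
  · rcases eq_or_ne (normH m ρ₀) 0 with h0 | h0
    · have e0 := ae_eq_zero_of_normH_eq_zero hH h0
      have e1 := h.eLpNorm_one_le hV ht
      rw [eLpNorm_congr_ae e0, eLpNorm_zero] at e1
      have e2 := (eLpNorm_eq_zero_iff (h.memLp_one t ht).1 one_ne_zero).1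
        (le_antisymm e1 zero_le)
      rw [normH_eq_zero_of_ae_eq_zero e2, h0, mul_zero]
    · rw [div_mul_cancel₀ _ h0]
      exact normH_le fun γ hγ => hM _ _ ⌈t⌉₊ V hV1 hV rfl rfl p T ρ h hc t ht (Nat.le_ceil t) γ hγ

end

theorem mainTheorem8 (N : ℕ) (hN : 1 ≤ N) :
    (∀ ρ₀ : Space N → ℝ, (∀ᵐ x ∂volume, 0 ≤ ρ₀ x) → MemLp ρ₀ 1 volume →
      ∃ C : ℝ, 0 ≤ C ∧
        ∀ p q : ℝ≥0∞, p.HolderConjugate q → MemLp ρ₀ p volume →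
        ∀ (W : Space N → ℝ) (V : Space N → Space N), HasWeakGradient W V →
          MemLp V q volume → MemLp V ∞ volume →
        ∀ T : EReal, 0 < T → ∀ ρ : ℝ → Space N → ℝ, IsMildSolution p V T ρ₀ ρ →
        ∀ t ∈ timeInterval T,
          eLpNorm (ρ t) 1 volume = eLpNorm ρ₀ 1 volume ∧
          eLpNorm (ρ t) p volume ≤ eLpNorm ρ₀ p volume *
            ENNReal.ofReal (Real.exp (C * (eLpNorm V ∞ volume).toReal *
              (eLpNorm ρ₀ 1 volume).toReal * Real.sqrt t))) ∧
    (∀ (m : ℕ) (ρ₀ : Space N → ℝ), 1 ≤ m →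
      MemH m ρ₀ → MemLp ρ₀ 1 volume → MemLp ρ₀ ∞ volume →
      ∃ C : ℝ → ℝ → ℝ → ℝ,
        (∀ a b τ : ℝ, ∃ B : ℝ, ∀ t ∈ Icc 0 τ, |C a b t| ≤ B) ∧
        ∀ (W : Space N → ℝ) (V : Space N → Space N), HasWeakGradient W V →
          MemLp V 1 volume → MemLp V ∞ volume →
        ∀ p : ℝ≥0∞, 1 ≤ p → ∀ T : EReal, 0 < T →
        ∀ ρ : ℝ → Space N → ℝ, IsMildSolution p V T ρ₀ ρ → ContinuousInH m T ρ →
        ∀ t ∈ timeInterval T,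
          normH m (ρ t) ≤
            C (eLpNorm V 1 volume).toReal (eLpNorm V ∞ volume).toReal t * normH m ρ₀) := by
  refine ⟨fun ρ₀ h0 h1 => ⟨growthConst N, growthConst_nonneg,
    fun p q hpq _ _ V _ _ hV T _ ρ h t ht => h.eLpNorm_bounds hpq.one_le hV h0 h1 ht⟩,
    fun m ρ₀ _ hH h1 _ => ?_⟩
  obtain ⟨C, hC, hbound⟩ := exists_normH_le hH h1
  exact ⟨C, hC, fun _ V _ hV1 hV p _ T _ ρ h hc t ht => hbound V hV1 hV p T ρ h hc t ht⟩
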